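/- Fix an integer $r\ge 1$. For a partition $\lambda$ put $p_{k}(\lambda)=\sum_{i\ge1}\big((\lambda_i-i+\tfrac12)^k-(-i+\tfrac12)^k\big)$, and for partitions $\lambda,\mu$ of $d$ let $\chi^\lambda_\mu$ be the value, on permutations of cycle type $\mu$, of the character of the irreducible representation of $S_d$ attached to $\lambda$. For a tuple $\mu=(\mu_1,\dots,\mu_n)$ of positive integers, $n\ge1$, with $|\mu|=\sum_i\mu_i$, and for $g\ge 0$ such that $m:=(2g+n-1)/r$ is an integer, the one-part double Hurwitz number with completed $(r+1)$-cycles is $$h_{g,|\mu|,\mu}=\frac{1}{|\mu|\prod_{i}\mu_i}\sum_{\lambda\vdash|\mu|}\chi^\lambda_{(|\mu|)}\Big(\frac{p_{r+1}(\lambda)}{(r+1)!}\Big)^{m}\chi^\lambda_{\mu}.$$ There is a unique family of complex numbers $\langle\Lambda_{2j}\tau_{d_1}\cdots\tau_{d_n}\rangle_g$ ($g,j,n\ge 0$, $d_i\ge0$), symmetric in $d_1,\dots,d_n$ and equal to zero unless $j\le g$ and $2g(r+1)+n-1=(2j+\sum_i d_i)\,r$, such that for all $g$ and $\mu$ as above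 $$h_{g,|\mu|,\mu}=\frac{m!}{|\mu|}\sum_{j=0}^{g}(-1)^j\sum_{d_1,\dots,d_n\ge0}\langle\Lambda_{2j}\tau_{d_1}\cdots\tau_{d_n}\rangle_g\,\mu_1^{d_1}\cdots\mu_n^{d_n}.$$ Define linear forms in $q_1,q_2,\dots$ by $T_0=q_1$ and $T_{k+1}=\big(u\sum_{i\ge1} i\,q_i\frac{\partial}{\partial q_i}+\sum_{i\ge1} i\,q_{i+1}\frac{\partial}{\partial q_i}\big)T_k$, and let $$G(u,q_1,q_2,\dots)=\sum_{g,\,j,\,k_0,k_1,\dots}(-1)^j\langle\Lambda_{2j}\tau_0^{k_0}\tau_1^{k_1}\cdots\rangle_g\,u^{2j}\,\frac{T_0^{k_0}}{k_0!}\frac{T_1^{k_1}}{k_1!}\cdots\in\mathbb C[[u]][[q_1,q_2,\dots]],$$ the sum being over all $g,j\ge 0$ and all finitely supported sequences $(k_i)$ that satisfy the above dimension constraint. Then for every "function" $c=c(u)$ (an element of $\mathbb C[[u]]$, of $\mathbb C((u))$, or more generally of any commutative $\mathbb C[[u]]$-algebra $A$) the series $\tau(q)=c+G$, regarded as a formal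 power series in $q_1,q_2,\dots$ with coefficients in $A$, satisfies the Hirota equations of the KP hierarchy in the (power sum) variables $q_i$, $u$ being a parameter: with $[z^{-1}]=(z^{-1},z^{-2},z^{-3},\dots)$, $$\operatorname{Res}_{z}\;\exp\Big(\sum_{k\ge1}\frac{q_k-q'_k}{k}z^k\Big)\,\tau\big(q-[z^{-1}]\big)\,\tau\big(q'+[z^{-1}]\big)\,dz=0$$ identically in $q=(q_1,q_2,\dots)$ and $q'=(q'_1,q'_2,\dots)$, where $\operatorname{Res}_z$ takes the coefficient of $z^{-1}$. -/

import Mathlib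

noncomputable section

namespace CompletedHurwitz

open Finset

/-! ### Characters of the symmetric group -/

/-- The Young diagram whose row lengths are the parts of the partition `lam`. -/
def diagram {d : ℕ} (lam : Nat.Partition d) : YoungDiagram :=
  YoungDiagram.ofRowLens (lam.parts.sort (· ≥ ·)) (Multiset.pairwise_sort _ _).sortedGE

/-- The cells of a Young diagram; the symmetric group on them plays the role of `S_d`, so that no
numbering of the cells has to be chosen. -/
abbrev Cell (Y : YoungDiagram) : Type := {c : ℕ × ℕ // c ∈ Y.cells}

open Classical in
/-- The Young symmetrizer of `Y`: the sum of all permutations preserving each row, times the signed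
sum of all permutations preserving each column, in the group algebra of the permutations of the
cells. -/
def youngSymmetrizer (Y : YoungDiagram) : MonoidAlgebra ℂ (Equiv.Perm (Cell Y)) :=
  (∑ σ : Equiv.Perm (Cell Y) with ∀ c, (σ c).1.1 = c.1.1, MonoidAlgebra.single σ (1 : ℂ)) *
  (∑ σ : Equiv.Perm (Cell Y) with ∀ c, (σ c).1.2 = c.1.2,
    MonoidAlgebra.single σ ((Equiv.Perm.sign σ : ℤ) : ℂ))

/-- The irreducible representation attached to `Y`: the left ideal of the group algebra generated
by the Young symmetrizer. -/
abbrev spechtModule (Y : YoungDiagram) : Ideal (MonoidAlgebra ℂ (Equiv.Perm (Cell Y))) :=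
  Ideal.span {youngSymmetrizer Y}

/-- The character of the irreducible representation attached to `Y`. -/
def spechtCharacter (Y : YoungDiagram) (σ : Equiv.Perm (Cell Y)) : ℂ :=
  LinearMap.trace ℂ (spechtModule Y)
    (Algebra.lsmul ℂ ℂ (spechtModule Y) (MonoidAlgebra.single σ (1 : ℂ)))

open Classical in
/-- `χ^λ_μ`: the character of the irreducible representation attached to `lam`, evaluated at any
permutation of cycle type `mu` (fixed points counted as parts equal to `1`). -/
def chi {d : ℕ} (lam mu : Nat.Partition d) : ℂ :=
  if h : ∃ σ : Equiv.Perm (Cell (diagram lam)), σ.partition.parts = mu.parts then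
    spechtCharacter (diagram lam) h.choose
  else 0

/-! ### Double Hurwitz numbers with completed cycles -/

/-- The shifted symmetric power sum `∑_{i ≥ 1} ((λ_i - i + 1/2)^k - (-i + 1/2)^k)`; the index is
shifted by one, and the summands with `i` beyond the number of rows vanish. -/
def shiftedPowerSum (k : ℕ) {d : ℕ} (lam : Nat.Partition d) : ℂ :=
  ∑ i ∈ range ((diagram lam).colLen 0),
    ((((diagram lam).rowLen i : ℂ) - (i + 1) + 1 / 2) ^ k - (-((i : ℂ) + 1) + 1 / 2) ^ k)

/-- The double Hurwitz number `h_{μ,ν}^{(r),s}` with `s` completed `(r+1)`-cycles. -/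
def hurwitz (r s : ℕ) {d : ℕ} (mu nu : Nat.Partition d) : ℂ :=
  1 / ((mu.parts.prod : ℂ) * (nu.parts.prod : ℂ)) *
    ∑ lam : Nat.Partition d,
      chi lam mu * (shiftedPowerSum (r + 1) lam / ((r + 1).factorial : ℂ)) ^ s * chi lam nu

/-- The partition of `μ_1 + ⋯ + μ_n` with parts `μ_1, …, μ_n`. -/
def tuplePartition {n : ℕ} (μ : Fin n → ℕ+) : Nat.Partition (∑ i, (μ i : ℕ)) where
  parts := univ.val.map fun i => (μ i : ℕ)
  parts_pos := by
    intro i hi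
    obtain ⟨a, -, rfl⟩ := Multiset.mem_map.mp hi
    exact (μ a).pos
  parts_sum := rfl

/-- The one-part double Hurwitz number `h_{|μ|,μ}` with `m` completed `(r+1)`-cycles. -/
def onePartHurwitz (r m : ℕ) {n : ℕ} (μ : Fin n → ℕ+) : ℂ :=
  hurwitz r m (Nat.Partition.indiscrete (∑ i, (μ i : ℕ))) (tuplePartition μ)

/-! ### The intersection numbers and their generating function -/

/-- The dimension constraint `2g(r+1) + n - 1 = (2j + ∑ d_i) r`, with `n` the number of the
`d_i`. -/
def DimensionConstraint (r g j : ℕ) (d : Multiset ℕ) : Prop :=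
  2 * g * (r + 1) + Multiset.card d = (2 * j + d.sum) * r + 1

/-- `N g j {d_1, …, d_n}` are the numbers `⟨Λ_{2j} τ_{d_1} ⋯ τ_{d_n}⟩_g`: they are symmetric in the
`d_i`, are supported where the dimension constraint holds and `j ≤ g`, and express the one-part
double Hurwitz numbers by
`h_{g,|μ|,μ} = m!/|μ| · ⟨(1 - Λ_2 + ⋯ + (-1)^g Λ_{2g}) / ∏ (1 - μ_i Ψ_i)⟩_g`, `m = (2g+n-1)/r`,
where `τ_d` stands for `Ψ^d`. -/
structure IsIntersectionNumbers (r : ℕ) (N : ℕ → ℕ → Multiset ℕ → ℂ) : Prop where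
  dimension : ∀ g j d, N g j d ≠ 0 → DimensionConstraint r g j d
  index_le : ∀ g j d, N g j d ≠ 0 → j ≤ g
  formula : ∀ (g m n : ℕ) (μ : Fin n → ℕ+), 1 ≤ n → 2 * g + n = r * m + 1 →
    onePartHurwitz r m μ = (m.factorial : ℂ) / ((∑ i, (μ i : ℕ) : ℕ) : ℂ) *
      ∑ j ∈ range (g + 1), (-1) ^ j *
        ∑ᶠ d : Fin n → ℕ, N g j (univ.val.map d) * ∏ i, ((μ i : ℕ) : ℂ) ^ d i

/-- The operator `𝓔_{0,1} = ∑ i q_i ∂/∂q_i`, on polynomials in `q_1, q_2, …` with coefficients in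
`ℂ⟦u⟧`. -/
def E01 : Derivation (PowerSeries ℂ) (MvPolynomial ℕ+ (PowerSeries ℂ))
    (MvPolynomial ℕ+ (PowerSeries ℂ)) :=
  MvPolynomial.mkDerivation _ fun i : ℕ+ => (i : ℕ) • MvPolynomial.X i

/-- The operator `𝓔_{-1,1} = ∑ i q_{i+1} ∂/∂q_i`. -/
def Em11 : Derivation (PowerSeries ℂ) (MvPolynomial ℕ+ (PowerSeries ℂ))
    (MvPolynomial ℕ+ (PowerSeries ℂ)) :=
  MvPolynomial.mkDerivation _ fun i : ℕ+ => (i : ℕ) • MvPolynomial.X (i + 1)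

/-- The linear forms `T_0 = q_1`, `T_{k+1} = (u 𝓔_{0,1} + 𝓔_{-1,1}) T_k`. -/
def T : ℕ → MvPolynomial ℕ+ (PowerSeries ℂ)
  | 0 => MvPolynomial.X 1
  | k + 1 => (PowerSeries.X : PowerSeries ℂ) • E01 (T k) + Em11 (T k)

/-- The summand `(-1)^j ⟨Λ_{2j} τ_0^{k_0} τ_1^{k_1} ⋯⟩_g u^{2j} ∏ T_i^{k_i} / k_i!`. -/
def gTerm (N : ℕ → ℕ → Multiset ℕ → ℂ) (g j : ℕ) (k : ℕ →₀ ℕ) :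
    MvPolynomial ℕ+ (PowerSeries ℂ) :=
  (PowerSeries.C ((-1) ^ j * N g j (Finsupp.toMultiset k)) * PowerSeries.X ^ (2 * j)) •
    k.prod fun i m => PowerSeries.C ((m.factorial : ℂ)⁻¹) • T i ^ m

/-- The generating series `G(u, q_1, q_2, …)`. Since `T_i` is a combination of the `u^{i+1-b} q_b`,
only finitely many summands contribute to a given monomial in `u` and the `q_i`. -/
def G (r : ℕ) (N : ℕ → ℕ → Multiset ℕ → ℂ) : MvPowerSeries ℕ+ (PowerSeries ℂ) :=
  fun e => PowerSeries.mk fun a =>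
    ∑ᶠ x ∈ {x : ℕ × ℕ × (ℕ →₀ ℕ) |
        DimensionConstraint r x.1 x.2.1 (Finsupp.toMultiset x.2.2)},
      PowerSeries.coeff a (MvPolynomial.coeff e (gTerm N x.1 x.2.1 x.2.2))

/-! ### The Hirota equations -/

/-- The coefficient of `z^n` in `exp (∑_{k ≥ 1} x_k z^k)`. -/
def expCoeff {B : Type*} [Ring B] [Algebra ℚ B] (x : ℕ+ → B) (n : ℕ) : B :=
  ∑ m ∈ range (n + 1), ((m.factorial : ℚ)⁻¹) •
    PowerSeries.coeff n
      ((PowerSeries.mk fun k => if h : 0 < k then x ⟨k, h⟩ else 0) ^ m)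

/-- For a sign `ε`, the coefficient of `z^{-n}` in
`τ(q_1 + ε z^{-1}, q_2 + ε z^{-2}, …) = exp (ε ∑ z^{-k} ∂/∂q_k) τ`. -/
def shiftCoeff {A : Type*} [CommRing A] [Algebra ℚ A] (ε : ℤ) (n : ℕ)
    (τ : MvPowerSeries ℕ+ A) : MvPowerSeries ℕ+ A :=
  expCoeff (fun k : ℕ+ =>
    ε • ((MvPowerSeries.pderiv A k : Derivation A _ _) :
      Module.End A (MvPowerSeries ℕ+ A))) n τ

/-- A series in the variables `q` as a series in the variables `q, q'`. -/
def inQ {A : Type*} [CommRing A] : MvPowerSeries ℕ+ A →ₐ[A] MvPowerSeries (ℕ+ ⊕ ℕ+) A :=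
  MvPowerSeries.rename Function.Embedding.inl

/-- A series in the variables `q`, with `q` replaced by `q'`, as a series in `q, q'`. -/
def inQ' {A : Type*} [CommRing A] : MvPowerSeries ℕ+ A →ₐ[A] MvPowerSeries (ℕ+ ⊕ ℕ+) A :=
  MvPowerSeries.rename Function.Embedding.inr

/-- The contribution to the coefficient of `z^{-1}` in
`exp (∑ (q_k - q'_k) z^k / k) · τ(q - [z⁻¹]) · τ(q' + [z⁻¹])`, `[z⁻¹] = (z⁻¹, z⁻², z⁻³, …)`,
of the coefficient of `z^j` of the exponential. -/
def hirotaTerm {A : Type*} [CommRing A] [Algebra ℚ A] (τ : MvPowerSeries ℕ+ A) (j : ℕ) :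
    MvPowerSeries (ℕ+ ⊕ ℕ+) A :=
  expCoeff (fun k : ℕ+ => ((k : ℕ) : ℚ)⁻¹ •
      (MvPowerSeries.X (Sum.inl k) - MvPowerSeries.X (Sum.inr k) :
        MvPowerSeries (ℕ+ ⊕ ℕ+) A)) j *
    ∑ ab ∈ antidiagonal (j + 1),
      inQ (shiftCoeff (-1) ab.1 τ) * inQ' (shiftCoeff 1 ab.2 τ)

/-- `τ` solves the Hirota equations of the KP hierarchy in the power sum variables `q_i` (that is,
with times `t_i = q_i / i`):
`Res_z exp (∑ (q_k - q'_k) z^k / k) τ(q - [z⁻¹]) τ(q' + [z⁻¹]) dz = 0`.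
The residue is the sum of all `hirotaTerm τ j`, which converges coefficientwise. -/
def SolvesHirota {A : Type*} [CommRing A] [Algebra ℚ A] (τ : MvPowerSeries ℕ+ A) : Prop :=
  ∀ e : (ℕ+ ⊕ ℕ+) →₀ ℕ, ∀ᶠ M in Filter.atTop,
    MvPowerSeries.coeff e (∑ j ∈ range M, hirotaTerm τ j) = 0

end CompletedHurwitz

end

/-! ### Exponentials of power series and derivations acting on their coefficients. -/

noncomputable section

namespace CompletedHurwitz

open Finset

/-! ### Cancellation in `ℚ`-algebras -/

/-! In the variables `q`, the series `G` is a combination of Schur functions of hooks only, and the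
coefficient of the hook with arm `i` and leg `j` is, up to sign, a product `A_i B_j`. Adding any
constant to such a series gives a KP tau function: the Plücker relations come down to the vanishing
of the 2×2 minors of the rank-one matrix `(A_i B_j)`, so the value of `c` never matters.

Schur functions do not appear in the argument. The shape of the series is recorded by its
derivatives in `IsHookSeries`: there are sequences `a_i`, `b_j` of series with `k ∂_k a_i =
a_{i+k}`, `k ∂_k b_j = -b_{j+k}` and `k ∂_k τ = ∑_{i+j=k-1} a_i b_j`. Then `τ(q - [z⁻¹]) = τ - a_0 ∑
b_n z^{-n-1}` and `τ(q' + [z⁻¹]) = τ' + b'_0 ∑ a'_n z^{-n-1}`, where a prime marks series in `q'`.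
Pairing with the exponential produces three Taylor-type sums, equal to `a_0`, `b'_0` and `τ - τ'`,
and the residue is `τ b'_0 a_0 - τ' a_0 b'_0 - a_0 b'_0 (τ - τ') = 0` (`IsHookSeries.solvesHirota`).
By `isHookSeries_of_coeff`, a series has this shape as soon as its coefficients are the values of
the functional `X^i Y^j ↦ A_i B_j` on the quotients `V = ∏ ((X^k - Y^k)/k)^{e_k} / (X - Y)`.

Three facts give `G` such coefficients.

Characters. In the group algebra, the sums of hook Young symmetrizers satisfy a Pieri rule, and the
coefficients of the products "symmetrizer times antisymmetrizer" count invariant subsets with signs.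
This makes `∏ (X^{μ_i} - Y^{μ_i}) / (X - Y)` the generating function of the hook characters
(`sub_mul_hookPoly`, `trace_hookElement`). An alternating sum of the hook elements is a multiple of
the sum of the long cycles and kills every non-hook Specht module (`spechtCharacter_eq_zero`). So a
one-part Hurwitz number is the value of the functional `X^i Y^j ↦ Q(i,j)^m` on this quotient, with
`Q` the content of the hook (`onePartHurwitz_eq`).

Polynomiality. The quotient is homogeneous, so `i + j + 1 = |μ|`, and `Q^m` becomes a polynomial in
`(i - j)/2` with powers of `|μ|` as coefficients. The substitution `X = e^{z/2}`, `Y = e^{-z/2}`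
then gives a polynomial in `μ` (`contentFunctional_eq_eval`). The degrees of its monomials determine
`j`, whence existence and uniqueness of the intersection numbers.

Change of variables. The coefficients of `T_d` are iterated differences of `x^d`, so inserting the
`T_d` amounts to the substitution `X ↦ X - 1`, `Y ↦ Y - 1` (`contentFunctional_shiftHom`). Summed
over `m` with weight `u^{(r+1)m}/m!`, the functional becomes `X^i Y^j ↦ exp(u^{r+1} Q(i,j))`. It
factors, since `Q` is a function of `i` plus a function of `j`. The substitution replaces the
factors by their differences of orders `i` and `j`, which are divisible by `u^i` and `u^j`; the
quotients are `A_i` and `B_j`. The dimension constraint supplies exactly this division by `u^{i+j}`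
(`isHookSeries_G`). -/

theorem eq_zero_of_mul_natCast_add_one {A : Type*} [CommRing A] [Algebra ℚ A] {a : A} {n : ℕ}
    (h : a * ((n : A) + 1) = 0) : a = 0 := by
  have h1 : ((n : A) + 1) * algebraMap ℚ A ((n : ℚ) + 1)⁻¹ = 1 := by
    have : (n : A) + 1 = algebraMap ℚ A ((n : ℚ) + 1) := by simp
    rw [this, ← map_mul, mul_inv_cancel₀ (by positivity), map_one]
  calc a = a * (((n : A) + 1) * algebraMap ℚ A ((n : ℚ) + 1)⁻¹) := by rw [h1, mul_one]
    _ = 0 := by rw [← mul_assoc, h, zero_mul]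

theorem smul_natCast_add_one_cancel {M : Type*} [AddCommGroup M] [Module ℚ M] {a b : M} {n : ℕ}
    (h : (n + 1) • a = (n + 1) • b) : a = b := by
  have h' : ((n + 1 : ℕ) : ℚ) • a = ((n + 1 : ℕ) : ℚ) • b := by
    rwa [Nat.cast_smul_eq_nsmul, Nat.cast_smul_eq_nsmul]
  have hn : ((n + 1 : ℕ) : ℚ) ≠ 0 := by positivity
  exact smul_right_injective M hn h'

/-! ### The exponential of a series without constant term -/

section Exp

/-- The series `∑_{k ≥ 1} x_k z^k`. -/
def noConstSeries {B : Type*} [Ring B] (x : ℕ+ → B) : PowerSeries B :=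
  PowerSeries.mk fun k => if h : 0 < k then x ⟨k, h⟩ else 0

theorem map_expCoeff {B B' : Type*} [Ring B] [Algebra ℚ B] [Ring B'] [Algebra ℚ B']
    (φ : B →ₐ[ℚ] B') (x : ℕ+ → B) (n : ℕ) :
    φ (expCoeff x n) = expCoeff (fun k => φ (x k)) n := by
  unfold expCoeff
  rw [map_sum]
  refine sum_congr rfl fun m _ => ?_
  rw [map_smul]
  congr 1
  have h : (PowerSeries.mk fun k => if h : 0 < k then φ (x ⟨k, h⟩) else 0) =
      PowerSeries.map (φ : B →+* B')
        (PowerSeries.mk fun k => if h : 0 < k then x ⟨k, h⟩ else 0) := by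
    ext k
    by_cases hk : 0 < k <;> simp [hk]
  rw [h, ← map_pow, PowerSeries.coeff_map]
  rfl

theorem expCoeff_zero {B : Type*} [Ring B] [Algebra ℚ B] (x : ℕ+ → B) : expCoeff x 0 = 1 := by
  simp [expCoeff]

theorem coeff_noConstSeries_pow_of_lt {B : Type*} [CommRing B] (x : ℕ+ → B) {m n : ℕ} (h : n < m) :
    PowerSeries.coeff n (noConstSeries x ^ m) = 0 := by
  have h1 : (PowerSeries.X : PowerSeries B) ∣ noConstSeries x := by
    rw [PowerSeries.X_dvd_iff]
    simp [noConstSeries, ← PowerSeries.coeff_zero_eq_constantCoeff_apply]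
  exact PowerSeries.X_pow_dvd_iff.mp (pow_dvd_pow_of_dvd h1 m) n h

variable {B : Type*} [CommRing B] [Algebra ℚ B] (x : ℕ+ → B)

theorem expCoeff_eq_coeff {M n : ℕ} (h : n < M) :
    expCoeff x n = PowerSeries.coeff n
      (∑ m ∈ range M, ((m.factorial : ℚ)⁻¹) • noConstSeries x ^ m) := by
  unfold expCoeff
  rw [map_sum]
  have h1 : range (n + 1) ⊆ range M := by
    intro i hi; simp only [mem_range] at *; omega
  rw [← sum_subset h1]
  · refine sum_congr rfl fun m _ => ?_
    rw [← PowerSeries.coeff_smul]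
    rfl
  · intro m _ hm
    rw [mem_range, not_lt] at hm
    rw [PowerSeries.coeff_smul, coeff_noConstSeries_pow_of_lt x (by omega), smul_zero]

/-- `E' = f' E` for `E = exp f`, in terms of coefficients. -/
theorem succ_smul_expCoeff (n : ℕ) :
    (n + 1) • expCoeff x (n + 1) =
      ∑ ij ∈ antidiagonal n, (ij.1 + 1) • x ij.1.succPNat * expCoeff x ij.2 := by
  -- The truncated exponentials satisfy the equation exactly, with one term fewer on the right, so
  -- no infinite sum is needed.
  have h1 : PowerSeries.derivative B
      (∑ m ∈ range (n + 2), ((m.factorial : ℚ)⁻¹) • noConstSeries x ^ m) =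
      PowerSeries.derivative B (noConstSeries x) *
        ∑ m ∈ range (n + 1), ((m.factorial : ℚ)⁻¹) • noConstSeries x ^ m := by
    rw [sum_range_succ', map_add, map_sum, mul_sum]
    have h0 : PowerSeries.derivative B
        (((Nat.factorial 0 : ℚ)⁻¹) • noConstSeries x ^ 0) = 0 := by simp
    rw [h0, add_zero]
    refine sum_congr rfl fun m _ => ?_
    have : ∀ (c : ℚ) (f : PowerSeries B),
        PowerSeries.derivative B (c • f) = c • PowerSeries.derivative B f := by
      intro c f
      rw [← algebraMap_smul B c f, Derivation.map_smul, algebraMap_smul]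
    rw [this, PowerSeries.derivative_pow]
    have h2 : ((m + 1).factorial : ℚ)⁻¹ • (((m + 1 : ℕ) : PowerSeries B) *
        noConstSeries x ^ (m + 1 - 1) * PowerSeries.derivative B (noConstSeries x)) =
        (((m + 1).factorial : ℚ)⁻¹ * ((m + 1 : ℕ) : ℚ)) •
        (PowerSeries.derivative B (noConstSeries x) * noConstSeries x ^ m) := by
      rw [mul_smul, Nat.cast_smul_eq_nsmul, nsmul_eq_mul, Nat.add_sub_cancel]
      congr 1
      ring
    rw [h2, mul_smul_comm]
    congr 1
    rw [Nat.factorial_succ]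
    push_cast
    have : (m : ℚ) + 1 ≠ 0 := by positivity
    have : (m.factorial : ℚ) ≠ 0 := by positivity
    field_simp
  have h2 := congrArg (PowerSeries.coeff n) h1
  rw [PowerSeries.coeff_derivative, ← expCoeff_eq_coeff x (by omega), PowerSeries.coeff_mul] at h2
  rw [nsmul_eq_mul, mul_comm]
  push_cast
  rw [h2]
  refine sum_congr rfl fun ij hij => ?_
  have := HasAntidiagonal.mem_antidiagonal.mp hij
  rw [← expCoeff_eq_coeff x (by omega), PowerSeries.coeff_derivative]
  simp [noConstSeries, Nat.succPNat, mul_comm]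

end Exp

/-- Commuting elements generate a commutative subalgebra, where the commutative recursion applies.
This is needed for the operators `∂/∂q_k`, which live in a noncommutative endomorphism ring. -/
theorem succ_smul_expCoeff_of_commute {B : Type*} [Ring B] [Algebra ℚ B] (x : ℕ+ → B)
    (hx : ∀ i j, x i * x j = x j * x i) (n : ℕ) :
    (n + 1) • expCoeff x (n + 1) =
      ∑ ij ∈ antidiagonal n, (ij.1 + 1) • x ij.1.succPNat * expCoeff x ij.2 := by
  have hc := Algebra.isMulCommutative_adjoin ℚ (s := Set.range x) (by
    rintro _ ⟨i, rfl⟩ _ ⟨j, rfl⟩; exact hx i j)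
  let _ : CommRing (Algebra.adjoin ℚ (Set.range x)) := open scoped IsMulCommutative in inferInstance
  let y : ℕ+ → Algebra.adjoin ℚ (Set.range x) := fun k =>
    ⟨x k, Algebra.subset_adjoin ⟨k, rfl⟩⟩
  have h := congrArg (Algebra.adjoin ℚ (Set.range x)).val (succ_smul_expCoeff y n)
  rw [map_nsmul, map_expCoeff, map_sum] at h
  refine h.trans (sum_congr rfl fun ij _ => ?_)
  rw [map_mul, map_nsmul, map_expCoeff]
  rfl

/-- A derivation that acts on the `y_i = i x_i` by `y_k ↦ k c` and kills the other ones shifts the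
coefficients of the exponential. -/
theorem derivation_expCoeff {R B : Type*} [CommRing R] [CommRing B] [Algebra R B] [Algebra ℚ B]
    (x : ℕ+ → B) (δ : Derivation R B B) (k : ℕ) (c : ℤ)
    (hδ : ∀ i : ℕ, (i + 1) • δ (x i.succPNat) = if i + 1 = k then (k * c : ℤ) • (1 : B) else 0)
    (n : ℕ) :
    δ (expCoeff x n) = if k ≤ n ∧ 0 < k then c • expCoeff x (n - k) else 0 := by
  induction n using Nat.strong_induction_on with
  | _ n ih =>
    rcases n with _ | n
    · rw [expCoeff_zero, Derivation.map_one_eq_zero, if_neg (by omega)]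
    · apply smul_natCast_add_one_cancel (n := n)
      have h1 := congrArg δ (succ_smul_expCoeff x n)
      rw [map_nsmul, map_sum] at h1
      rw [h1]
      -- Leibniz rule: `δ` hits either the factor `x`, which leaves only the index `k`, or the lower
      -- coefficient, which is known by induction.
      have h2 : ∀ ij ∈ antidiagonal n,
          δ ((ij.1 + 1) • x ij.1.succPNat * expCoeff x ij.2) =
          (if ij.1 + 1 = k then (k * c : ℤ) • expCoeff x ij.2 else 0) +
          (if k ≤ ij.2 ∧ 0 < k then
            c • ((ij.1 + 1) • x ij.1.succPNat * expCoeff x (ij.2 - k)) else 0) := by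
        intro ij hij
        have hlt : ij.2 < n + 1 := by have := HasAntidiagonal.mem_antidiagonal.mp hij; omega
        rw [Derivation.leibniz, ih _ hlt, map_nsmul, hδ, add_comm]
        congr 1
        · split_ifs <;> simp [mul_comm]
        · split_ifs <;> simp [mul_left_comm]
      rw [sum_congr rfl h2, sum_add_distrib]
      by_cases hk : k ≤ n + 1 ∧ 0 < k
      · obtain ⟨hk1, hk0⟩ := hk
        rw [if_pos ⟨hk1, hk0⟩]
        have h3 : ∑ ij ∈ antidiagonal n,
            (if ij.1 + 1 = k then (k * c : ℤ) • expCoeff x ij.2 else 0) =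
            (k * c : ℤ) • expCoeff x (n + 1 - k) := by
          rw [sum_eq_single (k - 1, n + 1 - k)]
          · rw [if_pos (by simp; omega)]
          · rintro ⟨i, j⟩ hij hne
            rw [if_neg]
            intro h
            apply hne
            have := HasAntidiagonal.mem_antidiagonal.mp hij
            simp only [Prod.mk.injEq] at *
            omega
          · intro h
            exact absurd (HasAntidiagonal.mem_antidiagonal.mpr (by simp; omega)) h
        have h4 : ∑ ij ∈ antidiagonal n, (if k ≤ ij.2 ∧ 0 < k then
            c • ((ij.1 + 1) • x ij.1.succPNat * expCoeff x (ij.2 - k)) else 0) =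
            c • ((n + 1 - k) • expCoeff x (n + 1 - k)) := by
          by_cases hkn : k ≤ n
          · obtain ⟨m, rfl⟩ := Nat.exists_eq_add_of_le hkn
            rw [show k + m + 1 - k = m + 1 by omega, succ_smul_expCoeff, smul_sum,
              ← sum_filter]
            refine (sum_bij (fun ij _ => (ij.1, ij.2 + k)) ?_ ?_ ?_ ?_).symm
            · rintro ⟨i, j⟩ hij
              simp only [mem_filter, HasAntidiagonal.mem_antidiagonal] at *
              omega
            · rintro ⟨i, j⟩ _ ⟨i', j'⟩ _ h
              simpa using h
            · rintro ⟨i, j⟩ hij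
              simp only [mem_filter, HasAntidiagonal.mem_antidiagonal] at hij
              exact ⟨(i, j - k), by simp; omega, by simp; omega⟩
            · rintro ⟨i, j⟩ _
              simp
          · rw [show n + 1 - k = 0 by omega, zero_smul, smul_zero]
            apply sum_eq_zero
            rintro ⟨i, j⟩ hij
            rw [if_neg]
            have := HasAntidiagonal.mem_antidiagonal.mp hij
            simp at *; omega
        -- The two contributions are `k c` and `(n + 1 - k) c` times the same coefficient, and they
        -- add up to `(n + 1) c`.
        rw [h3, h4]
        rw [← natCast_zsmul _ (n + 1 - k), ← natCast_zsmul _ (n + 1), smul_smul, smul_smul, ← add_smul]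
        congr 1
        push_cast [hk1]
        ring
      · rw [if_neg hk, smul_zero]
        rw [sum_eq_zero, sum_eq_zero, add_zero]
        · rintro ⟨i, j⟩ hij
          rw [if_neg]
          have := HasAntidiagonal.mem_antidiagonal.mp hij
          simp at *; omega
        · rintro ⟨i, j⟩ hij
          rw [if_neg]
          have := HasAntidiagonal.mem_antidiagonal.mp hij
          simp at *; omega

end CompletedHurwitz

end

/-! ### Series of hook type, their shifts by `[z⁻¹]`, and the weight filtration. -/

noncomputable section

namespace CompletedHurwitz

open Finset

/-! ### Shifted series of hook type -/

theorem pderiv_pderiv_comm {σ A : Type*} [CommRing A] (i j : σ) (f : MvPowerSeries σ A) :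
    MvPowerSeries.pderiv A i (MvPowerSeries.pderiv A j f) =
      MvPowerSeries.pderiv A j (MvPowerSeries.pderiv A i f) := by
  classical
  ext n
  simp only [MvPowerSeries.coeff_pderiv, Finsupp.add_apply, Finsupp.single_apply]
  rw [add_right_comm]
  by_cases h : i = j
  · subst h; rfl
  · rw [if_neg h, if_neg (Ne.symm h)]
    push_cast
    ring

/-- Series `τ` whose derivatives factor through two sequences of series `a`, `b` on which the
derivations `k ∂/∂q_k` act by shifts. -/
structure IsHookSeries {A : Type*} [CommRing A] (a b : ℕ → MvPowerSeries ℕ+ A)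
    (τ : MvPowerSeries ℕ+ A) : Prop where
  left : ∀ k i, (k + 1) • MvPowerSeries.pderiv A k.succPNat (a i) = a (i + (k + 1))
  right : ∀ k i, (k + 1) • MvPowerSeries.pderiv A k.succPNat (b i) = -b (i + (k + 1))
  total : ∀ k, (k + 1) • MvPowerSeries.pderiv A k.succPNat τ =
    ∑ ij ∈ antidiagonal k, a ij.1 * b ij.2

theorem IsHookSeries.smul_pderiv_mul {A : Type*} [CommRing A] {a b : ℕ → MvPowerSeries ℕ+ A}
    {τ : MvPowerSeries ℕ+ A} (h : IsHookSeries a b τ) (k i j : ℕ) :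
    (k + 1) • MvPowerSeries.pderiv A k.succPNat (a i * b j) =
      a (i + (k + 1)) * b j - a i * b (j + (k + 1)) := by
  rw [Derivation.leibniz, smul_add, ← smul_comm (a i), ← smul_comm (b j), h.left, h.right]
  simp only [smul_eq_mul]
  ring

variable {A : Type*} [CommRing A] [Algebra ℚ A]

theorem shiftCoeff_zero (ε : ℤ) (τ : MvPowerSeries ℕ+ A) : shiftCoeff ε 0 τ = τ := by
  simp [shiftCoeff, expCoeff_zero]

theorem succ_smul_shiftCoeff (ε : ℤ) (n : ℕ) (τ : MvPowerSeries ℕ+ A) :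
    (n + 1) • shiftCoeff ε (n + 1) τ = ∑ ij ∈ antidiagonal n,
      ε • (ij.1 + 1) • MvPowerSeries.pderiv A ij.1.succPNat (shiftCoeff ε ij.2 τ) := by
  have h := succ_smul_expCoeff_of_commute (B := Module.End A (MvPowerSeries ℕ+ A))
    (fun k : ℕ+ => ε • ((MvPowerSeries.pderiv A k : Derivation A _ _) :
      Module.End A (MvPowerSeries ℕ+ A))) (by
    intro i j
    rw [smul_mul_smul_comm, smul_mul_smul_comm]
    congr 1
    ext1 f
    exact pderiv_pderiv_comm i j f) n
  have h2 := LinearMap.congr_fun h τ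
  rw [LinearMap.smul_apply, LinearMap.sum_apply] at h2
  refine h2.trans (sum_congr rfl fun ij _ => ?_)
  rw [Module.End.mul_apply, LinearMap.smul_apply, LinearMap.smul_apply, smul_comm]
  rfl

namespace IsHookSeries

variable {a b : ℕ → MvPowerSeries ℕ+ A} {τ : MvPowerSeries ℕ+ A}

/-- In the recursion for the shift, the products `a_i b_j` coming from `k ∂_k τ` cancel against
those coming from the lower coefficients, except for the copies of `a_0 b_n`; these occur `n + 1`
times. -/
theorem shiftCoeff_neg_one (h : IsHookSeries a b τ) (n : ℕ) :
    shiftCoeff (-1) (n + 1) τ = -(a 0 * b n) := by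
  induction n using Nat.strong_induction_on with
  | _ n ih =>
    apply smul_natCast_add_one_cancel (n := n)
    rw [succ_smul_shiftCoeff]
    rcases n with _ | n
    · simpa [shiftCoeff_zero] using h.total 0
    · rw [Nat.sum_antidiagonal_succ', shiftCoeff_zero, h.total, Nat.sum_antidiagonal_succ]
      have h1 : ∀ ij ∈ antidiagonal n, (-1 : ℤ) • (ij.1 + 1) •
          MvPowerSeries.pderiv A ij.1.succPNat (shiftCoeff (-1) (ij.2 + 1) τ) =
          a (ij.1 + 1) * b ij.2 - a 0 * b (n + 1) := by
        intro ij hij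
        have h2 := HasAntidiagonal.mem_antidiagonal.mp hij
        rw [ih _ (by omega), map_neg, smul_neg, neg_smul, one_smul, neg_neg, h.smul_pderiv_mul,
          zero_add, show ij.2 + (ij.1 + 1) = n + 1 by omega]
      rw [sum_congr rfl h1, sum_sub_distrib, sum_const, Nat.card_antidiagonal]
      simp only [nsmul_eq_mul, neg_smul, one_smul]
      push_cast
      ring

/-- The cancellation is as for the opposite sign of the shift, but the surviving products are now
those with `b_0`. -/
theorem shiftCoeff_one (h : IsHookSeries a b τ) (n : ℕ) :
    shiftCoeff 1 (n + 1) τ = a n * b 0 := by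
  induction n using Nat.strong_induction_on with
  | _ n ih =>
    apply smul_natCast_add_one_cancel (n := n)
    rw [succ_smul_shiftCoeff]
    rcases n with _ | n
    · simpa [shiftCoeff_zero] using h.total 0
    · rw [Nat.sum_antidiagonal_succ', shiftCoeff_zero, h.total, Nat.sum_antidiagonal_succ']
      have h1 : ∀ ij ∈ antidiagonal n, (1 : ℤ) • (ij.1 + 1) •
          MvPowerSeries.pderiv A ij.1.succPNat (shiftCoeff 1 (ij.2 + 1) τ) =
          a (n + 1) * b 0 - a ij.2 * b (ij.1 + 1) := by
        intro ij hij
        have h2 := HasAntidiagonal.mem_antidiagonal.mp hij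
        rw [ih _ (by omega), one_smul, h.smul_pderiv_mul,
          zero_add, show ij.2 + (ij.1 + 1) = n + 1 by omega]
      rw [sum_congr rfl h1, sum_sub_distrib, sum_const, Nat.card_antidiagonal,
        ← Nat.sum_antidiagonal_swap (f := fun ij : ℕ × ℕ => a ij.2 * b (ij.1 + 1))]
      simp only [nsmul_eq_mul, one_smul, Prod.fst_swap, Prod.snd_swap]
      push_cast
      ring

end IsHookSeries

/-! ### The filtration by weight -/

/-- The series all of whose terms have weight at least `M`. -/
def weightIdeal (A : Type*) [CommRing A] {ι : Type*} (w : ι → ℕ) (M : ℕ) :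
    Ideal (MvPowerSeries ι A) where
  carrier := {f | ∀ e, Finsupp.weight w e < M → MvPowerSeries.coeff e f = 0}
  add_mem' hf hg e he := by rw [map_add, hf e he, hg e he, add_zero]
  zero_mem' e _ := by simp
  smul_mem' c f hf e he := by
    classical
    rw [smul_eq_mul, MvPowerSeries.coeff_mul]
    refine sum_eq_zero fun p hp => ?_
    rw [hf p.2, mul_zero]
    rw [← HasAntidiagonal.mem_antidiagonal.mp hp, map_add] at he
    omega

theorem weightIdeal_anti {A : Type*} [CommRing A] {ι : Type*} (w : ι → ℕ) {M M' : ℕ} (h : M ≤ M') :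
    weightIdeal A w M' ≤ weightIdeal A w M := fun _ hf e he => hf e (by omega)

/-- A nonconstant monomial contains some variable, and its coefficient can be recovered from the
derivative in that variable because positive integers are invertible. This is the induction device
for the identities below: compare constant terms, then derivatives at lower weight. -/
theorem mem_weightIdeal_of_pderiv {ι : Type*} {w : ι → ℕ} (hw : ∀ i, 0 < w i) {M : ℕ}
    {f : MvPowerSeries ι A} (h0 : 0 < M → MvPowerSeries.constantCoeff f = 0)
    (h : ∀ i, w i < M → w i • MvPowerSeries.pderiv A i f ∈ weightIdeal A w (M - w i)) :
    f ∈ weightIdeal A w M := by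
  intro e he
  by_cases he0 : e = 0
  · rw [he0, MvPowerSeries.coeff_zero_eq_constantCoeff_apply, h0 (by omega)]
  · obtain ⟨i, hi⟩ := Finsupp.ne_iff.mp he0
    have hle : Finsupp.single i 1 ≤ e := by
      rw [Finsupp.single_le_iff]; exact Nat.one_le_iff_ne_zero.mpr hi
    obtain ⟨e', rfl⟩ := exists_add_of_le hle
    rw [map_add, Finsupp.weight_single, one_smul] at he
    have h1 := h i (by omega) e' (by omega)
    obtain ⟨n, hn⟩ := Nat.exists_eq_succ_of_ne_zero (hw i).ne'
    rw [hn, map_nsmul, nsmul_eq_mul, mul_comm] at h1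
    push_cast at h1
    have h2 := eq_zero_of_mul_natCast_add_one h1
    rw [MvPowerSeries.coeff_pderiv, add_comm] at h2
    exact eq_zero_of_mul_natCast_add_one h2

end CompletedHurwitz

end

/-! ### The Hirota equations for series of hook type. -/

noncomputable section

namespace CompletedHurwitz

open Finset

set_option linter.unusedSectionVars false

/-! ### The Hirota equations for series of hook type -/

section Rename

variable {A : Type*} [CommRing A] {σ υ : Type*}

theorem pderiv_rename (e : σ ↪ υ) (i : σ) (f : MvPowerSeries σ A) :
    MvPowerSeries.pderiv A (e i) (MvPowerSeries.rename e f) =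
      MvPowerSeries.rename e (MvPowerSeries.pderiv A i f) := by
  classical
  ext x
  rw [MvPowerSeries.coeff_pderiv]
  by_cases hx : x ∈ Set.range (Finsupp.embDomain e)
  · obtain ⟨y, rfl⟩ := hx
    rw [← Finsupp.embDomain_single, ← Finsupp.embDomain_add,
      MvPowerSeries.coeff_embDomain_rename, MvPowerSeries.coeff_embDomain_rename,
      MvPowerSeries.coeff_pderiv, Finsupp.embDomain_apply_self]
  · have key : ∀ z : υ →₀ ℕ, z ∉ Set.range (Finsupp.embDomain e) →
        ∃ u ∉ Set.range e, z u ≠ 0 := by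
      intro z hz
      by_contra! hcon
      refine hz ⟨z.comapDomain e e.injective.injOn, ?_⟩
      apply Finsupp.embDomain_comapDomain
      intro u hu
      by_contra h
      exact (Finsupp.mem_support_iff.mp hu) (hcon u h)
    obtain ⟨u, hu, hxu⟩ := key x hx
    have h0 : ∀ (z : υ →₀ ℕ) (g : MvPowerSeries σ A), z u ≠ 0 →
        MvPowerSeries.coeff z (MvPowerSeries.rename e g) = 0 := by
      intro z g hz
      apply MvPowerSeries.coeff_rename_eq_zero
      rintro ⟨y, rfl⟩
      apply hz
      rw [← Finsupp.embDomain_eq_mapDomain, Finsupp.embDomain_of_notMem_range _ _ _ hu]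
    rw [h0 _ _ hxu, h0 _ _ (by simp [hxu]), zero_mul]

theorem pderiv_rename_of_notMem_range (e : σ ↪ υ) (u : υ) (hu : u ∉ Set.range e)
    (f : MvPowerSeries σ A) :
    MvPowerSeries.pderiv A u (MvPowerSeries.rename e f) = 0 := by
  classical
  ext x
  rw [MvPowerSeries.coeff_pderiv, MvPowerSeries.coeff_rename_eq_zero, zero_mul, map_zero]
  rintro ⟨y, hy⟩
  have h := DFunLike.congr_fun hy u
  rw [← Finsupp.embDomain_eq_mapDomain, Finsupp.embDomain_of_notMem_range _ _ _ hu] at h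
  simp at h

end Rename

/-- The pairs are separated according to whether the first entry is at most `k`. -/
theorem sum_antidiagonal_add_succ {M : Type*} [AddCommMonoid M] (f : ℕ × ℕ → M) (j k : ℕ) :
    ∑ p ∈ antidiagonal (j + 1 + k), f p =
      ∑ p ∈ antidiagonal k, f (p.1, p.2 + (j + 1)) +
        ∑ p ∈ antidiagonal j, f (p.1 + (k + 1), p.2) := by
  induction k generalizing f with
  | zero => simp [Nat.sum_antidiagonal_succ]
  | succ k ih =>
    rw [← add_assoc, Nat.sum_antidiagonal_succ, ih (fun p => f (p.1 + 1, p.2)),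
      Nat.sum_antidiagonal_succ, ← add_assoc]
    simp only [add_assoc, add_comm, add_left_comm]

variable {A : Type*} [CommRing A]

theorem pderiv_inl_inQ (k : ℕ+) (f : MvPowerSeries ℕ+ A) :
    MvPowerSeries.pderiv A (Sum.inl k) (inQ f) = inQ (MvPowerSeries.pderiv A k f) :=
  pderiv_rename Function.Embedding.inl k f

theorem pderiv_inr_inQ' (k : ℕ+) (f : MvPowerSeries ℕ+ A) :
    MvPowerSeries.pderiv A (Sum.inr k) (inQ' f) = inQ' (MvPowerSeries.pderiv A k f) :=
  pderiv_rename Function.Embedding.inr k f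

theorem pderiv_inr_inQ (k : ℕ+) (f : MvPowerSeries ℕ+ A) :
    MvPowerSeries.pderiv A (Sum.inr k) (inQ f) = 0 :=
  pderiv_rename_of_notMem_range Function.Embedding.inl _ (by simp) f

theorem pderiv_inl_inQ' (k : ℕ+) (f : MvPowerSeries ℕ+ A) :
    MvPowerSeries.pderiv A (Sum.inl k) (inQ' f) = 0 :=
  pderiv_rename_of_notMem_range Function.Embedding.inr _ (by simp) f

theorem constantCoeff_inQ (f : MvPowerSeries ℕ+ A) :
    MvPowerSeries.constantCoeff (inQ f) = MvPowerSeries.constantCoeff f :=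
  MvPowerSeries.constantCoeff_rename _ f

theorem constantCoeff_inQ' (f : MvPowerSeries ℕ+ A) :
    MvPowerSeries.constantCoeff (inQ' f) = MvPowerSeries.constantCoeff f :=
  MvPowerSeries.constantCoeff_rename _ f

/-- The weight of the variables `q_k` and `q'_k` is `k`. -/
def doubleWeight : ℕ+ ⊕ ℕ+ → ℕ := Sum.elim (fun k => (k : ℕ)) fun k => (k : ℕ)

theorem doubleWeight_pos (i : ℕ+ ⊕ ℕ+) : 0 < doubleWeight i := by
  rcases i with i | i <;> exact i.pos

theorem doubleWeight_inl (k : ℕ) : doubleWeight (Sum.inl k.succPNat) = k + 1 := rfl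

theorem doubleWeight_inr (k : ℕ) : doubleWeight (Sum.inr k.succPNat) = k + 1 := rfl

theorem exists_eq_succPNat (k : ℕ+) : ∃ i : ℕ, k = i.succPNat := ⟨k.natPred, by simp⟩

variable [Algebra ℚ A]

variable (A) in
/-- The coefficient of `z^n` in `exp (∑ (q_k - q'_k) z^k / k)`. -/
def expDiff (n : ℕ) : MvPowerSeries (ℕ+ ⊕ ℕ+) A :=
  expCoeff (fun k : ℕ+ => ((k : ℕ) : ℚ)⁻¹ •
      (MvPowerSeries.X (Sum.inl k) - MvPowerSeries.X (Sum.inr k) :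
        MvPowerSeries (ℕ+ ⊕ ℕ+) A)) n

theorem expDiff_zero : expDiff A 0 = 1 := expCoeff_zero _

theorem succ_smul_inv_smul {M : Type*} [AddCommGroup M] [Module ℚ M] (i : ℕ) (m : M) :
    (i + 1) • ((i.succPNat : ℕ) : ℚ)⁻¹ • m = m := by
  rw [← Nat.cast_smul_eq_nsmul ℚ, smul_smul, Nat.succPNat_coe, mul_inv_cancel₀ (by positivity),
    one_smul]

/-- Differentiating the exponential in `q_k` brings down `z^k / k`, which shifts the coefficients.
-/
theorem pderiv_inl_expDiff (k n : ℕ) :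
    (k + 1) • MvPowerSeries.pderiv A (Sum.inl k.succPNat) (expDiff A n) =
      if k + 1 ≤ n then expDiff A (n - (k + 1)) else 0 := by
  have h := derivation_expCoeff (fun k : ℕ+ => ((k : ℕ) : ℚ)⁻¹ •
      (MvPowerSeries.X (Sum.inl k) - MvPowerSeries.X (Sum.inr k) :
        MvPowerSeries (ℕ+ ⊕ ℕ+) A)) ((k + 1) • MvPowerSeries.pderiv A (Sum.inl k.succPNat))
      (k + 1) 1 (by
    intro i
    rw [← map_nsmul, succ_smul_inv_smul, Derivation.smul_apply, map_sub, MvPowerSeries.pderiv_X,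
      MvPowerSeries.pderiv_X]
    by_cases hik : i = k
    · subst hik; simp
    · have hne : i.succPNat ≠ k.succPNat := fun h => hik (Nat.succPNat_injective h)
      simp [hik]) n
  simpa [expDiff] using h

theorem pderiv_inr_expDiff (k n : ℕ) :
    (k + 1) • MvPowerSeries.pderiv A (Sum.inr k.succPNat) (expDiff A n) =
      if k + 1 ≤ n then -expDiff A (n - (k + 1)) else 0 := by
  have h := derivation_expCoeff (fun k : ℕ+ => ((k : ℕ) : ℚ)⁻¹ •
      (MvPowerSeries.X (Sum.inl k) - MvPowerSeries.X (Sum.inr k) :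
        MvPowerSeries (ℕ+ ⊕ ℕ+) A)) ((k + 1) • MvPowerSeries.pderiv A (Sum.inr k.succPNat))
      (k + 1) (-1) (by
    intro i
    rw [← map_nsmul, succ_smul_inv_smul, Derivation.smul_apply, map_sub, MvPowerSeries.pderiv_X,
      MvPowerSeries.pderiv_X]
    by_cases hik : i = k
    · subst hik; simp
    · have hne : i.succPNat ≠ k.succPNat := fun h => hik (Nat.succPNat_injective h)
      simp [hik]) n
  simpa [expDiff] using h

/-- `k ∂/∂q_k` on a combination of the coefficients of `exp (∑ (q_k - q'_k) z^k / k)`. -/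
theorem pderiv_inl_sum_expDiff (k M : ℕ) (f : ℕ → MvPowerSeries (ℕ+ ⊕ ℕ+) A) :
    (k + 1) • MvPowerSeries.pderiv A (Sum.inl k.succPNat)
        (∑ j ∈ range (k + 1 + M), expDiff A j * f j) =
      ∑ j ∈ range M, expDiff A j * f (k + 1 + j) +
        ∑ j ∈ range (k + 1 + M), expDiff A j *
          ((k + 1) • MvPowerSeries.pderiv A (Sum.inl k.succPNat) (f j)) := by
  rw [map_sum, smul_sum]
  have h1 : ∀ j, (k + 1) • MvPowerSeries.pderiv A (Sum.inl k.succPNat) (expDiff A j * f j) =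
      (if k + 1 ≤ j then expDiff A (j - (k + 1)) else 0) * f j + expDiff A j *
          ((k + 1) • MvPowerSeries.pderiv A (Sum.inl k.succPNat) (f j)) := by
    intro j
    rw [← pderiv_inl_expDiff, Derivation.leibniz, smul_eq_mul, smul_eq_mul, smul_add,
      mul_smul_comm, smul_mul_assoc]
    ring
  rw [sum_congr rfl fun j _ => h1 j, sum_add_distrib, sum_range_add, sum_eq_zero, zero_add]
  · congr 1
    refine sum_congr rfl fun j _ => ?_
    rw [if_pos (by omega), Nat.add_sub_cancel_left]
  · intro j hj
    rw [mem_range] at hj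
    rw [if_neg (by omega), zero_mul]

theorem pderiv_inr_sum_expDiff (k M : ℕ) (f : ℕ → MvPowerSeries (ℕ+ ⊕ ℕ+) A) :
    (k + 1) • MvPowerSeries.pderiv A (Sum.inr k.succPNat)
        (∑ j ∈ range (k + 1 + M), expDiff A j * f j) =
      -∑ j ∈ range M, expDiff A j * f (k + 1 + j) +
        ∑ j ∈ range (k + 1 + M), expDiff A j *
          ((k + 1) • MvPowerSeries.pderiv A (Sum.inr k.succPNat) (f j)) := by
  rw [map_sum, smul_sum]
  have h1 : ∀ j, (k + 1) • MvPowerSeries.pderiv A (Sum.inr k.succPNat) (expDiff A j * f j) =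
      (if k + 1 ≤ j then -expDiff A (j - (k + 1)) else 0) * f j + expDiff A j *
          ((k + 1) • MvPowerSeries.pderiv A (Sum.inr k.succPNat) (f j)) := by
    intro j
    rw [← pderiv_inr_expDiff, Derivation.leibniz, smul_eq_mul, smul_eq_mul, smul_add,
      mul_smul_comm, smul_mul_assoc]
    ring
  rw [sum_congr rfl fun j _ => h1 j, sum_add_distrib, sum_range_add, sum_eq_zero, zero_add]
  · congr 1
    rw [← sum_neg_distrib]
    refine sum_congr rfl fun j _ => ?_
    rw [if_pos (by omega), Nat.add_sub_cancel_left, neg_mul]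
  · intro j hj
    rw [mem_range] at hj
    rw [if_neg (by omega), zero_mul]

theorem constantCoeff_expDiff (n : ℕ) :
    MvPowerSeries.constantCoeff (expDiff A n) = if n = 0 then 1 else 0 := by
  rcases n with _ | n
  · simp [expDiff_zero]
  · rw [if_neg (by omega)]
    have h := congrArg (MvPowerSeries.constantCoeff (σ := ℕ+ ⊕ ℕ+) (R := A))
      (succ_smul_expCoeff (fun k : ℕ+ => ((k : ℕ) : ℚ)⁻¹ •
      (MvPowerSeries.X (Sum.inl k) - MvPowerSeries.X (Sum.inr k) :
        MvPowerSeries (ℕ+ ⊕ ℕ+) A)) n)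
    rw [map_nsmul, map_sum, sum_eq_zero, nsmul_eq_mul, mul_comm] at h
    · push_cast at h
      exact eq_zero_of_mul_natCast_add_one h
    · intro ij _
      rw [succ_smul_inv_smul, map_mul]
      simp

/-- Giving `q_k` and `q'_k` weight `k`, the coefficient of `z^n` is homogeneous of weight `n`. This
is what makes the residue converge coefficientwise. -/
theorem expDiff_mem (n : ℕ) : expDiff A n ∈ weightIdeal A doubleWeight n := by
  induction n using Nat.strong_induction_on with
  | _ n ih =>
    apply mem_weightIdeal_of_pderiv doubleWeight_pos
    · intro h
      rw [constantCoeff_expDiff, if_neg h.ne']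
    · rintro (i | i) hi <;> obtain ⟨k, rfl⟩ := exists_eq_succPNat i <;>
        simp only [doubleWeight_inl, doubleWeight_inr] at hi ⊢
      · rw [pderiv_inl_expDiff, if_pos (by omega)]
        exact ih _ (by omega)
      · rw [pderiv_inr_expDiff, if_pos (by omega)]
        exact neg_mem (ih _ (by omega))

/-- Differentiation leaves sums cut off at two different places; the excess terms are negligible at
the weight considered. -/
theorem sum_expDiff_tail_mem (k M : ℕ) (f : ℕ → MvPowerSeries (ℕ+ ⊕ ℕ+) A) :
    ∑ j ∈ range (k + M), expDiff A j * f j - ∑ j ∈ range M, expDiff A j * f j ∈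
      weightIdeal A doubleWeight M := by
  rw [add_comm k M, sum_range_add, add_sub_cancel_left]
  refine sum_mem fun j _ => Ideal.mul_mem_right _ _ ?_
  exact weightIdeal_anti _ (by omega) (expDiff_mem (M + j))

theorem constantCoeff_sum_expDiff (M : ℕ) (f : ℕ → MvPowerSeries (ℕ+ ⊕ ℕ+) A) (hM : 0 < M) :
    MvPowerSeries.constantCoeff (∑ j ∈ range M, expDiff A j * f j) =
      MvPowerSeries.constantCoeff (f 0) := by
  rw [map_sum, sum_eq_single 0]
  · simp [constantCoeff_expDiff]
  · intro j _ hj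
    rw [map_mul, constantCoeff_expDiff, if_neg hj, zero_mul]
  · intro h
    exact absurd (mem_range.mpr hM) h

namespace IsHookSeries

variable {a b : ℕ → MvPowerSeries ℕ+ A} {τ : MvPowerSeries ℕ+ A}

/-- Taylor expansion `a_i(q) = ∑_j E_j(q - q') a_{i+j}(q')`, cut off at weight `M`, with `E_j` the
coefficients of the exponential. The constant terms agree, `k ∂/∂q_k` turns the claim into the one
for `i + k` at lower weight, and the `q'`-derivatives cancel up to a tail. -/
theorem sum_expDiff_left (h : IsHookSeries a b τ) (M i : ℕ) :
    ∑ j ∈ range M, expDiff A j * inQ' (a (i + j)) - inQ (a i) ∈ weightIdeal A doubleWeight M := by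
  induction M using Nat.strong_induction_on generalizing i with
  | _ M ih =>
    apply mem_weightIdeal_of_pderiv doubleWeight_pos
    · intro hM
      rw [map_sub, constantCoeff_sum_expDiff _ _ hM, constantCoeff_inQ, constantCoeff_inQ',
        add_zero, sub_self]
    · rintro (l | l) hl <;> obtain ⟨k, rfl⟩ := exists_eq_succPNat l <;>
        simp only [doubleWeight_inl, doubleWeight_inr] at hl ⊢ <;>
        obtain ⟨M, rfl⟩ := Nat.exists_eq_add_of_lt hl <;>
        rw [show k + 1 + M + 1 - (k + 1) = M + 1 by omega, map_sub, smul_sub,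
          show k + 1 + M + 1 = k + 1 + (M + 1) by omega]
      · rw [pderiv_inl_sum_expDiff, pderiv_inl_inQ, ← map_nsmul, h.left]
        simp only [pderiv_inl_inQ', smul_zero, mul_zero, sum_const_zero, add_zero]
        convert ih (M + 1) (by omega) (i + (k + 1)) using 6
        omega
      · rw [pderiv_inr_sum_expDiff, pderiv_inr_inQ, smul_zero, sub_zero]
        simp only [pderiv_inr_inQ', ← map_nsmul, h.left]
        rw [neg_add_eq_sub]
        convert sum_expDiff_tail_mem (k + 1) (M + 1) (fun j => inQ' (a (i + j + (k + 1)))) using 6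
        omega

/-- The same expansion with `q` and `q'` exchanged: the minus sign in the derivatives of `b`
compensates for that in `q - q'`. -/
theorem sum_expDiff_right (h : IsHookSeries a b τ) (M i : ℕ) :
    ∑ j ∈ range M, expDiff A j * inQ (b (i + j)) - inQ' (b i) ∈ weightIdeal A doubleWeight M := by
  induction M using Nat.strong_induction_on generalizing i with
  | _ M ih =>
    apply mem_weightIdeal_of_pderiv doubleWeight_pos
    · intro hM
      rw [map_sub, constantCoeff_sum_expDiff _ _ hM, constantCoeff_inQ, constantCoeff_inQ',
        add_zero, sub_self]
    · rintro (l | l) hl <;> obtain ⟨k, rfl⟩ := exists_eq_succPNat l <;>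
        simp only [doubleWeight_inl, doubleWeight_inr] at hl ⊢ <;>
        obtain ⟨M, rfl⟩ := Nat.exists_eq_add_of_lt hl <;>
        rw [show k + 1 + M + 1 - (k + 1) = M + 1 by omega, map_sub, smul_sub,
          show k + 1 + M + 1 = k + 1 + (M + 1) by omega]
      · rw [pderiv_inl_sum_expDiff, pderiv_inl_inQ', smul_zero, sub_zero]
        simp only [pderiv_inl_inQ, ← map_nsmul, h.right, map_neg, mul_neg, sum_neg_distrib]
        rw [← neg_mem_iff, neg_add_rev, neg_neg, ← sub_eq_add_neg]
        convert sum_expDiff_tail_mem (k + 1) (M + 1) (fun j => inQ (b (i + j + (k + 1)))) using 6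
        omega
      · rw [pderiv_inr_sum_expDiff, pderiv_inr_inQ', ← map_nsmul, h.right]
        simp only [pderiv_inr_inQ, smul_zero, mul_zero, sum_const_zero, add_zero]
        rw [← neg_mem_iff, map_neg]
        convert ih (M + 1) (by omega) (i + (k + 1)) using 1
        rw [neg_sub, sub_eq_add_neg, neg_neg, neg_add_eq_sub]
        congr 1
        refine sum_congr rfl fun j _ => ?_
        rw [show i + (k + 1 + j) = i + (k + 1) + j by omega]

/-- The sums `∑_{x + y = j - 1} b_x(q) a_y(q')`. -/
def mixedSum (a b : ℕ → MvPowerSeries ℕ+ A) : ℕ → MvPowerSeries (ℕ+ ⊕ ℕ+) A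
  | 0 => 0
  | j + 1 => ∑ p ∈ antidiagonal j, inQ (b p.1) * inQ' (a p.2)

theorem mixedSum_add (a b : ℕ → MvPowerSeries ℕ+ A) (k j : ℕ) :
    mixedSum a b (k + 1 + j) = ∑ p ∈ antidiagonal k, inQ (b p.1) * inQ' (a (p.2 + j)) +
      mixedSum a (fun i => b (i + (k + 1))) j := by
  rw [show k + 1 + j = j + k + 1 by omega]
  rcases j with _ | j
  · simp [mixedSum]
  · simp only [mixedSum]
    rw [sum_antidiagonal_add_succ]

theorem mixedSum_add' (a b : ℕ → MvPowerSeries ℕ+ A) (k j : ℕ) :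
    mixedSum a b (k + 1 + j) = ∑ p ∈ antidiagonal k, inQ (b (p.2 + j)) * inQ' (a p.1) +
      mixedSum (fun i => a (i + (k + 1))) b j := by
  rw [show k + 1 + j = j + k + 1 by omega]
  rcases j with _ | j
  · simp only [mixedSum, zero_add, add_zero]
    exact (Nat.sum_antidiagonal_swap (f := fun p : ℕ × ℕ => inQ (b p.1) * inQ' (a p.2))).symm
  · simp only [mixedSum]
    rw [← Nat.sum_antidiagonal_swap, sum_antidiagonal_add_succ,
      ← Nat.sum_antidiagonal_swap (n := j)]
    rfl

theorem pderiv_inl_mixedSum (h : IsHookSeries a b τ) (k j : ℕ) :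
    (k + 1) • MvPowerSeries.pderiv A (Sum.inl k.succPNat) (mixedSum a b j) =
      -mixedSum a (fun i => b (i + (k + 1))) j := by
  rcases j with _ | j
  · simp [mixedSum]
  · simp only [mixedSum]
    rw [map_sum, smul_sum, ← sum_neg_distrib]
    refine sum_congr rfl fun p _ => ?_
    rw [Derivation.leibniz, pderiv_inl_inQ', pderiv_inl_inQ, smul_zero, zero_add, smul_eq_mul,
      ← mul_smul_comm, ← map_nsmul, h.right, map_neg]
    ring

theorem pderiv_inr_mixedSum (h : IsHookSeries a b τ) (k j : ℕ) :
    (k + 1) • MvPowerSeries.pderiv A (Sum.inr k.succPNat) (mixedSum a b j) =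
      mixedSum (fun i => a (i + (k + 1))) b j := by
  rcases j with _ | j
  · simp [mixedSum]
  · simp only [mixedSum]
    rw [map_sum, smul_sum]
    refine sum_congr rfl fun p _ => ?_
    rw [Derivation.leibniz, pderiv_inr_inQ', pderiv_inr_inQ, smul_zero, add_zero, smul_eq_mul,
      ← mul_smul_comm, ← map_nsmul, h.left]

/-- The left side and `τ(q) - τ(q')` have the same derivatives modulo high weight. Shifting the
exponential by `k` splits each mixed sum into a block with shifted indices, which cancels, and `k`
products that the two Taylor expansions turn into the terms of `k ∂_k τ`. -/
theorem sum_expDiff_mixedSum (h : IsHookSeries a b τ) (M : ℕ) :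
    ∑ j ∈ range M, expDiff A j * mixedSum a b j - (inQ τ - inQ' τ) ∈
      weightIdeal A doubleWeight M := by
  apply mem_weightIdeal_of_pderiv doubleWeight_pos
  · intro hM
    rw [map_sub, constantCoeff_sum_expDiff _ _ hM, map_sub, constantCoeff_inQ, constantCoeff_inQ',
      sub_self, sub_zero]
    simp [mixedSum]
  · rintro (l | l) hl <;> obtain ⟨k, rfl⟩ := exists_eq_succPNat l <;>
      simp only [doubleWeight_inl, doubleWeight_inr] at hl ⊢ <;>
      obtain ⟨M, rfl⟩ := Nat.exists_eq_add_of_lt hl <;>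
      rw [show k + 1 + M + 1 - (k + 1) = M + 1 by omega, map_sub, smul_sub,
        show k + 1 + M + 1 = k + 1 + (M + 1) by omega]
    · rw [pderiv_inl_sum_expDiff, map_sub, pderiv_inl_inQ', sub_zero, pderiv_inl_inQ,
        ← map_nsmul, h.total]
      simp only [h.pderiv_inl_mixedSum, mixedSum_add, mul_add, sum_add_distrib, mul_neg,
        sum_neg_distrib, map_sum, map_mul]
      have h1 := sum_expDiff_tail_mem (k + 1) (M + 1)
        (fun j => mixedSum a (fun i => b (i + (k + 1))) j)
      have h2 : ∑ p ∈ antidiagonal k, inQ (b p.1) *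
          (∑ j ∈ range (M + 1), expDiff A j * inQ' (a (p.2 + j)) - inQ (a p.2)) ∈
            weightIdeal A doubleWeight (M + 1) :=
        sum_mem fun p _ => Ideal.mul_mem_left _ _ (h.sum_expDiff_left _ _)
      convert sub_mem h2 h1 using 1
      simp only [mul_sub, sum_sub_distrib, mul_sum]
      rw [sum_comm, ← Nat.sum_antidiagonal_swap (f := fun p : ℕ × ℕ => inQ (a p.1) * inQ (b p.2))]
      simp only [Prod.fst_swap, Prod.snd_swap, mul_left_comm, mul_comm]
      ring
    · rw [pderiv_inr_sum_expDiff, map_sub, pderiv_inr_inQ, zero_sub, pderiv_inr_inQ', smul_neg,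
        ← map_nsmul, h.total]
      simp only [h.pderiv_inr_mixedSum, mixedSum_add', mul_add, sum_add_distrib, map_sum, map_mul]
      have h1 := sum_expDiff_tail_mem (k + 1) (M + 1)
        (fun j => mixedSum (fun i => a (i + (k + 1))) b j)
      have h2 : ∑ p ∈ antidiagonal k, inQ' (a p.1) *
          (∑ j ∈ range (M + 1), expDiff A j * inQ (b (p.2 + j)) - inQ' (b p.2)) ∈
            weightIdeal A doubleWeight (M + 1) :=
        sum_mem fun p _ => Ideal.mul_mem_left _ _ (h.sum_expDiff_right _ _)
      convert sub_mem h1 h2 using 1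
      simp only [mul_sub, sum_sub_distrib, mul_sum]
      rw [sum_comm (s := antidiagonal k)]
      simp only [mul_left_comm, mul_comm]
      ring

/-- The product of the shifts `τ - a_0 ∑ b_n z^{-n-1}` and `τ' + b'_0 ∑ a'_n z^{-n-1}` is multiplied
out. The product `τ τ'` carries no negative power of `z` and never contributes. -/
theorem hirotaTerm_eq (h : IsHookSeries a b τ) (j : ℕ) :
    hirotaTerm τ j = inQ τ * inQ' (b 0) * (expDiff A j * inQ' (a (0 + j))) -
      inQ' τ * inQ (a 0) * (expDiff A j * inQ (b (0 + j))) -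
      inQ (a 0) * inQ' (b 0) * (expDiff A j * mixedSum a b j) := by
  have h0 : hirotaTerm τ j = expDiff A j * ∑ p ∈ antidiagonal (j + 1),
      inQ (shiftCoeff (-1) p.1 τ) * inQ' (shiftCoeff 1 p.2 τ) := rfl
  rw [h0, Nat.sum_antidiagonal_succ, shiftCoeff_zero, h.shiftCoeff_one]
  simp only [h.shiftCoeff_neg_one, map_neg, map_mul]
  rcases j with _ | j
  · simp only [Nat.antidiagonal_zero, sum_singleton, shiftCoeff_zero, mixedSum]
    ring
  · rw [Nat.sum_antidiagonal_succ', shiftCoeff_zero]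
    simp only [h.shiftCoeff_one, map_mul, mixedSum, zero_add]
    have h1 : ∑ x ∈ antidiagonal j, -(inQ (a 0) * inQ (b x.1)) * (inQ' (a x.2) * inQ' (b 0)) =
        -(inQ (a 0) * inQ' (b 0)) * ∑ p ∈ antidiagonal j, inQ (b p.1) * inQ' (a p.2) := by
      rw [mul_sum]
      exact sum_congr rfl fun p _ => by ring
    rw [h1]
    ring

/-- By the three expansions the residue is `τ b'_0 a_0 - τ' a_0 b'_0 - a_0 b'_0 (τ - τ')`, which
vanishes identically. -/
theorem solvesHirota (h : IsHookSeries a b τ) : SolvesHirota τ := by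
  intro e
  filter_upwards [Filter.eventually_gt_atTop (Finsupp.weight doubleWeight e)] with M hM
  suffices ∑ j ∈ range M, hirotaTerm τ j ∈ weightIdeal A doubleWeight M from this e hM
  have h1 := Ideal.mul_mem_left _ (inQ τ * inQ' (b 0)) (h.sum_expDiff_left M 0)
  have h2 := Ideal.mul_mem_left _ (inQ' τ * inQ (a 0)) (h.sum_expDiff_right M 0)
  have h3 := Ideal.mul_mem_left _ (inQ (a 0) * inQ' (b 0)) (h.sum_expDiff_mixedSum M)
  convert sub_mem (sub_mem h1 h2) h3 using 1
  simp only [h.hirotaTerm_eq, sum_sub_distrib, mul_sub, mul_sum]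
  ring

end IsHookSeries

end CompletedHurwitz

end

/-! ### Series of hook type from product functionals on polynomials in two variables. -/

noncomputable section

namespace CompletedHurwitz

open Finset

/-! ### Linear functionals on polynomials in two variables -/

/-- Polynomials in two variables. -/
abbrev BiPoly : Type := MvPolynomial (Fin 2) ℂ

/-- The linear functional with the value `f i j` on `X^i Y^j`. -/
def biFunctional {M : Type*} [AddCommGroup M] [Module ℂ M] (f : ℕ → ℕ → M) : BiPoly →ₗ[ℂ] M :=
  (MvPolynomial.basisMonomials (Fin 2) ℂ).constr ℂ fun e => f (e 0) (e 1)

section BiFunctional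

variable {M : Type*} [AddCommGroup M] [Module ℂ M]

theorem biFunctional_monomial (f : ℕ → ℕ → M) (e : Fin 2 →₀ ℕ) :
    biFunctional f (MvPolynomial.monomial e 1) = f (e 0) (e 1) := by
  have h := (MvPolynomial.basisMonomials (Fin 2) ℂ).constr_basis ℂ (fun e => f (e 0) (e 1)) e
  rwa [MvPolynomial.coe_basisMonomials] at h

theorem monomial_eq_X_pow (e : Fin 2 →₀ ℕ) :
    (MvPolynomial.monomial e 1 : BiPoly) = MvPolynomial.X 0 ^ e 0 * MvPolynomial.X 1 ^ e 1 := by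
  rw [MvPolynomial.monomial_eq, Finsupp.prod_fintype _ _ (by simp), Fin.prod_univ_two]
  simp

theorem biFunctional_X_pow (f : ℕ → ℕ → M) (i j : ℕ) :
    biFunctional f (MvPolynomial.X 0 ^ i * MvPolynomial.X 1 ^ j) = f i j := by
  have h := biFunctional_monomial f (Finsupp.single 0 i + Finsupp.single 1 j)
  rw [monomial_eq_X_pow] at h
  simpa using h

theorem biPoly_hom_ext {φ ψ : BiPoly →ₗ[ℂ] M}
    (h : ∀ i j : ℕ, φ (MvPolynomial.X 0 ^ i * MvPolynomial.X 1 ^ j) =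
      ψ (MvPolynomial.X 0 ^ i * MvPolynomial.X 1 ^ j)) : φ = ψ := by
  refine (MvPolynomial.basisMonomials (Fin 2) ℂ).ext fun e => ?_
  have h' := h (e 0) (e 1)
  rw [← monomial_eq_X_pow] at h'
  rwa [MvPolynomial.coe_basisMonomials]

end BiFunctional

/-- `(X^k - Y^k) / k`. -/
def powDiff (k : ℕ) : BiPoly :=
  MvPolynomial.C ((k : ℂ)⁻¹) * (MvPolynomial.X 0 ^ k - MvPolynomial.X 1 ^ k)

/-- `∏_k ((X^k - Y^k) / k)^{e_k}`. -/
def powDiffProd (e : ℕ+ →₀ ℕ) : BiPoly := e.prod fun k m => powDiff k ^ m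

theorem X_sub_X_ne_zero : (MvPolynomial.X 0 - MvPolynomial.X 1 : BiPoly) ≠ 0 := by
  intro h
  have := congrArg (MvPolynomial.eval ![1, 0]) h
  simp at this

theorem powDiffProd_zero : powDiffProd 0 = 1 := Finsupp.prod_zero_index

theorem powDiffProd_add (e e' : ℕ+ →₀ ℕ) :
    powDiffProd (e + e') = powDiffProd e * powDiffProd e' :=
  Finsupp.prod_add_index' (fun _ => pow_zero _) fun _ _ _ => pow_add _ _ _

theorem powDiffProd_single (k : ℕ+) : powDiffProd (Finsupp.single k 1) = powDiff k := by
  rw [powDiffProd, Finsupp.prod_single_index (h := fun (k : ℕ+) m => powDiff k ^ m) (pow_zero _),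
    pow_one]

theorem succ_smul_powDiff (k : ℕ) :
    (k + 1) • powDiff (k + 1) = MvPolynomial.X 0 ^ (k + 1) - MvPolynomial.X 1 ^ (k + 1) := by
  rw [powDiff, nsmul_eq_mul, ← mul_assoc]
  have : ((k + 1 : ℕ) : BiPoly) * MvPolynomial.C (((k + 1 : ℕ) : ℂ)⁻¹) = 1 := by
    rw [← map_natCast (MvPolynomial.C : ℂ →+* BiPoly), ← map_mul,
      mul_inv_cancel₀ (by exact_mod_cast Nat.succ_ne_zero k), map_one]
  rw [this, one_mul]

theorem sub_mul_sum_antidiagonal {R : Type*} [CommRing R] (x y : R) (k : ℕ) :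
    (x - y) * ∑ p ∈ antidiagonal k, x ^ p.1 * y ^ p.2 = x ^ (k + 1) - y ^ (k + 1) := by
  rw [mul_comm, Nat.sum_antidiagonal_eq_sum_range_succ (fun i j => x ^ i * y ^ j), ← geom_sum₂_mul]
  rfl

theorem prod_add_single_mul {K : Type*} [CommMonoid K] {ψ : ℕ+ → ℕ → K} (hψ : ∀ k, ψ k 0 = 1)
    (e : ℕ+ →₀ ℕ) (k : ℕ+) :
    (e + Finsupp.single k 1).prod ψ * ψ k (e k) = e.prod ψ * ψ k (e k + 1) := by
  classical
  have h1 : (e + Finsupp.single k 1).support ⊆ insert k e.support := by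
    intro i hi
    rw [mem_insert, Finsupp.mem_support_iff]
    by_cases h : i = k
    · exact Or.inl h
    · refine Or.inr ?_
      simpa [Finsupp.single_apply, Ne.symm h] using hi
  have h2 : e.support ⊆ insert k e.support := subset_insert _ _
  rw [Finsupp.prod_of_support_subset _ h1 _ (fun i _ => hψ i),
    Finsupp.prod_of_support_subset _ h2 _ (fun i _ => hψ i),
    ← mul_prod_erase _ _ (mem_insert_self k e.support),
    ← mul_prod_erase _ _ (mem_insert_self k e.support)]
  have h3 : ∏ x ∈ (insert k e.support).erase k, ψ x ((e + Finsupp.single k 1 : ℕ+ →₀ ℕ) x) =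
      ∏ x ∈ (insert k e.support).erase k, ψ x (e x) := by
    refine prod_congr rfl fun x hx => ?_
    rw [Finsupp.add_apply, Finsupp.single_apply, if_neg (Ne.symm (ne_of_mem_erase hx)), add_zero]
  rw [h3, Finsupp.add_apply, Finsupp.single_eq_same, mul_right_comm, mul_comm (ψ k (e k)),
    mul_right_comm, mul_comm (ψ k (e k + 1)), mul_assoc, mul_assoc, mul_comm (ψ k (e k + 1))]

/-- `∏_k e_k!`. -/
def factProd (e : ℕ+ →₀ ℕ) : ℂ := e.prod fun _ m => (m.factorial : ℂ)

theorem factProd_ne_zero (e : ℕ+ →₀ ℕ) : factProd e ≠ 0 :=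
  prod_ne_zero_iff.mpr fun _ _ => Nat.cast_ne_zero.mpr (Nat.factorial_ne_zero _)

theorem factProd_add_single (e : ℕ+ →₀ ℕ) (k : ℕ+) :
    factProd (e + Finsupp.single k 1) = factProd e * (e k + 1) := by
  have h := prod_add_single_mul (ψ := fun (_ : ℕ+) m => (m.factorial : ℂ)) (by simp) e k
  have h0 : ((e k).factorial : ℂ) ≠ 0 := by exact_mod_cast Nat.factorial_ne_zero _
  apply mul_right_cancel₀ h0
  refine h.trans ?_
  rw [Nat.factorial_succ]
  push_cast
  rw [factProd]
  ring

/-- `∏_k k^{e_k} e_k!`. -/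
def zFactor (e : ℕ+ →₀ ℕ) : ℂ := e.prod fun k m => ((k : ℕ) : ℂ) ^ m * (m.factorial : ℂ)

theorem zFactor_ne_zero (e : ℕ+ →₀ ℕ) : zFactor e ≠ 0 :=
  prod_ne_zero_iff.mpr fun k _ => mul_ne_zero
    (pow_ne_zero _ (by exact_mod_cast k.ne_zero)) (by exact_mod_cast Nat.factorial_ne_zero _)

theorem zFactor_add_single (e : ℕ+ →₀ ℕ) (k : ℕ+) :
    zFactor (e + Finsupp.single k 1) = zFactor e * ((k : ℕ) * (e k + 1)) := by
  have h := prod_add_single_mul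
    (ψ := fun (k : ℕ+) m => ((k : ℕ) : ℂ) ^ m * (m.factorial : ℂ)) (by simp) e k
  have h0 : ((k : ℕ) : ℂ) ^ e k * ((e k).factorial : ℂ) ≠ 0 := mul_ne_zero
    (pow_ne_zero _ (by exact_mod_cast k.ne_zero)) (by exact_mod_cast Nat.factorial_ne_zero _)
  apply mul_right_cancel₀ h0
  refine h.trans ?_
  rw [Nat.factorial_succ, pow_succ]
  push_cast
  rw [zFactor]
  ring

/-! ### Series of hook type attached to two sequences -/

/-- The weight `∑ k e_k` of a monomial in the `q_k`. -/
def qWeight (e : ℕ+ →₀ ℕ) : ℕ := Finsupp.weight (fun k : ℕ+ => (k : ℕ)) e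

theorem qWeight_add (e e' : ℕ+ →₀ ℕ) : qWeight (e + e') = qWeight e + qWeight e' := map_add _ _ _

theorem qWeight_single (k : ℕ+) : qWeight (Finsupp.single k 1) = k := by
  rw [qWeight, Finsupp.weight_single, one_smul]

/-- The series `∑_n A_{i + n} ε^{deg} h_n(q)`, with `h_n` the complete homogeneous symmetric
functions in terms of power sums and the sign `ε` attached to each `q_k`. -/
def seqSeries (ε : ℂ) (A : ℕ → PowerSeries ℂ) (i : ℕ) : MvPowerSeries ℕ+ (PowerSeries ℂ) :=
  fun e => (ε ^ e.degree * (zFactor e)⁻¹) • A (i + qWeight e)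

theorem coeff_seqSeries (ε : ℂ) (A : ℕ → PowerSeries ℂ) (i : ℕ) (e : ℕ+ →₀ ℕ) :
    MvPowerSeries.coeff e (seqSeries ε A i) =
      (ε ^ e.degree * (zFactor e)⁻¹) • A (i + qWeight e) := rfl

theorem constantCoeff_seqSeries (ε : ℂ) (A : ℕ → PowerSeries ℂ) (i : ℕ) :
    MvPowerSeries.constantCoeff (seqSeries ε A i) = A i := by
  rw [← MvPowerSeries.coeff_zero_eq_constantCoeff_apply, coeff_seqSeries]
  simp [zFactor, qWeight]

theorem pderiv_seqSeries (ε : ℂ) (A : ℕ → PowerSeries ℂ) (i k : ℕ) :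
    (k + 1) • MvPowerSeries.pderiv (PowerSeries ℂ) k.succPNat (seqSeries ε A i) =
      (PowerSeries.C ε) • seqSeries ε A (i + (k + 1)) := by
  ext1 e
  rw [map_nsmul, MvPowerSeries.coeff_pderiv, MvPowerSeries.coeff_smul, coeff_seqSeries,
    coeff_seqSeries, zFactor_add_single, qWeight_add, qWeight_single, map_add,
    Finsupp.degree_single, pow_succ, Nat.succPNat_coe, Nat.succ_eq_add_one,
    show i + (qWeight e + (k + 1)) = i + (k + 1) + qWeight e by omega]
  have h1 : (e k.succPNat : PowerSeries ℂ) + 1 = PowerSeries.C ((e k.succPNat : ℂ) + 1) := by simp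
  rw [h1, mul_comm, ← PowerSeries.smul_eq_C_mul, ← PowerSeries.smul_eq_C_mul,
    ← Nat.cast_smul_eq_nsmul ℂ, smul_smul, smul_smul, smul_smul]
  congr 1
  have h2 := zFactor_ne_zero e
  have h3 : (e k.succPNat : ℂ) + 1 ≠ 0 := Nat.cast_add_one_ne_zero _
  have h4 : ((k + 1 : ℕ) : ℂ) ≠ 0 := by exact_mod_cast Nat.succ_ne_zero k
  field_simp

/-- The series with coefficients `Λ (p ∏_k ((X^k - Y^k) / k)^{e_k}) / ∏_k e_k!`. -/
def functionalSeries (Λ : BiPoly →ₗ[ℂ] PowerSeries ℂ) (p : BiPoly) :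
    MvPowerSeries ℕ+ (PowerSeries ℂ) :=
  fun e => (factProd e)⁻¹ • Λ (p * powDiffProd e)

theorem coeff_functionalSeries (Λ : BiPoly →ₗ[ℂ] PowerSeries ℂ) (p : BiPoly) (e : ℕ+ →₀ ℕ) :
    MvPowerSeries.coeff e (functionalSeries Λ p) = (factProd e)⁻¹ • Λ (p * powDiffProd e) := rfl

theorem functionalSeries_sum (Λ : BiPoly →ₗ[ℂ] PowerSeries ℂ) {ι : Type*} (s : Finset ι)
    (p : ι → BiPoly) :
    functionalSeries Λ (∑ i ∈ s, p i) = ∑ i ∈ s, functionalSeries Λ (p i) := by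
  ext1 e
  rw [map_sum]
  simp only [coeff_functionalSeries, sum_mul, map_sum, smul_sum]

theorem functionalSeries_sub (Λ : BiPoly →ₗ[ℂ] PowerSeries ℂ) (p q : BiPoly) :
    functionalSeries Λ (p - q) = functionalSeries Λ p - functionalSeries Λ q := by
  ext1 e
  rw [map_sub]
  simp only [coeff_functionalSeries, sub_mul, map_sub, smul_sub]

/-- Formally the series is `Λ (p exp (∑ q_k (X^k - Y^k) / k))`, and `k ∂/∂q_k` brings down `X^k -
Y^k`. -/
theorem pderiv_functionalSeries (Λ : BiPoly →ₗ[ℂ] PowerSeries ℂ) (p : BiPoly) (k : ℕ) :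
    (k + 1) • MvPowerSeries.pderiv (PowerSeries ℂ) k.succPNat (functionalSeries Λ p) =
      functionalSeries Λ
        (p * (MvPolynomial.X 0 ^ (k + 1) - MvPolynomial.X 1 ^ (k + 1))) := by
  ext1 e
  rw [map_nsmul, MvPowerSeries.coeff_pderiv, coeff_functionalSeries, coeff_functionalSeries,
    factProd_add_single, powDiffProd_add, powDiffProd_single, ← succ_smul_powDiff,
    Nat.succPNat_coe, Nat.succ_eq_add_one]
  have h0 : p * (k + 1) • powDiff (k + 1) * powDiffProd e =
      (k + 1) • (p * (powDiffProd e * powDiff (k + 1))) := by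
    simp only [nsmul_eq_mul]
    ring
  rw [h0, map_nsmul]
  have h1 : (e k.succPNat : PowerSeries ℂ) + 1 = PowerSeries.C ((e k.succPNat : ℂ) + 1) := by simp
  rw [h1, mul_comm, ← PowerSeries.smul_eq_C_mul, smul_smul, smul_comm (k + 1)]
  have h2 := factProd_ne_zero e
  have h3 : (e k.succPNat : ℂ) + 1 ≠ 0 := Nat.cast_add_one_ne_zero _
  congr 1
  field_simp

/-- The exponential `exp (∑ q_k (X^k - Y^k) / k)` is a function of `X` times a function of `Y`, so a
product functional takes a product value on it. The proof compares constant terms and derivatives,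
by induction on the weight. -/
theorem functionalSeries_X_pow (A B : ℕ → PowerSeries ℂ) (i j : ℕ) :
    functionalSeries (biFunctional fun i j => A i * B j)
        (MvPolynomial.X 0 ^ i * MvPolynomial.X 1 ^ j) =
      seqSeries 1 A i * seqSeries (-1) B j := by
  rw [← sub_eq_zero]
  have key : ∀ M i j, functionalSeries (biFunctional fun i j => A i * B j)
        (MvPolynomial.X 0 ^ i * MvPolynomial.X 1 ^ j) -
      seqSeries 1 A i * seqSeries (-1) B j ∈
        weightIdeal (PowerSeries ℂ) (fun k : ℕ+ => (k : ℕ)) M := by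
    intro M
    induction M using Nat.strong_induction_on with
    | _ M ih =>
      intro i j
      apply mem_weightIdeal_of_pderiv (fun k => k.pos)
      · intro _
        rw [map_sub, map_mul, constantCoeff_seqSeries, constantCoeff_seqSeries,
          ← MvPowerSeries.coeff_zero_eq_constantCoeff_apply, coeff_functionalSeries,
          powDiffProd_zero, mul_one, biFunctional_X_pow]
        simp [factProd]
      · intro l hl
        obtain ⟨k, rfl⟩ := exists_eq_succPNat l
        simp only [Nat.succPNat_coe, Nat.succ_eq_add_one] at hl ⊢
        have h1 := ih (M - (k + 1)) (by omega) (i + (k + 1)) j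
        have h2 := ih (M - (k + 1)) (by omega) i (j + (k + 1))
        convert sub_mem h1 h2 using 1
        rw [map_sub, smul_sub, pderiv_functionalSeries, Derivation.leibniz, smul_add,
          ← smul_comm (seqSeries 1 A i), ← smul_comm (seqSeries (-1) B j), pderiv_seqSeries,
          pderiv_seqSeries, mul_sub, functionalSeries_sub]
        rw [show (MvPolynomial.X 0 ^ i * MvPolynomial.X 1 ^ j * MvPolynomial.X 0 ^ (k + 1) : BiPoly)
          = MvPolynomial.X 0 ^ (i + (k + 1)) * MvPolynomial.X 1 ^ j by ring,
          show (MvPolynomial.X 0 ^ i * MvPolynomial.X 1 ^ j * MvPolynomial.X 1 ^ (k + 1) : BiPoly)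
          = MvPolynomial.X 0 ^ i * MvPolynomial.X 1 ^ (j + (k + 1)) by ring]
        simp only [map_neg, map_one, neg_smul, one_smul, smul_eq_mul]
        ring
  ext1 e
  exact key (qWeight e + 1) i j e (Nat.lt_succ_self _)

/-- A series whose coefficients are the values of the functional `X^i Y^j ↦ A_i B_j` on
`∏_k ((X^k - Y^k) / k)^{e_k} / (X - Y)`, up to factorials, is of hook type. -/
theorem isHookSeries_of_coeff (A B : ℕ → PowerSeries ℂ) (F : MvPowerSeries ℕ+ (PowerSeries ℂ))
    (hF : ∀ e ≠ 0, ∀ V : BiPoly, (MvPolynomial.X 0 - MvPolynomial.X 1) * V = powDiffProd e →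
      factProd e • MvPowerSeries.coeff e F = biFunctional (fun i j => A i * B j) V) :
    IsHookSeries (seqSeries 1 A) (seqSeries (-1) B) F where
  left k i := by rw [pderiv_seqSeries, map_one, one_smul]
  right k i := by rw [pderiv_seqSeries, map_neg, map_one, neg_smul, one_smul]
  total k := by
    simp only [← functionalSeries_X_pow, ← functionalSeries_sum]
    ext1 e
    -- The extra factor `(X^{k+1} - Y^{k+1})/(k+1)` is divided by `X - Y` explicitly; the resulting
    -- sum `∑ X^i Y^j` over `i + j = k` becomes `∑ a_i b_j`.
    have h1 := hF (e + Finsupp.single k.succPNat 1) (by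
        intro h
        have := DFunLike.congr_fun h k.succPNat
        simp at this)
      (powDiffProd e * (MvPolynomial.C (((k + 1 : ℕ) : ℂ)⁻¹) * ∑ p ∈ antidiagonal k,
        MvPolynomial.X 0 ^ p.1 * MvPolynomial.X 1 ^ p.2)) (by
        rw [powDiffProd_add, powDiffProd_single, mul_left_comm, Nat.succPNat_coe,
          Nat.succ_eq_add_one, powDiff, ← sub_mul_sum_antidiagonal]
        ring)
    rw [map_nsmul, MvPowerSeries.coeff_pderiv, coeff_functionalSeries]
    rw [mul_left_comm, ← MvPolynomial.smul_eq_C_mul, map_smul] at h1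
    rw [mul_comm (∑ p ∈ antidiagonal k, _) (powDiffProd e)]
    rw [eq_inv_smul_iff₀ (factProd_ne_zero e)]
    rw [eq_inv_smul_iff₀ (by exact_mod_cast Nat.succ_ne_zero k)] at h1
    rw [← h1, factProd_add_single]
    have h2 : (e k.succPNat : PowerSeries ℂ) + 1 = PowerSeries.C ((e k.succPNat : ℂ) + 1) := by simp
    rw [h2, mul_comm, ← PowerSeries.smul_eq_C_mul, mul_smul, ← Nat.cast_smul_eq_nsmul ℂ,
      smul_comm (factProd e)]

section Map

variable {R S : Type*} [CommRing R] [CommRing S] (φ : R →+* S)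

theorem pderiv_map {σ : Type*} (i : σ) (f : MvPowerSeries σ R) :
    MvPowerSeries.pderiv S i (MvPowerSeries.map φ f) =
      MvPowerSeries.map φ (MvPowerSeries.pderiv R i f) := by
  ext e
  simp [MvPowerSeries.coeff_pderiv]

theorem IsHookSeries.map {a b : ℕ → MvPowerSeries ℕ+ R} {τ : MvPowerSeries ℕ+ R}
    (h : IsHookSeries a b τ) :
    IsHookSeries (fun i => MvPowerSeries.map φ (a i)) (fun i => MvPowerSeries.map φ (b i))
      (MvPowerSeries.map φ τ) where
  left k i := by rw [pderiv_map, ← map_nsmul, h.left]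
  right k i := by rw [pderiv_map, ← map_nsmul, h.right, map_neg]
  total k := by rw [pderiv_map, ← map_nsmul, h.total, map_sum]; simp only [map_mul]

theorem IsHookSeries.C_add {a b : ℕ → MvPowerSeries ℕ+ R} {τ : MvPowerSeries ℕ+ R}
    (h : IsHookSeries a b τ) (c : R) : IsHookSeries a b (MvPowerSeries.C c + τ) where
  left := h.left
  right := h.right
  total k := by rw [map_add, MvPowerSeries.pderiv_C, zero_add, h.total]

end Map

end CompletedHurwitz

end

/-! ### Symmetrizers, antisymmetrizers and Young symmetrizers of hooks in the group algebra. -/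

noncomputable section

namespace CompletedHurwitz

open Finset

/-! ### Symmetrizers and antisymmetrizers of subsets -/

theorem eq_zero_of_eq_neg {M : Type*} [AddCommGroup M] [Module ℂ M] {x : M} (h : x = -x) :
    x = 0 := by
  have h2 : (2 : ℂ) • x = 0 := by
    rw [two_smul]
    nth_rewrite 1 [h]
    exact neg_add_cancel x
  exact (smul_eq_zero.mp h2).resolve_left two_ne_zero

section PermSum

variable {X : Type*} [Fintype X] [DecidableEq X]

/-- The permutations moving only elements of `S`. -/
def permsOn (S : Finset X) : Finset (Equiv.Perm X) := univ.filter fun σ => ∀ x, x ∉ S → σ x = x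

theorem mem_permsOn {S : Finset X} {σ : Equiv.Perm X} :
    σ ∈ permsOn S ↔ ∀ x, x ∉ S → σ x = x := by simp [permsOn]

theorem mul_mem_permsOn {S : Finset X} {σ τ : Equiv.Perm X} (hσ : σ ∈ permsOn S)
    (hτ : τ ∈ permsOn S) : σ * τ ∈ permsOn S := by
  rw [mem_permsOn] at *
  intro x hx
  rw [Equiv.Perm.mul_apply, hτ x hx, hσ x hx]

theorem inv_mem_permsOn {S : Finset X} {σ : Equiv.Perm X} (hσ : σ ∈ permsOn S) :
    σ⁻¹ ∈ permsOn S := by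
  rw [mem_permsOn] at *
  intro x hx
  rw [Equiv.Perm.inv_eq_iff_eq, hσ x hx]

theorem apply_mem_iff_of_mem_permsOn {S : Finset X} {σ : Equiv.Perm X} (hσ : σ ∈ permsOn S)
    (x : X) : σ x ∈ S ↔ x ∈ S := by
  rw [mem_permsOn] at hσ
  constructor
  · intro h
    by_contra hx
    rw [hσ x hx] at h
    exact hx h
  · intro h
    by_contra hx
    have := σ.injective (hσ (σ x) hx)
    rw [this] at hx
    exact hx h

theorem swap_mem_permsOn {S : Finset X} {x y : X} (hx : x ∈ S) (hy : y ∈ S) :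
    Equiv.swap x y ∈ permsOn S := by
  rw [mem_permsOn]
  intro z hz
  exact Equiv.swap_apply_of_ne_of_ne (by rintro rfl; exact hz hx) (by rintro rfl; exact hz hy)

theorem permsOn_mono {S S' : Finset X} (h : S ⊆ S') : permsOn S ⊆ permsOn S' := by
  intro σ hσ
  rw [mem_permsOn] at *
  exact fun x hx => hσ x fun h' => hx (h h')

/-- The sum over the permutations moving only elements of `S`, weighted by a character. -/
def permSum (ε : Equiv.Perm X →* ℂ) (S : Finset X) : MonoidAlgebra ℂ (Equiv.Perm X) :=
  ∑ σ ∈ permsOn S, MonoidAlgebra.single σ (ε σ)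

theorem single_mul_permSum (ε : Equiv.Perm X →* ℂ) {S : Finset X} {τ : Equiv.Perm X}
    (hτ : τ ∈ permsOn S) : MonoidAlgebra.single τ (ε τ) * permSum ε S = permSum ε S := by
  rw [permSum, mul_sum]
  simp only [MonoidAlgebra.single_mul_single, ← map_mul]
  refine sum_bij (fun σ _ => τ * σ) (fun σ hσ => mul_mem_permsOn hτ hσ)
    (fun _ _ _ _ h => mul_left_cancel h) (fun σ hσ => ?_) fun _ _ => rfl
  exact ⟨τ⁻¹ * σ, mul_mem_permsOn (inv_mem_permsOn hτ) hσ, by simp⟩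

theorem permSum_mul_single (ε : Equiv.Perm X →* ℂ) {S : Finset X} {τ : Equiv.Perm X}
    (hτ : τ ∈ permsOn S) : permSum ε S * MonoidAlgebra.single τ (ε τ) = permSum ε S := by
  rw [permSum, sum_mul]
  simp only [MonoidAlgebra.single_mul_single, ← map_mul]
  refine sum_bij (fun σ _ => σ * τ) (fun σ hσ => mul_mem_permsOn hσ hτ)
    (fun _ _ _ _ h => mul_right_cancel h) (fun σ hσ => ?_) fun _ _ => rfl
  exact ⟨σ * τ⁻¹, mul_mem_permsOn hσ (inv_mem_permsOn hτ), by simp⟩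

theorem map_conj {X : Type*} (ε : Equiv.Perm X →* ℂ) (g σ : Equiv.Perm X) : ε (g * σ * g⁻¹) = ε σ := by
  rw [map_mul, map_mul, mul_right_comm, ← map_mul, mul_inv_cancel, map_one, one_mul]

theorem conj_permSum (ε : Equiv.Perm X →* ℂ) (S : Finset X) (g : Equiv.Perm X) :
    MonoidAlgebra.single g 1 * permSum ε S * MonoidAlgebra.single g⁻¹ 1 =
      permSum ε (S.map g.toEmbedding) := by
  have key : ∀ (S : Finset X) (g σ : Equiv.Perm X), σ ∈ permsOn S →
      g * σ * g⁻¹ ∈ permsOn (S.map g.toEmbedding) := by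
    intro S g σ hσ
    rw [mem_permsOn] at *
    intro x hx
    have hx' : g⁻¹ x ∉ S := by
      intro h
      apply hx
      rw [mem_map]
      exact ⟨_, h, by simp⟩
    simp only [Equiv.Perm.mul_apply]
    rw [hσ _ hx']
    simp
  rw [permSum, permSum, mul_sum, sum_mul]
  simp only [MonoidAlgebra.single_mul_single, one_mul, mul_one]
  refine sum_bij (fun σ _ => g * σ * g⁻¹) (fun σ hσ => key S g σ hσ)
    (fun _ _ _ _ h => by simpa using h) (fun σ hσ => ?_) fun σ _ => by rw [map_conj]
  refine ⟨g⁻¹ * σ * g, ?_, by group⟩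
  have := key _ g⁻¹ σ hσ
  rw [inv_inv, map_map] at this
  convert this
  ext x
  simp

/-- Coset decomposition: `σ` is the transposition of `x` and `σ x` times a permutation fixing `x`.
The version on the other side uses `σ⁻¹ x`. -/
theorem permSum_insert_left (ε : Equiv.Perm X →* ℂ) {S : Finset X} {x : X} (hx : x ∉ S) :
    permSum ε (insert x S) = ∑ c ∈ insert x S,
      MonoidAlgebra.single (Equiv.swap x c) (ε (Equiv.swap x c)) * permSum ε S := by
  simp only [permSum, mul_sum, MonoidAlgebra.single_mul_single, ← map_mul]
  rw [sum_sigma']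
  symm
  refine sum_bij (fun p _ => Equiv.swap x p.1 * p.2) ?_ ?_ ?_ fun _ _ => rfl
  · rintro ⟨c, σ⟩ h
    rw [mem_sigma] at h
    exact mul_mem_permsOn (swap_mem_permsOn (mem_insert_self _ _) h.1)
      (permsOn_mono (subset_insert _ _) h.2)
  · rintro ⟨c, σ⟩ h ⟨c', σ'⟩ h' heq
    rw [mem_sigma] at h h'
    have h1 := DFunLike.congr_fun heq x
    simp only [Equiv.Perm.mul_apply, mem_permsOn.mp h.2 x hx, mem_permsOn.mp h'.2 x hx,
      Equiv.swap_apply_left] at h1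
    obtain rfl : c = c' := h1
    simpa using heq
  · intro σ hσ
    refine ⟨⟨σ x, Equiv.swap x (σ x) * σ⟩, ?_, by simp⟩
    rw [mem_sigma]
    have h1 : σ x ∈ insert x S :=
      (apply_mem_iff_of_mem_permsOn hσ x).mpr (mem_insert_self _ _)
    refine ⟨h1, ?_⟩
    rw [mem_permsOn]
    intro y hy
    have h2 := mul_mem_permsOn (swap_mem_permsOn (mem_insert_self x S) h1) hσ
    by_cases hyx : y = x
    · subst hyx; simp
    · exact mem_permsOn.mp h2 y (by simp [hy, hyx])

theorem permSum_insert_right (ε : Equiv.Perm X →* ℂ) {S : Finset X} {x : X} (hx : x ∉ S) :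
    permSum ε (insert x S) = ∑ c ∈ insert x S,
      permSum ε S * MonoidAlgebra.single (Equiv.swap x c) (ε (Equiv.swap x c)) := by
  simp only [permSum, sum_mul, MonoidAlgebra.single_mul_single, ← map_mul]
  rw [sum_sigma']
  symm
  refine sum_bij (fun p _ => p.2 * Equiv.swap x p.1) ?_ ?_ ?_ fun _ _ => rfl
  · rintro ⟨c, σ⟩ h
    rw [mem_sigma] at h
    exact mul_mem_permsOn (permsOn_mono (subset_insert _ _) h.2)
      (swap_mem_permsOn (mem_insert_self _ _) h.1)
  · rintro ⟨c, σ⟩ h ⟨c', σ'⟩ h' heq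
    rw [mem_sigma] at h h'
    have h1 := DFunLike.congr_fun (congrArg (fun g => g⁻¹) heq) x
    simp only [mul_inv_rev, Equiv.swap_inv, Equiv.Perm.mul_apply,
      mem_permsOn.mp (inv_mem_permsOn h.2) x hx, mem_permsOn.mp (inv_mem_permsOn h'.2) x hx,
      Equiv.swap_apply_left] at h1
    obtain rfl : c = c' := h1
    simpa using heq
  · intro σ hσ
    refine ⟨⟨σ⁻¹ x, σ * Equiv.swap x (σ⁻¹ x)⟩, ?_, by simp [mul_assoc]⟩
    rw [mem_sigma]
    have h1 : σ⁻¹ x ∈ insert x S :=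
      (apply_mem_iff_of_mem_permsOn (inv_mem_permsOn hσ) x).mpr (mem_insert_self _ _)
    refine ⟨h1, ?_⟩
    rw [mem_permsOn]
    intro y hy
    have h2 := mul_mem_permsOn hσ (swap_mem_permsOn (mem_insert_self x S) h1)
    by_cases hyx : y = x
    · subst hyx; simp
    · exact mem_permsOn.mp h2 y (by simp [hy, hyx])

theorem commute_of_disjoint_permsOn {S S' : Finset X} (h : Disjoint S S') {σ τ : Equiv.Perm X}
    (hσ : σ ∈ permsOn S) (hτ : τ ∈ permsOn S') : σ * τ = τ * σ := by
  refine Equiv.Perm.Disjoint.commute fun x => ?_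
  by_cases hx : x ∈ S
  · exact Or.inr (mem_permsOn.mp hτ x (disjoint_left.mp h hx))
  · exact Or.inl (mem_permsOn.mp hσ x hx)

theorem permSum_comm_of_disjoint (ε ε' : Equiv.Perm X →* ℂ) {S S' : Finset X}
    (h : Disjoint S S') : permSum ε S * permSum ε' S' = permSum ε' S' * permSum ε S := by
  refine Commute.sum_left _ _ _ fun σ hσ => Commute.sum_right _ _ _ fun τ hτ => ?_
  exact MonoidAlgebra.single_commute_single (commute_of_disjoint_permsOn h hσ hτ) (Commute.all _ _)

theorem card_permsOn (S : Finset X) : (permsOn S).card = S.card.factorial := by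
  have h1 : Nat.card {σ : Equiv.Perm X // ∀ x, x ∉ S → σ x = x} = (permsOn S).card := by
    rw [Nat.card_eq_fintype_card]
    exact Fintype.card_of_subtype _ fun σ => mem_permsOn
  have h2 := Nat.card_congr (Equiv.Perm.subtypeEquivSubtypePerm fun x => x ∈ S)
  rw [← h1, ← h2, Nat.card_eq_fintype_card, Fintype.card_perm, Fintype.card_coe]

theorem permSum_mul_permSum_of_subset (ε : Equiv.Perm X →* ℂ) {S S' : Finset X} (h : S' ⊆ S) :
    permSum ε S * permSum ε S' = S'.card.factorial • permSum ε S := by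
  rw [permSum.eq_1 ε S', mul_sum]
  rw [sum_congr rfl fun σ hσ => permSum_mul_single ε (permsOn_mono h hσ), sum_const, card_permsOn]

theorem permSum_mul_permSum_of_subset' (ε : Equiv.Perm X →* ℂ) {S S' : Finset X} (h : S' ⊆ S) :
    permSum ε S' * permSum ε S = S'.card.factorial • permSum ε S := by
  rw [permSum.eq_1 ε S', sum_mul]
  rw [sum_congr rfl fun σ hσ => single_mul_permSum ε (permsOn_mono h hσ), sum_const, card_permsOn]

variable (X) in
/-- The sign character with values in `ℂ`. -/
def signC : Equiv.Perm X →* ℂ :=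
  ((Int.castRingHom ℂ : ℤ →* ℂ).comp (Units.coeHom ℤ)).comp Equiv.Perm.sign

theorem signC_apply (σ : Equiv.Perm X) : signC X σ = ((Equiv.Perm.sign σ : ℤ) : ℂ) := rfl

theorem signC_swap {x y : X} (h : x ≠ y) : signC X (Equiv.swap x y) = -1 := by
  simp [signC_apply, Equiv.Perm.sign_swap h]

/-- The symmetrizer of `S`. -/
def symmetrizer (S : Finset X) : MonoidAlgebra ℂ (Equiv.Perm X) := permSum 1 S

/-- The antisymmetrizer of `S`. -/
def antisymmetrizer (S : Finset X) : MonoidAlgebra ℂ (Equiv.Perm X) := permSum (signC X) S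

/-- `a g b = 0` if `g` sends two elements of the column `C` to the row `R`. -/
theorem symmetrizer_mul_single_mul_antisymmetrizer {R C : Finset X} {g : Equiv.Perm X} {x y : X}
    (hxy : x ≠ y) (hx : x ∈ C) (hy : y ∈ C) (hgx : g x ∈ R) (hgy : g y ∈ R) :
    symmetrizer R * MonoidAlgebra.single g 1 * antisymmetrizer C = 0 := by
  have h1 := permSum_mul_single (1 : Equiv.Perm X →* ℂ) (swap_mem_permsOn hgx hgy)
  have h2 := single_mul_permSum (signC X) (swap_mem_permsOn hx hy)
  rw [signC_swap hxy] at h2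
  have h3 : Equiv.swap (g x) (g y) * g = g * Equiv.swap x y := by
    rw [Equiv.mul_swap_eq_swap_mul]
  have h4 : MonoidAlgebra.single (Equiv.swap x y) 1 * antisymmetrizer C =
      -antisymmetrizer C := by
    have : MonoidAlgebra.single (Equiv.swap x y) (1 : ℂ) =
        -MonoidAlgebra.single (Equiv.swap x y) (-1 : ℂ) := by
      rw [← neg_one_smul ℂ, MonoidAlgebra.smul_single]
      simp
    rw [this, neg_mul, antisymmetrizer, h2]
  have h5 : symmetrizer R * MonoidAlgebra.single g 1 * antisymmetrizer C =
      -(symmetrizer R * MonoidAlgebra.single g 1 * antisymmetrizer C) := by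
    calc symmetrizer R * MonoidAlgebra.single g 1 * antisymmetrizer C
        = symmetrizer R * MonoidAlgebra.single (Equiv.swap (g x) (g y)) 1 *
            MonoidAlgebra.single g 1 * antisymmetrizer C := by
          congr 2
          exact h1.symm
      _ = symmetrizer R * MonoidAlgebra.single g 1 *
            (MonoidAlgebra.single (Equiv.swap x y) 1 * antisymmetrizer C) := by
          rw [← mul_assoc, mul_assoc (symmetrizer R) (MonoidAlgebra.single (Equiv.swap (g x) (g y)) _),
            mul_assoc (symmetrizer R) (MonoidAlgebra.single g _),
            MonoidAlgebra.single_mul_single, MonoidAlgebra.single_mul_single, h3]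
      _ = _ := by rw [h4, mul_neg]
  exact eq_zero_of_eq_neg h5

/-! ### Young symmetrizers of hooks -/

/-- The Young symmetrizer of a hook with corner `x`, whose column consists of `x` and `S` and whose
row is the complement of `S`. -/
def hookElement (S : Finset X) (x : X) : MonoidAlgebra ℂ (Equiv.Perm X) :=
  symmetrizer Sᶜ * antisymmetrizer (insert x S)

/-- If both transpositions are nontrivial, their product sends the two column elements `x` and `c`
to `r` and `x`, which both lie in the row, so the term dies. If one is trivial, the other is
absorbed by the row or the column. -/
theorem hookElement_middle {S : Finset X} {x c r : X} (hx : x ∉ S) (hc : c ∈ insert x S)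
    (hr : r ∈ Sᶜ) :
    symmetrizer Sᶜ * MonoidAlgebra.single (Equiv.swap x c) (signC X (Equiv.swap x c)) *
        MonoidAlgebra.single (Equiv.swap x r) 1 * antisymmetrizer (insert x S) =
      if c = x ∨ r = x then hookElement S x else 0 := by
  have hxc : x ∈ Sᶜ := mem_compl.mpr hx
  have ha : ∀ g, g ∈ permsOn Sᶜ → symmetrizer Sᶜ * MonoidAlgebra.single g 1 = symmetrizer Sᶜ :=
    fun g hg => permSum_mul_single (1 : Equiv.Perm X →* ℂ) hg
  have hb : ∀ g, g ∈ permsOn (insert x S) → MonoidAlgebra.single g (signC X g) *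
      antisymmetrizer (insert x S) = antisymmetrizer (insert x S) :=
    fun g hg => single_mul_permSum (signC X) hg
  have h1 : ∀ z : X, MonoidAlgebra.single (Equiv.swap z z) (1 : ℂ) = 1 := by
    intro z
    rw [Equiv.swap_self]
    rfl
  split_ifs with h
  · by_cases hcx : c = x
    · subst hcx
      have h2 : signC X (Equiv.swap c c) = 1 := by
        rw [Equiv.swap_self]
        exact map_one _
      rw [h2, h1, mul_one, ha _ (swap_mem_permsOn hxc hr), hookElement]
    · obtain rfl : r = x := h.resolve_left hcx
      rw [h1, mul_one, mul_assoc, hb _ (swap_mem_permsOn (mem_insert_self _ _) hc), hookElement]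
  · push Not at h
    have hcS : c ∈ S := mem_of_mem_insert_of_ne hc h.1
    have hrc : r ≠ c := by rintro rfl; exact mem_compl.mp hr hcS
    rw [mul_assoc (symmetrizer Sᶜ), MonoidAlgebra.single_mul_single, mul_one]
    have h2 : MonoidAlgebra.single (Equiv.swap x c * Equiv.swap x r)
        (signC X (Equiv.swap x c)) = signC X (Equiv.swap x c) •
        MonoidAlgebra.single (Equiv.swap x c * Equiv.swap x r) (1 : ℂ) := by
      rw [MonoidAlgebra.smul_single, smul_eq_mul, mul_one]
    rw [h2, mul_smul_comm, smul_mul_assoc,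
      symmetrizer_mul_single_mul_antisymmetrizer (Ne.symm h.1) (mem_insert_self x S) hc, smul_zero]
    · rw [Equiv.Perm.mul_apply, Equiv.swap_apply_left, Equiv.swap_apply_of_ne_of_ne h.2 hrc]
      exact hr
    · rw [Equiv.Perm.mul_apply, Equiv.swap_apply_of_ne_of_ne h.1 (Ne.symm hrc),
        Equiv.swap_apply_right]
      exact hxc

/-- In `a b a b` the inner `b` and `a` are expanded into cosets of the groups that fix the corner.
Their leftover factors `b'` and `a'` commute past the outer `a` and `b` and give the two factorials.
The constant is the product of the hook lengths. -/
theorem hookElement_mul_self {S : Finset X} {x : X} (hx : x ∉ S) :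
    hookElement S x * hookElement S x =
      (Fintype.card X * (S.card.factorial * (Sᶜ.erase x).card.factorial)) • hookElement S x := by
  set a := symmetrizer Sᶜ with ha
  set b := antisymmetrizer (insert x S) with hb
  set a' := symmetrizer (Sᶜ.erase x) with ha'
  set b' := antisymmetrizer S with hb'
  have hxc : x ∈ Sᶜ := mem_compl.mpr hx
  have e1 : a * b' = b' * a := permSum_comm_of_disjoint _ _ disjoint_compl_left
  have e2 : a' * b = b * a' := by
    refine permSum_comm_of_disjoint _ _ ?_
    rw [disjoint_left]
    intro y hy hy'
    rw [mem_erase, mem_compl] at hy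
    rw [mem_insert] at hy'
    tauto
  have e3 : a' * b' = b' * a' :=
    permSum_comm_of_disjoint _ _ (disjoint_compl_left.mono_left (erase_subset _ _))
  have hbsum : b = ∑ c ∈ insert x S, b' *
      MonoidAlgebra.single (Equiv.swap x c) (signC X (Equiv.swap x c)) :=
    permSum_insert_right _ hx
  have hasum : a = ∑ r ∈ Sᶜ, MonoidAlgebra.single (Equiv.swap x r) 1 * a' := by
    have h := permSum_insert_left (1 : Equiv.Perm X →* ℂ) (notMem_erase x Sᶜ)
    rw [insert_erase hxc] at h
    exact h
  have key : hookElement S x * hookElement S x =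
      ∑ c ∈ insert x S, ∑ r ∈ Sᶜ, b' * (if c = x ∨ r = x then hookElement S x else 0) * a' := by
    calc hookElement S x * hookElement S x = a * b * (a * b) := rfl
      _ = a * (∑ c ∈ insert x S, b' *
            MonoidAlgebra.single (Equiv.swap x c) (signC X (Equiv.swap x c))) *
          ((∑ r ∈ Sᶜ, MonoidAlgebra.single (Equiv.swap x r) 1 * a') * b) := by
          rw [← hbsum, ← hasum]
      _ = _ := by
        simp only [mul_sum, sum_mul]
        rw [sum_comm]
        refine sum_congr rfl fun c hc => sum_congr rfl fun r hr => ?_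
        rw [← hookElement_middle hx hc hr]
        calc _ = (a * b') * MonoidAlgebra.single (Equiv.swap x c) (signC X (Equiv.swap x c)) *
              MonoidAlgebra.single (Equiv.swap x r) 1 * (a' * b) := by simp only [mul_assoc]
          _ = _ := by rw [e1, e2]; simp only [mul_assoc, ← ha, ← hb]
  have hbab : b' * hookElement S x * a' =
      (S.card.factorial * (Sᶜ.erase x).card.factorial) • hookElement S x := by
    have h1 : a * a' = (Sᶜ.erase x).card.factorial • a :=
      permSum_mul_permSum_of_subset _ (erase_subset _ _)
    have h2 : b' * b = S.card.factorial • b :=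
      permSum_mul_permSum_of_subset' _ (subset_insert _ _)
    calc b' * hookElement S x * a' = (b' * a) * (b * a') := by
          rw [hookElement]; simp only [mul_assoc, ← ha, ← hb]
      _ = a * (b' * a') * b := by rw [← e1, ← e2]; simp only [mul_assoc]
      _ = (a * a') * (b' * b) := by rw [← e3]; simp only [mul_assoc]
      _ = _ := by rw [h1, h2, smul_mul_smul_comm, mul_comm (Nat.factorial _), hookElement]
  -- The surviving pairs are those with `c = x`, one for each element of the row, and those with `r
  -- = x` and `c ∈ S`.
  have hcount : ∑ c ∈ insert x S, ∑ r ∈ Sᶜ, (if c = x ∨ r = x then 1 else 0) = Fintype.card X := by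
    rw [sum_insert hx]
    simp only [true_or, if_true, sum_const, smul_eq_mul, mul_one]
    have : ∀ c ∈ S, ∑ r ∈ Sᶜ, (if c = x ∨ r = x then 1 else 0) = 1 := by
      intro c hc
      have hcx : c ≠ x := by rintro rfl; exact hx hc
      simp [hcx, hx]
    rw [sum_congr rfl this, sum_const, smul_eq_mul, mul_one, add_comm, card_add_card_compl]
  rw [key]
  have h1 : ∀ c r, b' * (if c = x ∨ r = x then hookElement S x else 0) * a' =
      (if c = x ∨ r = x then 1 else 0) • (b' * hookElement S x * a') := by
    intro c r
    split_ifs <;> simp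
  simp only [h1, ← sum_smul]
  rw [hcount, hbab, smul_smul]

end PermSum

end CompletedHurwitz

end

/-! ### Sums of hook symmetrizers, their Pieri rule, and traces on left ideals. -/

noncomputable section

namespace CompletedHurwitz

open Finset

section HookSum

variable {X : Type*} [Fintype X] [DecidableEq X]

variable (X) in
/-- The sum of the Young symmetrizers of all hooks in `X` with leg length `k`. -/
def hookSum (k : ℕ) : MonoidAlgebra ℂ (Equiv.Perm X) :=
  ∑ S ∈ powersetCard k (univ : Finset X), ∑ x ∈ Sᶜ, hookElement S x

variable (X) in
/-- The sum of the products `a_{X ∖ S} b_S` over all `k`-element subsets `S`. -/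
def splitSum (k : ℕ) : MonoidAlgebra ℂ (Equiv.Perm X) :=
  ∑ S ∈ powersetCard k (univ : Finset X), symmetrizer Sᶜ * antisymmetrizer S

theorem swap_self_eq_one {X : Type*} [DecidableEq X] (x : X) : Equiv.swap x x = 1 := Equiv.swap_self x

theorem symmetrizer_insert {R : Finset X} {c : X} (hc : c ∉ R) :
    symmetrizer (insert c R) = symmetrizer R +
      ∑ x ∈ R, symmetrizer R * MonoidAlgebra.single (Equiv.swap x c) 1 := by
  rw [symmetrizer, permSum_insert_right _ hc, sum_insert hc, swap_self_eq_one, map_one,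
    ← MonoidAlgebra.one_def, mul_one]
  refine congrArg₂ _ rfl (sum_congr rfl fun x _ => ?_)
  rw [Equiv.swap_comm, MonoidHom.one_apply, symmetrizer]

theorem antisymmetrizer_insert {S : Finset X} {x : X} (hx : x ∉ S) :
    antisymmetrizer (insert x S) = antisymmetrizer S -
      ∑ c ∈ S, MonoidAlgebra.single (Equiv.swap x c) 1 * antisymmetrizer S := by
  rw [antisymmetrizer, permSum_insert_left _ hx, sum_insert hx, swap_self_eq_one, map_one,
    ← MonoidAlgebra.one_def, one_mul, sub_eq_add_neg, ← sum_neg_distrib]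
  refine congrArg₂ _ rfl (sum_congr rfl fun c hc => ?_)
  have hxc : x ≠ c := by rintro rfl; exact hx hc
  have h2 : MonoidAlgebra.single (Equiv.swap x c) (-1 : ℂ) =
      -MonoidAlgebra.single (Equiv.swap x c) (1 : ℂ) := by
    rw [← neg_one_smul ℂ (MonoidAlgebra.single _ _), MonoidAlgebra.smul_single, smul_eq_mul,
      mul_one]
  rw [signC_swap hxc, h2, neg_mul, antisymmetrizer]

/-- Pieri rule: moving `x` into the column subtracts, and moving `c` into the row adds, the same
terms with the transpositions of `x` and `c`. They cancel and leave one copy of `a b` for each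
element of `X`. -/
theorem sum_hookElement_add (S : Finset X) :
    ∑ x ∈ Sᶜ, hookElement S x + ∑ c ∈ S, hookElement (S.erase c) c =
      Fintype.card X • (symmetrizer Sᶜ * antisymmetrizer S) := by
  have h1 : ∀ x ∈ Sᶜ, hookElement S x = symmetrizer Sᶜ * antisymmetrizer S -
      ∑ c ∈ S, symmetrizer Sᶜ * MonoidAlgebra.single (Equiv.swap x c) 1 * antisymmetrizer S := by
    intro x hx
    rw [hookElement, antisymmetrizer_insert (mem_compl.mp hx), mul_sub, mul_sum]
    simp only [mul_assoc]
  have h2 : ∀ c ∈ S, hookElement (S.erase c) c = symmetrizer Sᶜ * antisymmetrizer S +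
      ∑ x ∈ Sᶜ, symmetrizer Sᶜ * MonoidAlgebra.single (Equiv.swap x c) 1 * antisymmetrizer S := by
    intro c hc
    have hc' : c ∉ Sᶜ := by simpa using hc
    rw [hookElement, insert_erase hc, compl_erase, symmetrizer_insert hc', add_mul, sum_mul]
  rw [sum_congr rfl h1, sum_congr rfl h2, sum_sub_distrib, sum_add_distrib,
    sum_comm (s := S), sum_const, sum_const, sub_add_eq_add_sub, add_comm, add_assoc, add_comm,
    add_sub_assoc]
  rw [← card_add_card_compl S, add_smul]
  abel

theorem sum_powersetCard_succ_erase {M : Type*} [AddCommMonoid M] (f : Finset X → X → M) (k : ℕ) :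
    ∑ S ∈ powersetCard (k + 1) (univ : Finset X), ∑ c ∈ S, f (S.erase c) c =
      ∑ S ∈ powersetCard k (univ : Finset X), ∑ x ∈ Sᶜ, f S x := by
  rw [sum_sigma', sum_sigma']
  refine sum_bij' (fun p _ => ⟨p.1.erase p.2, p.2⟩) (fun p _ => ⟨insert p.2 p.1, p.2⟩)
    ?_ ?_ ?_ ?_ fun _ _ => rfl
  · rintro ⟨S, c⟩ h
    simp only [mem_sigma, mem_powersetCard_univ, mem_compl] at h ⊢
    exact ⟨by rw [card_erase_of_mem h.2, h.1]; rfl, notMem_erase _ _⟩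
  · rintro ⟨S, x⟩ h
    simp only [mem_sigma, mem_powersetCard_univ, mem_compl] at h ⊢
    exact ⟨by rw [card_insert_of_notMem h.2, h.1], mem_insert_self _ _⟩
  · rintro ⟨S, c⟩ h
    simp only [mem_sigma] at h
    simp [insert_erase h.2]
  · rintro ⟨S, x⟩ h
    simp only [mem_sigma, mem_compl] at h
    simp [erase_insert h.2]

variable (X) in
theorem hookSum_succ_add (k : ℕ) :
    hookSum X (k + 1) + hookSum X k = Fintype.card X • splitSum X (k + 1) := by
  rw [hookSum, hookSum, ← sum_powersetCard_succ_erase _ k, ← sum_add_distrib, splitSum, smul_sum]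
  exact sum_congr rfl fun S _ => sum_hookElement_add S

variable (X) in
theorem hookSum_zero : hookSum X 0 = Fintype.card X • splitSum X 0 := by
  have h := sum_hookElement_add (∅ : Finset X)
  simpa [hookSum, splitSum] using h

variable (X) in
theorem hookSum_card : hookSum X (Fintype.card X) = 0 := by
  rw [hookSum]
  refine sum_eq_zero fun S hS => ?_
  rw [mem_powersetCard_univ, card_eq_iff_eq_univ] at hS
  rw [hS, compl_univ, sum_empty]

/-! ### Conjugates of the Young symmetrizer of a hook -/

theorem conj_hookElement (S : Finset X) (x : X) (g : Equiv.Perm X) :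
    MonoidAlgebra.single g 1 * hookElement S x * MonoidAlgebra.single g⁻¹ 1 =
      hookElement (S.map g.toEmbedding) (g x) := by
  have h1 : MonoidAlgebra.single g⁻¹ (1 : ℂ) * MonoidAlgebra.single g 1 = 1 := by
    rw [MonoidAlgebra.single_mul_single, inv_mul_cancel, mul_one, MonoidAlgebra.one_def]
  have h2 : (S.map g.toEmbedding)ᶜ = Sᶜ.map g.toEmbedding := by
    ext y
    simp only [mem_compl, mem_map_equiv]
  have h3 : insert (g x) (S.map g.toEmbedding) = (insert x S).map g.toEmbedding := by
    rw [map_insert]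
    rfl
  rw [hookElement, hookElement, h2, h3, symmetrizer, antisymmetrizer, symmetrizer, antisymmetrizer,
    ← conj_permSum, ← conj_permSum]
  calc _ = MonoidAlgebra.single g 1 * permSum 1 Sᶜ * 1 * permSum (signC X) (insert x S) *
        MonoidAlgebra.single g⁻¹ 1 := by rw [mul_one]; simp only [mul_assoc]
    _ = _ := by rw [← h1]; simp only [mul_assoc]

theorem exists_perm_map_eq {S S' : Finset X} {x y : X} (hS : S.card = S'.card) (hx : x ∉ S)
    (hy : y ∉ S') : ∃ g : Equiv.Perm X, g x = y ∧ S.map g.toEmbedding = S' := by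
  let e : {z // z ∈ S} ≃ {z // z ∈ S'} := Finset.equivOfCardEq hS
  have h1 : S.map e.extendSubtype.toEmbedding = S' := by
    apply eq_of_subset_of_card_le
    · intro z hz
      obtain ⟨w, hw, rfl⟩ := mem_map.mp hz
      exact e.extendSubtype_mem w hw
    · rw [card_map, hS]
  have h2 : e.extendSubtype x ∉ S' := e.extendSubtype_not_mem x hx
  -- Both points swapped lie outside `S'`, so correcting the image of `x` does not disturb the image
  -- of `S`.
  refine ⟨Equiv.swap (e.extendSubtype x) y * e.extendSubtype, by simp, ?_⟩
  have h3 : (Equiv.swap (e.extendSubtype x) y * e.extendSubtype).toEmbedding =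
      e.extendSubtype.toEmbedding.trans (Equiv.swap (e.extendSubtype x) y).toEmbedding := rfl
  rw [h3, ← map_map, h1]
  ext z
  rw [mem_map_equiv, Equiv.symm_swap]
  by_cases hz1 : z = e.extendSubtype x
  · subst hz1; simp [hy, h2]
  · by_cases hz2 : z = y
    · subst hz2; simp [hy, h2]
    · rw [Equiv.swap_apply_of_ne_of_ne hz1 hz2]

theorem sum_comp_of_card_fiber {ι κ M : Type*} [DecidableEq κ] [AddCommMonoid M] {s : Finset ι}
    {t : Finset κ} {f : ι → κ} (hf : ∀ i ∈ s, f i ∈ t) {n : ℕ}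
    (hn : ∀ y ∈ t, (s.filter fun i => f i = y).card = n) (F : κ → M) :
    ∑ i ∈ s, F (f i) = n • ∑ y ∈ t, F y := by
  rw [← sum_fiberwise_of_maps_to hf, smul_sum]
  refine sum_congr rfl fun y hy => ?_
  rw [sum_congr rfl (g := fun _ => F y) (by intro g hg; rw [(mem_filter.mp hg).2]), sum_const,
    hn y hy]

/-- The permutations act transitively on the pairs (leg, corner), so averaging one hook element over
conjugation gives all hooks of the same leg length equally often. -/
theorem sum_conj_hookElement {S : Finset X} {x : X} (hx : x ∉ S) :
    ∑ g : Equiv.Perm X, MonoidAlgebra.single g 1 * hookElement S x * MonoidAlgebra.single g⁻¹ 1 =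
      (S.card.factorial * (Sᶜ.erase x).card.factorial) • hookSum X S.card := by
  set T := (powersetCard S.card (univ : Finset X)).sigma fun S => Sᶜ with hT
  let f : Equiv.Perm X → (_ : Finset X) × X := fun g => ⟨S.map g.toEmbedding, g x⟩
  have hf : ∀ g ∈ (univ : Finset (Equiv.Perm X)), f g ∈ T := by
    intro g _
    simp only [hT, f, mem_sigma, mem_powersetCard_univ, card_map, true_and, mem_compl]
    simpa using hx
  set κ := (univ.filter fun g => f g = ⟨S, x⟩).card with hκ
  have hfib : ∀ y ∈ T, (univ.filter fun g => f g = y).card = κ := by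
    rintro ⟨S', y⟩ h
    simp only [hT, mem_sigma, mem_powersetCard_univ, mem_compl] at h
    obtain ⟨g₀, hg1, hg2⟩ := exists_perm_map_eq h.1.symm hx h.2
    symm
    refine card_bij (fun g _ => g₀ * g) ?_ (fun _ _ _ _ h => mul_left_cancel h) ?_
    · intro g hg
      simp only [f, mem_filter, mem_univ, true_and, Sigma.mk.injEq, heq_eq_eq] at hg ⊢
      refine ⟨?_, by rw [Equiv.Perm.mul_apply, hg.2, hg1]⟩
      have h3 : (g₀ * g).toEmbedding = g.toEmbedding.trans g₀.toEmbedding := rfl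
      rw [h3, ← map_map, hg.1, hg2]
    · intro g hg
      simp only [f, mem_filter, mem_univ, true_and, Sigma.mk.injEq, heq_eq_eq] at hg
      refine ⟨g₀⁻¹ * g, ?_, by simp⟩
      simp only [f, mem_filter, mem_univ, true_and, Sigma.mk.injEq, heq_eq_eq]
      have h3 : (g₀⁻¹ * g).toEmbedding = g.toEmbedding.trans (g₀⁻¹ : Equiv.Perm X).toEmbedding := rfl
      have h4 : Finset.map (g₀⁻¹ : Equiv.Perm X).toEmbedding S' = S := by
        rw [← hg2, map_map]
        ext z
        simp
      refine ⟨by rw [h3, ← map_map, hg.1, h4], ?_⟩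
      rw [Equiv.Perm.mul_apply, hg.2, Equiv.Perm.inv_eq_iff_eq, hg1]
  -- The common fibre size comes from counting: `|X|!` permutations are spread over `choose(|X|, k)
  -- (|X| - k)` pairs, with `k = |S|`.
  have hcard : κ = S.card.factorial * (Sᶜ.erase x).card.factorial := by
    have h1 := sum_comp_of_card_fiber hf hfib (fun _ => 1)
    rw [sum_const, card_univ, Fintype.card_perm, sum_const, hT, card_sigma] at h1
    have h2 : ∀ S' ∈ powersetCard S.card (univ : Finset X),
        S'ᶜ.card = Fintype.card X - S.card := by
      intro S' h
      rw [card_compl, mem_powersetCard_univ.mp h]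
    rw [sum_congr rfl h2, sum_const, card_powersetCard, card_univ] at h1
    rw [card_erase_of_mem (mem_compl.mpr hx), card_compl]
    have hlt : S.card < Fintype.card X := card_lt_univ_of_notMem hx
    obtain ⟨m, hm⟩ := Nat.exists_eq_add_of_lt hlt
    have h3 := Nat.choose_mul_factorial_mul_factorial hlt.le
    rw [show Fintype.card X - S.card = m + 1 by omega] at *
    simp only [smul_eq_mul, mul_one] at h1
    rw [Nat.factorial_succ] at h3
    rw [Nat.add_sub_cancel]
    have hpos : 0 < (Fintype.card X).choose S.card * (m + 1) :=
      Nat.mul_pos (Nat.choose_pos hlt.le) (Nat.succ_pos m)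
    apply Nat.eq_of_mul_eq_mul_right hpos
    rw [← h1, ← h3]
    ring
  have := sum_comp_of_card_fiber hf hfib fun y => hookElement y.1 y.2
  rw [hcard, hT, sum_sigma] at this
  rw [hookSum, ← this]
  exact sum_congr rfl fun g _ => conj_hookElement S x g

end HookSum

/-! ### Traces on left ideals generated by quasi-idempotents -/

section Trace

variable {Γ : Type*} [Group Γ] [Fintype Γ]

instance finite_ideal (I : Ideal (MonoidAlgebra ℂ Γ)) : Module.Finite ℂ I := by
  have : Module.Finite ℂ (I.restrictScalars ℂ) := inferInstance
  exact this

theorem trace_mul_left_mul_right (σ : Γ) (c : MonoidAlgebra ℂ Γ) :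
    LinearMap.trace ℂ (MonoidAlgebra ℂ Γ)
      (LinearMap.mulLeft ℂ (MonoidAlgebra.single σ 1) ∘ₗ LinearMap.mulRight ℂ c) =
      ∑ g : Γ, c.coeff (g⁻¹ * σ⁻¹ * g) := by
  classical
  rw [LinearMap.trace_eq_matrix_trace ℂ (MonoidAlgebra.basis Γ ℂ), Matrix.trace]
  refine sum_congr rfl fun g _ => ?_
  rw [Matrix.diag_apply, LinearMap.toMatrix_apply, MonoidAlgebra.basis_apply]
  change (MonoidAlgebra.single σ (1 : ℂ) * (MonoidAlgebra.single g 1 * c)).coeff g = _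
  rw [MonoidAlgebra.coeff_single_mul_apply, MonoidAlgebra.coeff_single_mul_apply]
  simp [mul_assoc]

/-- Since `c / n` is idempotent, `x ↦ n⁻¹ x c` retracts the algebra onto the ideal, and cyclicity of
the trace moves the computation to the whole group algebra. -/
theorem trace_span_singleton {c : MonoidAlgebra ℂ Γ} {n : ℂ} (hn : n ≠ 0) (hc : c * c = n • c)
    (σ : Γ) :
    LinearMap.trace ℂ (Ideal.span {c})
      (Algebra.lsmul ℂ ℂ (Ideal.span {c}) (MonoidAlgebra.single σ (1 : ℂ))) =
      n⁻¹ * ∑ g : Γ, c.coeff (g⁻¹ * σ⁻¹ * g) := by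
  let ι : Ideal.span {c} →ₗ[ℂ] MonoidAlgebra ℂ Γ := (Ideal.span {c}).subtype.restrictScalars ℂ
  let π : MonoidAlgebra ℂ Γ →ₗ[ℂ] Ideal.span {c} :=
    { toFun := fun x => ⟨n⁻¹ • (x * c), by
        rw [← smul_mul_assoc]
        exact Ideal.mul_mem_left _ _ (Ideal.subset_span rfl)⟩
      map_add' := fun x y => by ext1; simp [add_mul]
      map_smul' := fun a x => Subtype.ext (by
        change n⁻¹ • (a • x * c) = a • n⁻¹ • (x * c)
        rw [smul_mul_assoc, smul_comm]) }
  have hπι : ∀ x, π (ι x) = x := by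
    rintro ⟨x, hx⟩
    obtain ⟨y, rfl⟩ := Ideal.mem_span_singleton'.mp hx
    ext1
    change n⁻¹ • (y * c * c) = y * c
    rw [mul_assoc, hc, mul_smul_comm, smul_smul, inv_mul_cancel₀ hn, one_smul]
  have h1 : (Algebra.lsmul ℂ ℂ (Ideal.span {c}) (MonoidAlgebra.single σ (1 : ℂ)) :
      Ideal.span {c} →ₗ[ℂ] Ideal.span {c}) =
      π ∘ₗ (LinearMap.mulLeft ℂ (MonoidAlgebra.single σ 1) ∘ₗ ι) := by
    ext1 x
    change _ = π (ι ((MonoidAlgebra.single σ (1 : ℂ)) • x))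
    rw [hπι]
    rfl
  have h2 : (LinearMap.mulLeft ℂ (MonoidAlgebra.single σ 1) ∘ₗ ι) ∘ₗ π =
      n⁻¹ • (LinearMap.mulLeft ℂ (MonoidAlgebra.single σ 1) ∘ₗ LinearMap.mulRight ℂ c) := by
    refine LinearMap.ext fun x => ?_
    change MonoidAlgebra.single σ (1 : ℂ) * (n⁻¹ • (x * c)) =
      n⁻¹ • (MonoidAlgebra.single σ (1 : ℂ) * (x * c))
    rw [mul_smul_comm]
  rw [h1, LinearMap.trace_comp_comm', h2, map_smul, trace_mul_left_mul_right, smul_eq_mul]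

end Trace

end CompletedHurwitz

end

/-! ### Signed counts of invariant subsets in terms of the cycle type. -/

noncomputable section

namespace CompletedHurwitz

open Finset

set_option linter.unusedSectionVars false

/-! ### Invariant subsets of a permutation -/

section Invariant

variable {X : Type*} [Fintype X] [DecidableEq X]

/-- The subset `S` is mapped to itself by `σ`. -/
def IsInvariant (σ : Equiv.Perm X) (S : Finset X) : Prop := ∀ x, σ x ∈ S ↔ x ∈ S

theorem isInvariant_of_forall_mem {σ : Equiv.Perm X} {S : Finset X} (h : ∀ x ∈ S, σ x ∈ S) :
    IsInvariant σ S := by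
  have h1 : S.map σ.toEmbedding = S := by
    apply eq_of_subset_of_card_le
    · intro z hz
      obtain ⟨w, hw, rfl⟩ := mem_map.mp hz
      exact h w hw
    · rw [card_map]
  intro x
  nth_rewrite 1 [← h1]
  rw [mem_map_equiv, Equiv.symm_apply_apply]

open Classical in
/-- The permutation that agrees with `σ` on the invariant set `S` and fixes the complement. -/
def restrictPerm (σ : Equiv.Perm X) (S : Finset X) : Equiv.Perm X :=
  if h : IsInvariant σ S then Equiv.Perm.ofSubtype (p := fun x => x ∈ S) (σ.subtypePerm h) else 1

theorem restrictPerm_apply {σ : Equiv.Perm X} {S : Finset X} (h : IsInvariant σ S) (x : X) :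
    restrictPerm σ S x = if x ∈ S then σ x else x := by
  rw [restrictPerm, dif_pos h]
  split_ifs with hx
  · rw [Equiv.Perm.ofSubtype_apply_of_mem _ hx]
    rfl
  · rw [Equiv.Perm.ofSubtype_apply_of_not_mem _ hx]

theorem eq_restrictPerm {σ q : Equiv.Perm X} {S : Finset X} (h : IsInvariant σ S)
    (hq : q ∈ permsOn S) (hS : ∀ x ∈ S, q x = σ x) : q = restrictPerm σ S := by
  ext x
  rw [restrictPerm_apply h]
  split_ifs with hx
  · exact hS x hx
  · exact mem_permsOn.mp hq x hx

open Classical in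
/-- The sign of the restriction of `σ` to `S`, and `0` if `S` is not invariant. -/
def restrictSign (σ : Equiv.Perm X) (S : Finset X) : ℂ :=
  if IsInvariant σ S then signC X (restrictPerm σ S) else 0

/-- A factorization `σ = p q`, with `p` fixing `S` pointwise and `q` fixing its complement
pointwise, exists only if `σ` preserves `S`. It is then unique, with `q` the restriction of `σ` to
`S`. -/
theorem coeff_symmetrizer_mul_antisymmetrizer (σ : Equiv.Perm X) (S : Finset X) :
    (symmetrizer Sᶜ * antisymmetrizer S).coeff σ = restrictSign σ S := by
  classical
  have key : ∀ p ∈ permsOn Sᶜ, ∀ q ∈ permsOn S, p * q = σ →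
      IsInvariant σ S ∧ ∀ x ∈ S, q x = σ x := by
    intro p hp q hq h
    have h1 : ∀ x ∈ S, q x = σ x := by
      intro x hx
      rw [← h, Equiv.Perm.mul_apply, mem_permsOn.mp hp]
      simpa using (apply_mem_iff_of_mem_permsOn hq x).mpr hx
    refine ⟨isInvariant_of_forall_mem fun x hx => ?_, h1⟩
    rw [← h1 x hx]
    exact (apply_mem_iff_of_mem_permsOn hq x).mpr hx
  have h1 : (symmetrizer Sᶜ * antisymmetrizer S).coeff σ =
      ∑ p ∈ permsOn Sᶜ, ∑ q ∈ permsOn S, if p * q = σ then signC X q else 0 := by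
    simp only [symmetrizer, antisymmetrizer, permSum, sum_mul, mul_sum,
      MonoidAlgebra.single_mul_single, MonoidHom.one_apply, one_mul]
    simp only [MonoidAlgebra.coeff_sum, Finsupp.coe_finsetSum, Finset.sum_apply,
      MonoidAlgebra.coeff_single, Finsupp.single_apply]
    exact sum_comm
  rw [h1, restrictSign]
  split_ifs with hinv
  · have hr : restrictPerm σ S ∈ permsOn S := by
      rw [mem_permsOn]
      intro x hx
      rw [restrictPerm_apply hinv, if_neg hx]
    have hp : σ * (restrictPerm σ S)⁻¹ ∈ permsOn Sᶜ := by
      rw [mem_permsOn]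
      intro x hx
      rw [mem_compl, not_not] at hx
      have h2 : (restrictPerm σ S)⁻¹ x ∈ S :=
        (apply_mem_iff_of_mem_permsOn (inv_mem_permsOn hr) x).mpr hx
      have h3 := restrictPerm_apply hinv ((restrictPerm σ S)⁻¹ x)
      rw [if_pos h2, show restrictPerm σ S ((restrictPerm σ S)⁻¹ x) = x from
        (restrictPerm σ S).apply_symm_apply x] at h3
      rw [Equiv.Perm.mul_apply, ← h3]
    rw [sum_eq_single_of_mem _ hp, sum_eq_single_of_mem _ hr, if_pos (by simp)]
    · intro q _ hne
      rw [if_neg]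
      intro h
      apply hne
      rw [mul_assoc, mul_eq_left, inv_mul_eq_one] at h
      exact h.symm
    · intro p hp' hne
      refine sum_eq_zero fun q hq => ?_
      rw [if_neg]
      intro h
      apply hne
      rw [← eq_restrictPerm hinv hq (key p hp' q hq h).2, ← h, mul_inv_cancel_right]
  · refine sum_eq_zero fun p hp => sum_eq_zero fun q hq => ?_
    rw [if_neg]
    exact fun h => hinv (key p hp q hq h).1

theorem isInvariant_inter {σ : Equiv.Perm X} {S A : Finset X} (hS : IsInvariant σ S)
    (hA : IsInvariant σ A) : IsInvariant σ (S ∩ A) := by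
  intro x
  rw [mem_inter, mem_inter, hS x, hA x]

theorem isInvariant_union {σ : Equiv.Perm X} {S A : Finset X} (hS : IsInvariant σ S)
    (hA : IsInvariant σ A) : IsInvariant σ (S ∪ A) := by
  intro x
  rw [mem_union, mem_union, hS x, hA x]

theorem restrictSign_union {σ : Equiv.Perm X} {A B : Finset X} (hA : IsInvariant σ A)
    (hB : IsInvariant σ B) (hAB : Disjoint A B) {S S' : Finset X} (hS : S ⊆ A) (hS' : S' ⊆ B) :
    restrictSign σ (S ∪ S') = restrictSign σ S * restrictSign σ S' := by
  have hd : Disjoint S S' := hAB.mono hS hS'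
  by_cases h : IsInvariant σ (S ∪ S')
  · have h1 : IsInvariant σ S := by
      have := isInvariant_inter h hA
      rwa [union_inter_distrib_right, inter_eq_left.mpr hS,
        (disjoint_iff_inter_eq_empty.mp (hAB.symm.mono_left hS')), union_empty] at this
    have h2 : IsInvariant σ S' := by
      have := isInvariant_inter h hB
      rwa [union_inter_distrib_right, inter_eq_left.mpr hS',
        (disjoint_iff_inter_eq_empty.mp (hAB.mono_left hS)), empty_union] at this
    rw [restrictSign, restrictSign, restrictSign, if_pos h, if_pos h1, if_pos h2, ← map_mul]
    congr 1
    ext x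
    rw [Equiv.Perm.mul_apply, restrictPerm_apply h, restrictPerm_apply h1, restrictPerm_apply h2]
    by_cases hx : x ∈ S
    · have hx' : x ∉ S' := disjoint_left.mp hd hx
      simp [hx, hx']
    · by_cases hx' : x ∈ S'
      · have h3 : σ x ∉ S := disjoint_right.mp hd ((h2 x).mpr hx')
        simp [hx', h3]
      · simp [hx, hx']
  · rw [restrictSign, if_neg h]
    by_cases h1 : IsInvariant σ S
    · have h2 : ¬IsInvariant σ S' := fun h2 => h (isInvariant_union h1 h2)
      rw [restrictSign.eq_1 σ S', if_neg h2, mul_zero]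
    · rw [restrictSign, if_neg h1, zero_mul]

/-- The sum `∑ sign (σ|S) X^{|A ∖ S|} (-Y)^{|S|}` over the invariant subsets `S` of `A`. -/
def invariantPoly (σ : Equiv.Perm X) (A : Finset X) : BiPoly :=
  ∑ S ∈ A.powerset, MvPolynomial.C (restrictSign σ S) *
    (MvPolynomial.X 0 ^ (A.card - S.card) * (-MvPolynomial.X 1) ^ S.card)

/-- An invariant subset of `A ∪ B` is one of `A` together with one of `B`, and signs and
cardinalities are compatible with this. The computation is thereby reduced to single cycles and
fixed points. -/
theorem invariantPoly_union {σ : Equiv.Perm X} {A B : Finset X} (hA : IsInvariant σ A)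
    (hB : IsInvariant σ B) (hAB : Disjoint A B) :
    invariantPoly σ (A ∪ B) = invariantPoly σ A * invariantPoly σ B := by
  rw [invariantPoly, invariantPoly, invariantPoly, sum_mul_sum, ← sum_product']
  refine sum_bij' (fun S _ => (S ∩ A, S ∩ B)) (fun p _ => p.1 ∪ p.2) ?_ ?_ ?_ ?_ ?_
  · intro S _
    simp
  · rintro ⟨S, S'⟩ h
    rw [mem_product, mem_powerset, mem_powerset] at h
    exact mem_powerset.mpr (union_subset_union h.1 h.2)
  · intro S hS
    rw [← inter_union_distrib_left, inter_eq_left.mpr (mem_powerset.mp hS)]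
  · rintro ⟨S, S'⟩ h
    rw [mem_product, mem_powerset, mem_powerset] at h
    have h1 : S' ∩ A = ∅ := disjoint_iff_inter_eq_empty.mp (hAB.symm.mono_left h.2)
    have h2 : S ∩ B = ∅ := disjoint_iff_inter_eq_empty.mp (hAB.mono_left h.1)
    simp only [union_inter_distrib_right, h1, h2, inter_eq_left.mpr h.1, inter_eq_left.mpr h.2,
      union_empty, empty_union]
  · intro S hS
    have hS' : S = S ∩ A ∪ S ∩ B := by
      rw [← inter_union_distrib_left, inter_eq_left.mpr (mem_powerset.mp hS)]
    have hd : Disjoint (S ∩ A) (S ∩ B) := hAB.mono inter_subset_right inter_subset_right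
    have h1 : S.card = (S ∩ A).card + (S ∩ B).card := by
      conv_lhs => rw [hS', card_union_of_disjoint hd]
    have h2 : restrictSign σ S = restrictSign σ (S ∩ A) * restrictSign σ (S ∩ B) := by
      conv_lhs => rw [hS']
      exact restrictSign_union hA hB hAB inter_subset_right inter_subset_right
    have h3 : (S ∩ A).card ≤ A.card := card_le_card inter_subset_right
    have h4 : (S ∩ B).card ≤ B.card := card_le_card inter_subset_right
    rw [h2, h1, card_union_of_disjoint hAB, map_mul, pow_add,
      show A.card + B.card - ((S ∩ A).card + (S ∩ B).card) =
        (A.card - (S ∩ A).card) + (B.card - (S ∩ B).card) by omega, pow_add]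
    ring

theorem restrictSign_empty (σ : Equiv.Perm X) : restrictSign σ ∅ = 1 := by
  have h : IsInvariant σ (∅ : Finset X) := fun x => by simp
  rw [restrictSign, if_pos h]
  have : restrictPerm σ ∅ = 1 := by
    ext x
    rw [restrictPerm_apply h]
    simp
  rw [this, map_one]

theorem invariantPoly_empty (σ : Equiv.Perm X) : invariantPoly σ ∅ = 1 := by
  simp [invariantPoly, restrictSign_empty]

theorem isInvariant_biUnion {ι : Type*} {σ : Equiv.Perm X} (s : Finset ι)
    (A : ι → Finset X) (hA : ∀ i ∈ s, IsInvariant σ (A i)) : IsInvariant σ (s.biUnion A) := by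
  intro x
  simp only [mem_biUnion]
  exact ⟨fun ⟨i, hi, h⟩ => ⟨i, hi, (hA i hi x).mp h⟩, fun ⟨i, hi, h⟩ => ⟨i, hi, (hA i hi x).mpr h⟩⟩

theorem invariantPoly_biUnion {ι : Type*} [DecidableEq ι] {σ : Equiv.Perm X} (s : Finset ι)
    (A : ι → Finset X) (hA : ∀ i ∈ s, IsInvariant σ (A i))
    (hd : ∀ i ∈ s, ∀ j ∈ s, i ≠ j → Disjoint (A i) (A j)) :
    invariantPoly σ (s.biUnion A) = ∏ i ∈ s, invariantPoly σ (A i) := by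
  induction s using Finset.induction_on with
  | empty => simp [invariantPoly_empty]
  | insert i s hi ih =>
    rw [biUnion_insert, invariantPoly_union (hA i (mem_insert_self _ _)), prod_insert hi, ih]
    · exact fun j hj => hA j (mem_insert_of_mem hj)
    · exact fun j hj k hk => hd j (mem_insert_of_mem hj) k (mem_insert_of_mem hk)
    · exact isInvariant_biUnion _ _ fun j hj => hA j (mem_insert_of_mem hj)
    · rw [disjoint_biUnion_right]
      exact fun j hj => hd i (mem_insert_self _ _) j (mem_insert_of_mem hj)
        (by rintro rfl; exact hi hj)

/-- The contribution of a block on which `σ` acts transitively by a cycle. -/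
theorem invariantPoly_of_cycle {σ c : Equiv.Perm X} {A : Finset X} (hne : A.Nonempty)
    (hA : IsInvariant σ A) (htrans : ∀ S ⊆ A, IsInvariant σ S → S = ∅ ∨ S = A)
    (hc : restrictPerm σ A = c) (hsign : signC X c = -(-1) ^ A.card) :
    invariantPoly σ A = MvPolynomial.X 0 ^ A.card - MvPolynomial.X 1 ^ A.card := by
  rw [invariantPoly, sum_eq_add_of_mem ∅ A (empty_mem_powerset _) (mem_powerset_self _)
    hne.ne_empty.symm]
  -- With `n = |A|`, the full block contributes `-(-1)^n (-Y)^n = -Y^n`.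
  · rw [restrictSign_empty, restrictSign, if_pos hA, hc, hsign]
    simp only [card_empty, Nat.sub_zero, Nat.sub_self, pow_zero, map_one, one_mul, mul_one, map_neg,
      map_pow, neg_mul, ← mul_pow, neg_neg]
    ring
  · intro S hS hS'
    rw [restrictSign, if_neg, map_zero, zero_mul]
    intro h
    rcases htrans S (mem_powerset.mp hS) h with h | h
    · exact hS'.1 h
    · exact hS'.2 h

theorem invariantPoly_cycleFactor {σ c : Equiv.Perm X} (hc : c ∈ σ.cycleFactorsFinset) :
    invariantPoly σ c.support =
      MvPolynomial.X 0 ^ c.support.card - MvPolynomial.X 1 ^ c.support.card := by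
  obtain ⟨hcyc, hcσ⟩ := Equiv.Perm.mem_cycleFactorsFinset_iff.mp hc
  have hinv : IsInvariant σ c.support := isInvariant_of_forall_mem fun x hx => by
    rw [← hcσ x hx]
    exact Equiv.Perm.apply_mem_support.mpr hx
  refine invariantPoly_of_cycle hcyc.nonempty_support hinv ?_ (c := c) ?_ ?_
  · intro S hS hSinv
    rcases S.eq_empty_or_nonempty with h | ⟨x, hx⟩
    · exact Or.inl h
    · refine Or.inr (Subset.antisymm hS fun y hy => ?_)
      obtain ⟨n, hn⟩ := hcyc.exists_pow_eq (Equiv.Perm.mem_support.mp (hS hx))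
        (Equiv.Perm.mem_support.mp hy)
      have : ∀ n : ℕ, (c ^ n) x ∈ S := by
        intro n
        induction n with
        | zero => simpa using hx
        | succ n ih =>
          rw [pow_succ', Equiv.Perm.mul_apply, hcσ _ (hS ih)]
          exact (hSinv _).mpr ih
      rw [← hn]
      exact this n
  · ext x
    rw [restrictPerm_apply hinv]
    split_ifs with hx
    · exact (hcσ x hx).symm
    · exact (Equiv.Perm.notMem_support.mp hx).symm
  · rw [signC_apply, hcyc.sign]
    push_cast
    rfl

theorem invariantPoly_fixed {σ : Equiv.Perm X} {x : X} (hx : σ x = x) :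
    invariantPoly σ {x} = MvPolynomial.X 0 - MvPolynomial.X 1 := by
  have hinv : IsInvariant σ {x} := isInvariant_of_forall_mem fun y hy => by
    rw [mem_singleton] at hy
    rw [hy, hx, mem_singleton]
  have h := invariantPoly_of_cycle (singleton_nonempty x) hinv
    (fun S hS _ => subset_singleton_iff.mp hS) (c := 1) (by
      ext y
      rw [restrictPerm_apply hinv]
      by_cases h : y = x
      · rw [h, hx]; simp
      · simp [h]) (by simp)
  simpa using h

theorem invariantPoly_univ (σ : Equiv.Perm X) :
    invariantPoly σ univ =
      (σ.partition.parts.map fun p => MvPolynomial.X 0 ^ p - MvPolynomial.X 1 ^ p : Multiset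
        BiPoly).prod := by
  have hsupp : σ.support = σ.cycleFactorsFinset.biUnion Equiv.Perm.support := by
    ext x
    rw [mem_biUnion]
    constructor
    · intro hx
      exact ⟨σ.cycleOf x, Equiv.Perm.cycleOf_mem_cycleFactorsFinset_iff.mpr hx,
        Equiv.Perm.mem_support_cycleOf_iff.mpr ⟨Equiv.Perm.SameCycle.refl _ _, hx⟩⟩
    · rintro ⟨c, hc, hx⟩
      exact Equiv.Perm.mem_cycleFactorsFinset_support_le hc hx
  have hcinv : ∀ c ∈ σ.cycleFactorsFinset, IsInvariant σ c.support := fun c hc =>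
    isInvariant_of_forall_mem fun x hx => by
      rw [← (Equiv.Perm.mem_cycleFactorsFinset_iff.mp hc).2 x hx]
      exact Equiv.Perm.apply_mem_support.mpr hx
  have hfix : ∀ x ∈ σ.supportᶜ, σ x = x := fun x hx =>
    Equiv.Perm.notMem_support.mp (mem_compl.mp hx)
  have hfinv : ∀ x ∈ σ.supportᶜ, IsInvariant σ {x} := fun x hx =>
    isInvariant_of_forall_mem fun y hy => by
      rw [mem_singleton] at hy
      rw [hy, hfix x hx, mem_singleton]
  have h1 : invariantPoly σ σ.support = (σ.cycleType.map fun p =>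
      MvPolynomial.X 0 ^ p - MvPolynomial.X 1 ^ p : Multiset BiPoly).prod := by
    conv_lhs => rw [hsupp]
    rw [invariantPoly_biUnion _ _ hcinv, Equiv.Perm.cycleType_def, Multiset.map_map]
    · exact prod_congr rfl fun c hc => invariantPoly_cycleFactor hc
    · intro c hc c' hc' hne
      exact Equiv.Perm.disjoint_iff_disjoint_support.mp
        (Equiv.Perm.cycleFactorsFinset_pairwise_disjoint σ hc hc' hne)
  have h2 : invariantPoly σ σ.supportᶜ =
      (MvPolynomial.X 0 - MvPolynomial.X 1) ^ (Fintype.card X - σ.support.card) := by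
    have : σ.supportᶜ = σ.supportᶜ.biUnion singleton := by
      rw [biUnion_singleton_eq_self]
    conv_lhs => rw [this]
    rw [invariantPoly_biUnion _ _ hfinv,
      prod_congr rfl fun x hx => invariantPoly_fixed (hfix x hx), prod_const, card_compl]
    intro x _ y _ hxy
    simpa using hxy
  rw [← union_compl σ.support, invariantPoly_union _ _ disjoint_compl_right, h1, h2,
    Equiv.Perm.parts_partition, Multiset.map_add, Multiset.prod_add, Multiset.map_replicate,
    Multiset.prod_replicate, pow_one, pow_one]
  · rw [hsupp]
    exact isInvariant_biUnion _ _ hcinv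
  · intro x
    rw [mem_compl, mem_compl, Equiv.Perm.apply_mem_support]

end Invariant

end CompletedHurwitz

end

/-! ### The generating polynomial of the hook characters, and the sum of the long cycles. -/

noncomputable section

namespace CompletedHurwitz

open Finset

set_option linter.unusedSectionVars false

/-! ### Characters of hooks -/

section HookCharacter

variable {X : Type*} [Fintype X] [DecidableEq X]

/-- Multiplying the generating polynomial of `h` by `x - y` forms the sums `h (k + 1) + h k`. Only
the top boundary term `h d` remains separate; for hook sums it vanishes. -/
theorem sub_mul_sum_of_succ_add {R : Type*} [CommRing R] (x y c : R) (h s : ℕ → R)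
    (h0 : h 0 = c * s 0) (hs : ∀ k, h (k + 1) + h k = c * s (k + 1)) (d : ℕ) :
    (x - y) * ∑ k ∈ range d, h k * (x ^ (d - 1 - k) * (-y) ^ k) + h d * (-y) ^ d =
      c * ∑ k ∈ range (d + 1), s k * (x ^ (d - k) * (-y) ^ k) := by
  induction d with
  | zero => simp [h0]
  | succ d ih =>
    have e1 : ∑ k ∈ range (d + 1), h k * (x ^ (d + 1 - 1 - k) * (-y) ^ k) =
        x * ∑ k ∈ range d, h k * (x ^ (d - 1 - k) * (-y) ^ k) + h d * (-y) ^ d := by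
      rw [sum_range_succ, mul_sum]
      refine congrArg₂ _ (sum_congr rfl fun k hk => ?_) (by simp)
      rw [mem_range] at hk
      rw [show d + 1 - 1 - k = (d - 1 - k) + 1 by omega]
      ring
    have e2 : ∑ k ∈ range (d + 1 + 1), s k * (x ^ (d + 1 - k) * (-y) ^ k) =
        x * ∑ k ∈ range (d + 1), s k * (x ^ (d - k) * (-y) ^ k) + s (d + 1) * (-y) ^ (d + 1) := by
      rw [sum_range_succ, mul_sum]
      refine congrArg₂ _ (sum_congr rfl fun k hk => ?_) (by simp)
      rw [mem_range] at hk
      rw [show d + 1 - k = (d - k) + 1 by omega]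
      ring
    rw [e1, e2]
    linear_combination x * ih + (-y) ^ (d + 1) * hs d

/-- The generating polynomial of the values at `σ` of the class functions `hookSum X k`. -/
def hookPoly (σ : Equiv.Perm X) : BiPoly :=
  ∑ k ∈ range (Fintype.card X), MvPolynomial.C ((hookSum X k).coeff σ) *
    (MvPolynomial.X 0 ^ (Fintype.card X - 1 - k) * (-MvPolynomial.X 1) ^ k)

theorem sum_splitSum_eq_invariantPoly (σ : Equiv.Perm X) :
    ∑ k ∈ range (Fintype.card X + 1), MvPolynomial.C ((splitSum X k).coeff σ) *
      (MvPolynomial.X 0 ^ (Fintype.card X - k) * (-MvPolynomial.X 1) ^ k) =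
      invariantPoly σ univ := by
  rw [invariantPoly, sum_powerset, card_univ]
  refine sum_congr rfl fun k _ => ?_
  rw [splitSum, MonoidAlgebra.coeff_sum, Finsupp.coe_finsetSum, Finset.sum_apply, map_sum, sum_mul]
  refine sum_congr rfl fun S hS => ?_
  rw [coeff_symmetrizer_mul_antisymmetrizer, mem_powersetCard_univ.mp hS]

/-- The Pieri rule makes `X - Y` times the hook polynomial equal to `|X|` times the signed
generating function of invariant subsets, which is a product over the cycles. -/
theorem sub_mul_hookPoly (σ : Equiv.Perm X) :
    (MvPolynomial.X 0 - MvPolynomial.X 1) * hookPoly σ = (Fintype.card X : BiPoly) *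
      (σ.partition.parts.map fun p => MvPolynomial.X 0 ^ p - MvPolynomial.X 1 ^ p : Multiset
        BiPoly).prod := by
  have h := sub_mul_sum_of_succ_add (MvPolynomial.X 0 : BiPoly) (MvPolynomial.X 1)
    (Fintype.card X : BiPoly) (fun k => MvPolynomial.C ((hookSum X k).coeff σ))
    (fun k => MvPolynomial.C ((splitSum X k).coeff σ))
    (by rw [hookSum_zero, MonoidAlgebra.coeff_smul, Finsupp.smul_apply, nsmul_eq_mul, map_mul,
      map_natCast]) (fun k => by
      rw [← map_add, ← Finsupp.add_apply, ← MonoidAlgebra.coeff_add, hookSum_succ_add,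
        MonoidAlgebra.coeff_smul, Finsupp.smul_apply, nsmul_eq_mul, map_mul, map_natCast])
    (Fintype.card X)
  rw [sum_splitSum_eq_invariantPoly, hookSum_card, invariantPoly_univ] at h
  simpa [hookPoly] using h

theorem biFunctional_hookPoly (σ : Equiv.Perm X) (f : ℕ → ℕ → ℂ) :
    biFunctional f (hookPoly σ) = ∑ k ∈ range (Fintype.card X),
      (-1) ^ k * (hookSum X k).coeff σ * f (Fintype.card X - 1 - k) k := by
  rw [hookPoly, map_sum]
  refine sum_congr rfl fun k _ => ?_
  have : MvPolynomial.C ((hookSum X k).coeff σ) *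
      (MvPolynomial.X 0 ^ (Fintype.card X - 1 - k) * (-MvPolynomial.X 1) ^ k) =
      ((-1) ^ k * (hookSum X k).coeff σ) •
        (MvPolynomial.X 0 ^ (Fintype.card X - 1 - k) * MvPolynomial.X 1 ^ k : BiPoly) := by
    rw [MvPolynomial.smul_eq_C_mul, neg_pow]
    simp only [map_mul, map_pow, map_neg, map_one]
    ring
  rw [this, map_smul, biFunctional_X_pow, smul_eq_mul]

/-- The trace formula for quasi-idempotents averages the hook element over conjugation. The
factorials in this average cancel against those in the quasi-idempotent constant. -/
theorem trace_hookElement {S : Finset X} {x : X} (hx : x ∉ S) (σ : Equiv.Perm X) :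
    LinearMap.trace ℂ (Ideal.span {hookElement S x})
      (Algebra.lsmul ℂ ℂ (Ideal.span {hookElement S x}) (MonoidAlgebra.single σ (1 : ℂ))) =
      (Fintype.card X : ℂ)⁻¹ * (hookSum X S.card).coeff σ⁻¹ := by
  have hX : (Fintype.card X : ℂ) ≠ 0 :=
    Nat.cast_ne_zero.mpr (haveI : Nonempty X := ⟨x⟩; Fintype.card_ne_zero)
  set f := S.card.factorial * (Sᶜ.erase x).card.factorial with hf
  have hf0 : (f : ℂ) ≠ 0 :=
    Nat.cast_ne_zero.mpr (mul_ne_zero (Nat.factorial_ne_zero _) (Nat.factorial_ne_zero _))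
  have h1 := hookElement_mul_self hx
  rw [← hf, ← Nat.cast_smul_eq_nsmul ℂ] at h1
  have h2 := congrArg (fun z => z.coeff σ⁻¹) (sum_conj_hookElement hx)
  simp only [MonoidAlgebra.coeff_sum, Finsupp.coe_finsetSum, Finset.sum_apply,
    MonoidAlgebra.coeff_mul_single_apply, MonoidAlgebra.coeff_single_mul_apply, inv_inv, one_mul,
    mul_one, ← hf, MonoidAlgebra.coeff_smul, Finsupp.smul_apply] at h2
  rw [trace_span_singleton (by push_cast; exact mul_ne_zero hX hf0) h1]
  simp only [mul_assoc] at h2 ⊢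
  rw [h2, nsmul_eq_mul]
  push_cast
  field_simp

/-! ### The sum of all long cycles -/

/-- The alternating sum is the value of the hook polynomial at `X = Y = 1`. With two or more cycles,
a factor `X^q - Y^q` survives the division by `X - Y` and vanishes there; a single long cycle leaves
`|X|` times a sum of `|X|` monomials. -/
theorem sum_neg_one_pow_hookSum_coeff [Nonempty X] (σ : Equiv.Perm X) :
    (∑ k ∈ range (Fintype.card X), (-1 : ℂ) ^ k • hookSum X k).coeff σ =
      if σ.partition.parts = {Fintype.card X} then (Fintype.card X : ℂ) ^ 2 else 0 := by
  have h0 : (∑ k ∈ range (Fintype.card X), (-1 : ℂ) ^ k • hookSum X k).coeff σ =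
      MvPolynomial.eval (fun _ => 1) (hookPoly σ) := by
    rw [MonoidAlgebra.coeff_sum, Finsupp.coe_finsetSum, Finset.sum_apply, hookPoly, map_sum]
    refine sum_congr rfl fun k _ => ?_
    simp [mul_comm]
  have hdvd : ∀ p : ℕ, (MvPolynomial.X 0 - MvPolynomial.X 1 : BiPoly) ∣
    MvPolynomial.X 0 ^ p - MvPolynomial.X 1 ^ p := fun p => sub_dvd_pow_sub_pow _ _ p
  have h1 := sub_mul_hookPoly σ
  rw [h0]
  have hsum := σ.partition.parts_sum
  split_ifs with h
  · rw [h, Multiset.map_singleton, Multiset.prod_singleton] at h1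
    obtain ⟨n, hn⟩ : ∃ n, Fintype.card X = n + 1 :=
      Nat.exists_eq_succ_of_ne_zero Fintype.card_ne_zero
    have h2 : hookPoly σ = (Fintype.card X : BiPoly) *
        ∑ i ∈ range (n + 1), MvPolynomial.X 0 ^ i * MvPolynomial.X 1 ^ (n - i) := by
      apply mul_left_cancel₀ X_sub_X_ne_zero
      rw [h1, hn, ← (Commute.all _ _).mul_geom_sum₂]
      simp only [Nat.add_sub_cancel]
      ring
    rw [h2]
    simp [hn, pow_two]
  · obtain ⟨p, hp⟩ : ∃ p, p ∈ σ.partition.parts := by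
      by_contra hne
      rw [Multiset.eq_zero_of_forall_notMem (not_exists.mp hne), Multiset.sum_zero] at hsum
      exact Fintype.card_ne_zero hsum.symm
    obtain ⟨t, ht⟩ := Multiset.exists_cons_of_mem hp
    obtain ⟨q, hq⟩ : ∃ q, q ∈ t := by
      by_contra hne
      rw [Multiset.eq_zero_of_forall_notMem (not_exists.mp hne)] at ht
      rw [ht, Multiset.cons_zero, Multiset.sum_singleton] at hsum
      rw [ht, hsum] at h
      exact h rfl
    obtain ⟨t', rfl⟩ := Multiset.exists_cons_of_mem hq
    rw [ht, Multiset.map_cons, Multiset.prod_cons, Multiset.map_cons, Multiset.prod_cons] at h1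
    obtain ⟨u, hu⟩ := hdvd p
    have h2 : hookPoly σ = (Fintype.card X : BiPoly) * (u *
        ((MvPolynomial.X 0 ^ q - MvPolynomial.X 1 ^ q) *
        (t'.map fun p => MvPolynomial.X 0 ^ p - MvPolynomial.X 1 ^ p : Multiset BiPoly).prod)) := by
      apply mul_left_cancel₀ X_sub_X_ne_zero
      rw [h1, hu]
      ring
    rw [h2]
    simp

/-- If all Young symmetrizers of hooks annihilate `c` from the left, then long cycles have trace
zero on the left ideal generated by `c`. -/
theorem trace_eq_zero_of_hookElement_mul [Nonempty X] {c : MonoidAlgebra ℂ (Equiv.Perm X)}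
    (hc : ∀ (S : Finset X) (x : X), x ∉ S → ∀ g : Equiv.Perm X,
      hookElement S x * (MonoidAlgebra.single g 1 * c) = 0)
    {σ : Equiv.Perm X} (hσ : σ.partition.parts = {Fintype.card X}) :
    LinearMap.trace ℂ (Ideal.span {c})
      (Algebra.lsmul ℂ ℂ (Ideal.span {c}) (MonoidAlgebra.single σ (1 : ℂ))) = 0 := by
  classical
  set ρ := Algebra.lsmul ℂ ℂ (Ideal.span {c}) (A := MonoidAlgebra ℂ (Equiv.Perm X)) with hρ
  set Z : MonoidAlgebra ℂ (Equiv.Perm X) :=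
    ∑ k ∈ range (Fintype.card X), (-1 : ℂ) ^ k • hookSum X k with hZ
  have hZc : ∀ y, Z * (y * c) = 0 := by
    intro y
    induction y using MonoidAlgebra.induction_on with
    | of g =>
      rw [hZ, sum_mul]
      refine sum_eq_zero fun k _ => ?_
      rw [smul_mul_assoc, hookSum, sum_mul]
      rw [sum_eq_zero, smul_zero]
      intro S _
      rw [sum_mul]
      exact sum_eq_zero fun x hx => hc S x (mem_compl.mp hx) g
    | add a b ha hb => rw [add_mul, mul_add, ha, hb, add_zero]
    | smul r a ha => rw [smul_mul_assoc, mul_smul_comm, ha, smul_zero]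
  have hρZ : ρ Z = 0 := by
    refine LinearMap.ext ?_
    rintro ⟨v, hv⟩
    obtain ⟨y, rfl⟩ := Ideal.mem_span_singleton'.mp hv
    exact Subtype.ext (hZc y)
  have hZsum : Z = ∑ τ : Equiv.Perm X, Z.coeff τ • MonoidAlgebra.single τ (1 : ℂ) := by
    ext τ
    simp [MonoidAlgebra.coeff_sum]
  have hconj : ∀ τ : Equiv.Perm X, τ.partition.parts = {Fintype.card X} →
      LinearMap.trace ℂ _ (ρ (MonoidAlgebra.single τ 1)) =
      LinearMap.trace ℂ _ (ρ (MonoidAlgebra.single σ 1)) := by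
    intro τ hτ
    have h1 : IsConj σ τ := by
      rw [Equiv.Perm.partition_eq_of_isConj]
      ext1
      rw [hσ, hτ]
    obtain ⟨g, hg⟩ := isConj_iff.mp h1
    have h2 : MonoidAlgebra.single τ (1 : ℂ) =
        MonoidAlgebra.single g 1 * (MonoidAlgebra.single σ 1 * MonoidAlgebra.single g⁻¹ 1) := by
      rw [← hg]
      simp [MonoidAlgebra.single_mul_single, mul_assoc]
    have h3 : MonoidAlgebra.single σ (1 : ℂ) =
        (MonoidAlgebra.single σ 1 * MonoidAlgebra.single g⁻¹ 1) * MonoidAlgebra.single g 1 := by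
      simp [MonoidAlgebra.single_mul_single, mul_assoc]
    rw [h2, map_mul, LinearMap.trace_mul_comm, ← map_mul, ← h3]
  -- `Z` is a nonzero multiple of the sum of all long cycles. These are conjugate and have equal
  -- traces, so the vanishing of the trace of `Z` forces each of them to be zero.
  have h1 : LinearMap.trace ℂ _ (ρ Z) = 0 := by rw [hρZ, map_zero]
  rw [hZsum, map_sum, map_sum] at h1
  simp only [map_smul, smul_eq_mul, hZ, sum_neg_one_pow_hookSum_coeff, ite_mul, zero_mul] at h1
  rw [← sum_filter, sum_congr rfl (fun τ hτ => by rw [hconj τ (mem_filter.mp hτ).2]), sum_const,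
    nsmul_eq_mul] at h1
  rcases mul_eq_zero.mp h1 with h | h
  · rw [Nat.cast_eq_zero, card_eq_zero] at h
    exact absurd (h ▸ mem_filter.mpr ⟨mem_univ σ, hσ⟩ : σ ∈ (∅ : Finset _)) (notMem_empty _)
  · refine (mul_eq_zero.mp h).resolve_left (pow_ne_zero _ (Nat.cast_ne_zero.mpr ?_))
    exact Fintype.card_ne_zero

end HookCharacter

end CompletedHurwitz

end

/-! ### Specht modules of hooks, and the vanishing on long cycles for other shapes. -/

noncomputable section

namespace CompletedHurwitz

open Finset

/-! ### The Young symmetrizer of a hook -/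

section Young

variable (Y : YoungDiagram)

/-- The cells of the diagram that lie outside the first row. -/
def lowerCells : Finset (Cell Y) := univ.filter fun c => c.1.1 ≠ 0

variable {Y}

theorem mem_lowerCells {c : Cell Y} : c ∈ lowerCells Y ↔ c.1.1 ≠ 0 := by simp [lowerCells]

theorem cell_ext {c c' : Cell Y} (h1 : c.1.1 = c'.1.1) (h2 : c.1.2 = c'.1.2) : c = c' :=
  Subtype.ext (Prod.ext h1 h2)

theorem snd_eq_zero_of_hook (h : (1, 1) ∉ Y) {c : Cell Y} (hc : c.1.1 ≠ 0) : c.1.2 = 0 := by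
  by_contra hne
  exact h (Y.up_left_mem (Nat.one_le_iff_ne_zero.mpr hc) (Nat.one_le_iff_ne_zero.mpr hne) c.2)

/-- In a hook every row but the first and every column but the first has at most one cell, so
row-preserving permutations fix everything below the first row and column-preserving ones fix
everything outside the first column. -/
theorem youngSymmetrizer_of_hook (h : (1, 1) ∉ Y) (x : Cell Y) (hx : x.1 = (0, 0)) :
    youngSymmetrizer Y = hookElement (lowerCells Y) x := by
  have hx1 : x.1.1 = 0 := by rw [hx]
  have hx2 : x.1.2 = 0 := by rw [hx]
  have hcol : ∀ c : Cell Y, c ∈ insert x (lowerCells Y) ↔ c.1.2 = 0 := by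
    intro c
    rw [mem_insert, mem_lowerCells]
    constructor
    · rintro (rfl | hc)
      · exact hx2
      · exact snd_eq_zero_of_hook h hc
    · intro hc
      by_cases h0 : c.1.1 = 0
      · exact Or.inl (cell_ext (h0.trans hx1.symm) (hc.trans hx2.symm))
      · exact Or.inr h0
  have hrow : ∀ c : Cell Y, c ∈ (lowerCells Y)ᶜ ↔ c.1.1 = 0 := by
    intro c
    rw [mem_compl, mem_lowerCells, not_not]
  rw [youngSymmetrizer, hookElement, symmetrizer, antisymmetrizer, permSum, permSum]
  congr 1
  · refine sum_congr ?_ fun _ _ => rfl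
    ext σ
    rw [mem_filter, mem_permsOn]
    simp only [mem_univ, true_and]
    constructor
    · intro hσ c hc
      rw [hrow] at hc
      have h1 : (σ c).1.1 ≠ 0 := by rw [hσ c]; exact hc
      exact cell_ext (hσ c) (by rw [snd_eq_zero_of_hook h hc, snd_eq_zero_of_hook h h1])
    · intro hσ c
      by_cases hc : c.1.1 = 0
      · rw [hc]
        exact (hrow _).mp ((apply_mem_iff_of_mem_permsOn (mem_permsOn.mpr hσ) c).mpr
          ((hrow c).mpr hc))
      · rw [hσ c ((hrow c).not.mpr hc)]
  · refine sum_congr ?_ fun σ _ => by rw [signC_apply]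
    ext σ
    rw [mem_filter, mem_permsOn]
    simp only [mem_univ, true_and]
    constructor
    · intro hσ c hc
      rw [hcol] at hc
      have h1 : (σ c).1.2 ≠ 0 := by rw [hσ c]; exact hc
      refine cell_ext ?_ (hσ c)
      rw [not_not.mp (mt (snd_eq_zero_of_hook h) hc), not_not.mp (mt (snd_eq_zero_of_hook h) h1)]
    · intro hσ c
      by_cases hc : c.1.2 = 0
      · rw [hc]
        exact (hcol _).mp ((apply_mem_iff_of_mem_permsOn (mem_permsOn.mpr hσ) c).mpr
          ((hcol c).mpr hc))
      · rw [hσ c ((hcol c).not.mpr hc)]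

theorem card_lowerCells_of_hook (h : (1, 1) ∉ Y) : (lowerCells Y).card = Y.colLen 0 - 1 := by
  have : (lowerCells Y).card = (Ico 1 (Y.colLen 0)).card := by
    refine card_bij (fun c _ => c.1.1) ?_ ?_ ?_
    · intro c hc
      rw [mem_lowerCells] at hc
      rw [mem_Ico]
      refine ⟨Nat.one_le_iff_ne_zero.mpr hc, ?_⟩
      rw [← YoungDiagram.mem_iff_lt_colLen]
      exact Y.up_left_mem le_rfl (Nat.zero_le _) c.2
    · intro c hc c' hc' heq
      rw [mem_lowerCells] at hc hc'
      exact cell_ext heq (by rw [snd_eq_zero_of_hook h hc, snd_eq_zero_of_hook h hc'])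
    · intro i hi
      rw [mem_Ico, ← YoungDiagram.mem_iff_lt_colLen] at hi
      exact ⟨⟨(i, 0), hi.2⟩, mem_lowerCells.mpr (Nat.one_le_iff_ne_zero.mp hi.1), rfl⟩
  rw [this, Nat.card_Ico]

theorem spechtCharacter_of_hook (h : (1, 1) ∉ Y) (h0 : (0, 0) ∈ Y) (σ : Equiv.Perm (Cell Y)) :
    spechtCharacter Y σ = (Fintype.card (Cell Y) : ℂ)⁻¹ *
      (hookSum (Cell Y) (Y.colLen 0 - 1)).coeff σ⁻¹ := by
  change LinearMap.trace ℂ (Ideal.span {youngSymmetrizer Y})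
    (Algebra.lsmul ℂ ℂ (Ideal.span {youngSymmetrizer Y}) (MonoidAlgebra.single σ (1 : ℂ))) = _
  rw [youngSymmetrizer_of_hook h ⟨(0, 0), h0⟩ rfl, trace_hookElement,
    card_lowerCells_of_hook h]
  rw [mem_lowerCells, not_not]

/-! ### Vanishing of characters outside hooks -/

/-- A transposition absorbed with sign `ε` on one side and, after conjugation by `g`, with sign `-ε`
on the other side makes the product equal to its own negative. -/
theorem permSum_mul_single_mul_eq_zero {X : Type*} [Fintype X] [DecidableEq X]
    (ε : Equiv.Perm X →* ℂ) {C : Finset X} {g : Equiv.Perm X} {x y : X} (hx : x ∈ C) (hy : y ∈ C)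
    {a : MonoidAlgebra ℂ (Equiv.Perm X)}
    (ha : MonoidAlgebra.single (Equiv.swap (g⁻¹ x) (g⁻¹ y)) (-ε (Equiv.swap x y)) * a = a) :
    permSum ε C * (MonoidAlgebra.single g 1 * a) = 0 := by
  apply eq_zero_of_eq_neg
  have h1 := permSum_mul_single ε (swap_mem_permsOn hx hy)
  have h2 : Equiv.swap x y * g = g * Equiv.swap (g⁻¹ x) (g⁻¹ y) := by
    rw [Equiv.mul_swap_eq_swap_mul, show g (g⁻¹ x) = x from g.apply_symm_apply x,
      show g (g⁻¹ y) = y from g.apply_symm_apply y]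
  have h3 : MonoidAlgebra.single (Equiv.swap x y) (ε (Equiv.swap x y)) * MonoidAlgebra.single g 1 =
      -(MonoidAlgebra.single g 1 *
        MonoidAlgebra.single (Equiv.swap (g⁻¹ x) (g⁻¹ y)) (-ε (Equiv.swap x y))) := by
    rw [MonoidAlgebra.single_mul_single, MonoidAlgebra.single_mul_single, h2, mul_one, one_mul,
      MonoidAlgebra.single_neg, neg_neg]
  calc permSum ε C * (MonoidAlgebra.single g 1 * a)
      = permSum ε C * (MonoidAlgebra.single (Equiv.swap x y) (ε (Equiv.swap x y)) *
          MonoidAlgebra.single g 1 * a) := by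
        conv_lhs => rw [← h1]
        simp only [mul_assoc]
    _ = -(permSum ε C * (MonoidAlgebra.single g 1 *
          (MonoidAlgebra.single (Equiv.swap (g⁻¹ x) (g⁻¹ y)) (-ε (Equiv.swap x y)) * a))) := by
        rw [h3, neg_mul, mul_neg, mul_assoc]
    _ = _ := by rw [ha]

theorem single_mul_sum_eq_self {Γ : Type*} [Group Γ] (s : Finset Γ) (ε : Γ →* ℂ)
    {τ : Γ} (h : ∀ σ, σ ∈ s ↔ τ * σ ∈ s) :
    MonoidAlgebra.single τ (ε τ) * ∑ σ ∈ s, MonoidAlgebra.single σ (ε σ) =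
      ∑ σ ∈ s, MonoidAlgebra.single σ (ε σ) := by
  rw [mul_sum]
  simp only [MonoidAlgebra.single_mul_single, ← map_mul]
  refine sum_bij' (fun σ _ => τ * σ) (fun σ _ => τ⁻¹ * σ) (fun σ hσ => (h σ).mp hσ) ?_ ?_ ?_ ?_
  · intro σ hσ
    rw [h, mul_inv_cancel_left]
    exact hσ
  · simp
  · simp
  · simp

theorem card_firstRow_add_card_firstColumn_le (h : (1, 1) ∈ Y) :
    (univ.filter fun c : Cell Y => c.1.1 = 0).card + (univ.filter fun c : Cell Y => c.1.2 = 0).card ≤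
      Fintype.card (Cell Y) := by
  set A := univ.filter fun c : Cell Y => c.1.1 = 0
  set B := univ.filter fun c : Cell Y => c.1.2 = 0
  have h1 := card_union_add_card_inter A B
  have h2 : (A ∩ B).card ≤ 1 := by
    rw [card_le_one]
    intro a ha b hb
    simp only [A, B, mem_inter, mem_filter, mem_univ, true_and] at ha hb
    exact cell_ext (by omega) (by omega)
  have h3 : (A ∪ B).card < Fintype.card (Cell Y) := by
    apply card_lt_univ_of_notMem (x := (⟨(1, 1), h⟩ : Cell Y))
    simp [A, B]
  omega

/-- Pigeonhole: the row and the column of the hook have `|Y| + 1` cells counted together, while the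
first row and first column of `Y` have at most `|Y|`, because the cell `(1, 1)` lies in neither. -/
theorem hookElement_mul_youngSymmetrizer (h : (1, 1) ∈ Y) {S : Finset (Cell Y)} {x : Cell Y}
    (hx : x ∉ S) (g : Equiv.Perm (Cell Y)) :
    hookElement S x * (MonoidAlgebra.single g 1 * youngSymmetrizer Y) = 0 := by
  classical
  have hle := card_firstRow_add_card_firstColumn_le h
  have hcard : Sᶜ.card + (insert x S).card = Fintype.card (Cell Y) + 1 := by
    rw [card_insert_of_notMem hx, ← card_add_card_compl S]
    ring
  rw [youngSymmetrizer, hookElement]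
  set a := ∑ σ : Equiv.Perm (Cell Y) with ∀ c, (σ c).1.1 = c.1.1, MonoidAlgebra.single σ (1 : ℂ)
    with ha
  set b := ∑ σ : Equiv.Perm (Cell Y) with ∀ c, (σ c).1.2 = c.1.2,
    MonoidAlgebra.single σ ((Equiv.Perm.sign σ : ℤ) : ℂ) with hb
  have hswap1 : ∀ {c c' : Cell Y}, c.1.1 = c'.1.1 → ∀ z, (Equiv.swap c c' z).1.1 = z.1.1 := by
    intro c c' hcc z
    rw [Equiv.swap_apply_def]
    split_ifs with h1 h2
    · rw [h1, hcc]
    · rw [h2, hcc]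
    · rfl
  have hswap2 : ∀ {c c' : Cell Y}, c.1.2 = c'.1.2 → ∀ z, (Equiv.swap c c' z).1.2 = z.1.2 := by
    intro c c' hcc z
    rw [Equiv.swap_apply_def]
    split_ifs with h1 h2
    · rw [h1, hcc]
    · rw [h2, hcc]
    · rfl
  -- The first column of `Y` has one cell for each row. If the column of the hook is longer, `g⁻¹`
  -- puts two of its cells into the same row of `Y`.
  by_cases hlt : (univ.filter fun c : Cell Y => c.1.2 = 0).card < (insert x S).card
  · obtain ⟨y, hy, z, hz, hyz, heq⟩ := exists_ne_map_eq_of_card_lt_of_maps_to hlt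
      (f := fun c => (⟨((g⁻¹ c).1.1, 0), Y.up_left_mem le_rfl (Nat.zero_le _) (g⁻¹ c).2⟩ : Cell Y))
      (by intro c _; simp)
    have heq' : (g⁻¹ y).1.1 = (g⁻¹ z).1.1 :=
      (Prod.ext_iff.mp (Subtype.ext_iff.mp heq)).1
    have h0 : antisymmetrizer (insert x S) * (MonoidAlgebra.single g 1 * a) = 0 := by
      refine permSum_mul_single_mul_eq_zero _ hy hz ?_
      rw [signC_swap hyz, neg_neg]
      refine single_mul_sum_eq_self _ (1 : Equiv.Perm (Cell Y) →* ℂ) fun σ => ?_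
      simp only [mem_filter, mem_univ, true_and, Equiv.Perm.mul_apply, hswap1 heq']
    calc _ = symmetrizer Sᶜ * (antisymmetrizer (insert x S) * (MonoidAlgebra.single g 1 * a)) * b := by
          simp only [mul_assoc]
      _ = 0 := by rw [h0, mul_zero, zero_mul]
  -- Otherwise the row of the hook is longer than the first row of `Y`, and two of its cells come
  -- from one column. Other factors stand between the symmetrizer and `b`, so the vanishing is shown
  -- for every element `w` in between.
  · have hlt' : (univ.filter fun c : Cell Y => c.1.1 = 0).card < Sᶜ.card := by omega
    have h0 : ∀ w : MonoidAlgebra ℂ (Equiv.Perm (Cell Y)), symmetrizer Sᶜ * (w * b) = 0 := by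
      intro w
      induction w using MonoidAlgebra.induction_on with
      | of g' =>
        obtain ⟨y, hy, z, hz, hyz, heq⟩ := exists_ne_map_eq_of_card_lt_of_maps_to hlt'
          (f := fun c => (⟨(0, (g'⁻¹ c).1.2), Y.up_left_mem (Nat.zero_le _) le_rfl (g'⁻¹ c).2⟩ :
            Cell Y)) (by intro c _; simp)
        have heq' : (g'⁻¹ y).1.2 = (g'⁻¹ z).1.2 :=
          (Prod.ext_iff.mp (Subtype.ext_iff.mp heq)).2
        have hne : g'⁻¹ y ≠ g'⁻¹ z := fun h => hyz (g'⁻¹.injective h)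
        refine permSum_mul_single_mul_eq_zero _ hy hz ?_
        rw [MonoidHom.one_apply, ← signC_swap hne]
        refine single_mul_sum_eq_self _ (signC (Cell Y)) fun σ => ?_
        simp only [mem_filter, mem_univ, true_and, Equiv.Perm.mul_apply, hswap2 heq']
      | add u v hu hv => rw [add_mul, mul_add, hu, hv, add_zero]
      | smul r u hu => rw [smul_mul_assoc, mul_smul_comm, hu, smul_zero]
    calc _ = symmetrizer Sᶜ * ((antisymmetrizer (insert x S) * MonoidAlgebra.single g 1 * a) * b) := by
          simp only [mul_assoc]
      _ = 0 := h0 _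

theorem spechtCharacter_eq_zero (h : (1, 1) ∈ Y) {σ : Equiv.Perm (Cell Y)}
    (hσ : σ.partition.parts = {Fintype.card (Cell Y)}) : spechtCharacter Y σ = 0 := by
  have : Nonempty (Cell Y) := ⟨⟨(1, 1), h⟩⟩
  exact trace_eq_zero_of_hookElement_mul
    (fun S x hx g => hookElement_mul_youngSymmetrizer h hx g) hσ

end Young

end CompletedHurwitz

end

/-! ### One-part double Hurwitz numbers as values of the hook content functional. -/

noncomputable section

namespace CompletedHurwitz

open Finset

/-! ### Diagrams of partitions -/

section Diagram

variable {d : ℕ}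

theorem rowLens_diagram (lam : Nat.Partition d) :
    (diagram lam).rowLens = lam.parts.sort (· ≥ ·) :=
  YoungDiagram.rowLens_ofRowLens_eq_self fun _ hx => lam.parts_pos ((Multiset.mem_sort _).mp hx)

theorem card_cell (Y : YoungDiagram) : Fintype.card (Cell Y) = Y.rowLens.sum := by
  have h1 : ∀ c ∈ Y.cells, c.1 ∈ range (Y.colLen 0) := by
    intro c hc
    rw [mem_range, ← YoungDiagram.mem_iff_lt_colLen]
    exact Y.up_left_mem le_rfl (Nat.zero_le c.2) hc
  rw [Fintype.card_coe, card_eq_sum_card_fiberwise h1, YoungDiagram.rowLens]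
  have h2 : ∀ i, (Y.cells.filter fun c => c.1 = i).card = Y.rowLen i := fun i =>
    Y.rowLen_eq_card.symm
  simp only [h2]
  rfl

theorem card_cell_diagram (lam : Nat.Partition d) : Fintype.card (Cell (diagram lam)) = d := by
  rw [card_cell, rowLens_diagram, ← Multiset.sum_coe, Multiset.sort_eq, lam.parts_sum]

theorem exists_perm_partition {X : Type*} [Fintype X] [DecidableEq X] {m : Multiset ℕ}
    (hm : m.sum = Fintype.card X) (hpos : ∀ a ∈ m, 0 < a) :
    ∃ σ : Equiv.Perm X, σ.partition.parts = m := by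
  have hsplit : m = m.filter (2 ≤ ·) + Multiset.replicate (m.filter (¬ 2 ≤ ·)).card 1 := by
    conv_lhs => rw [← Multiset.filter_add_not (2 ≤ ·) m]
    congr 1
    refine Multiset.eq_replicate_card.mpr fun b hb => ?_
    rw [Multiset.mem_filter] at hb
    have := hpos b hb.1
    omega
  have hsum := congrArg Multiset.sum hsplit
  rw [Multiset.sum_add, Multiset.sum_replicate, smul_eq_mul, mul_one, hm] at hsum
  obtain ⟨σ, hσ⟩ := (Equiv.Perm.exists_with_cycleType_iff X (m := m.filter (2 ≤ ·))).mpr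
    ⟨by omega, fun a ha => (Multiset.mem_filter.mp ha).2⟩
  refine ⟨σ, ?_⟩
  rw [Equiv.Perm.parts_partition, ← Equiv.Perm.sum_cycleType, hσ]
  conv_rhs => rw [hsplit]
  congr 2
  omega

/-- The default value `0` in `chi` never occurs: every partition of `d` is the cycle type of some
permutation of the cells. -/
theorem chi_eq_spechtCharacter (lam mu : Nat.Partition d) :
    ∃ σ : Equiv.Perm (Cell (diagram lam)), σ.partition.parts = mu.parts ∧
      chi lam mu = spechtCharacter (diagram lam) σ := by
  classical
  have h : ∃ σ : Equiv.Perm (Cell (diagram lam)), σ.partition.parts = mu.parts :=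
    exists_perm_partition (by rw [card_cell_diagram, mu.parts_sum]) fun a ha => mu.parts_pos ha
  exact ⟨h.choose, h.choose_spec, by rw [chi, dif_pos h]⟩

/-- The partition `(d - k, 1, …, 1)` of `d`. -/
def hookPartition {d k : ℕ} (hk : k < d) : Nat.Partition d where
  parts := (d - k) ::ₘ Multiset.replicate k 1
  parts_pos := by
    intro i hi
    rcases Multiset.mem_cons.mp hi with rfl | h
    · omega
    · rw [Multiset.eq_of_mem_replicate h]
      exact Nat.one_pos
  parts_sum := by simp; omega

theorem rowLens_hookPartition {k : ℕ} (hk : k < d) :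
    (diagram (hookPartition hk)).rowLens = (d - k) :: List.replicate k 1 := by
  rw [rowLens_diagram]
  refine List.Perm.eq_of_pairwise' (r := (· ≥ ·)) (Multiset.pairwise_sort _ _) ?_ ?_
  · refine List.pairwise_cons.mpr ⟨fun a ha => ?_, ?_⟩
    · rw [List.eq_of_mem_replicate ha]
      omega
    · exact List.pairwise_replicate_of_refl 
  · rw [← Multiset.coe_eq_coe, Multiset.sort_eq]
    rfl

theorem colLen_hookPartition {k : ℕ} (hk : k < d) :
    (diagram (hookPartition hk)).colLen 0 = k + 1 := by
  rw [← YoungDiagram.length_rowLens, rowLens_hookPartition]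
  simp

theorem rowLen_eq_getElem (Y : YoungDiagram) {l : List ℕ} (hl : Y.rowLens = l) {i : ℕ}
    (hi : i < l.length) : Y.rowLen i = l[i] := by
  subst hl
  exact YoungDiagram.get_rowLens.symm

theorem rowLen_hookPartition_zero {k : ℕ} (hk : k < d) :
    (diagram (hookPartition hk)).rowLen 0 = d - k := by
  rw [rowLen_eq_getElem _ (rowLens_hookPartition hk) (by simp)]
  rfl

theorem rowLen_hookPartition_succ {k i : ℕ} (hk : k < d) (hi : i < k) :
    (diagram (hookPartition hk)).rowLen (i + 1) = 1 := by
  rw [rowLen_eq_getElem _ (rowLens_hookPartition hk) (by simpa using hi)]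
  simp

theorem one_one_notMem_hookPartition {k : ℕ} (hk : k < d) :
    (1, 1) ∉ diagram (hookPartition hk) := by
  intro h
  have h1 : (1, 0) ∈ diagram (hookPartition hk) :=
    (diagram (hookPartition hk)).up_left_mem le_rfl (Nat.zero_le _) h
  rw [YoungDiagram.mem_iff_lt_colLen, colLen_hookPartition] at h1
  rw [YoungDiagram.mem_iff_lt_rowLen, rowLen_hookPartition_succ hk (by omega)] at h
  omega

theorem eq_hookPartition (hd : 0 < d) (lam : Nat.Partition d) (h : (1, 1) ∉ diagram lam) :
    ∃ (k : ℕ) (hk : k < d), lam = hookPartition hk := by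
  have hsum : (lam.parts.sort (· ≥ ·)).sum = d := by
    rw [← Multiset.sum_coe, Multiset.sort_eq, lam.parts_sum]
  cases hl : lam.parts.sort (· ≥ ·) with
  | nil =>
    rw [hl] at hsum
    simp at hsum
    omega
  | cons a l =>
    have h1 : l = List.replicate l.length 1 := by
      refine List.eq_replicate_length.mpr fun b hb => ?_
      obtain ⟨i, hi, rfl⟩ := List.getElem_of_mem hb
      have h2 : (diagram lam).rowLen (i + 1) = l[i] := by
        rw [rowLen_eq_getElem _ ((rowLens_diagram lam).trans hl) (by simpa using hi)]
        simp
      have h3 : (diagram lam).rowLen (i + 1) ≤ (diagram lam).rowLen 1 :=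
        (diagram lam).rowLen_anti _ _ (by omega)
      have h4 : ¬ 1 < (diagram lam).rowLen 1 := by
        rwa [← YoungDiagram.mem_iff_lt_rowLen]
      have h5 : 0 < l[i] := lam.parts_pos ((Multiset.mem_sort (r := (· ≥ ·))).mp
        (by rw [hl]; exact List.mem_cons_of_mem _ hb))
      omega
    have ha : 0 < a := lam.parts_pos ((Multiset.mem_sort (r := (· ≥ ·))).mp
        (by rw [hl]; exact List.mem_cons_self))
    rw [hl, List.sum_cons, h1, List.sum_replicate, smul_eq_mul, mul_one] at hsum
    refine ⟨l.length, by omega, ?_⟩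
    ext1
    rw [← Multiset.sort_eq (r := (· ≥ ·)) lam.parts, hl]
    change _ = (d - l.length) ::ₘ Multiset.replicate l.length 1
    rw [show d - l.length = a by omega]
    conv_lhs => rw [h1]
    rfl

/-- The rows of length one telescope, and what is left depends only on the arm and the leg. -/
theorem shiftedPowerSum_hookPartition {k : ℕ} (hk : k < d) (K : ℕ) :
    shiftedPowerSum K (hookPartition hk) =
      (((d - 1 - k : ℕ) : ℂ) + 1 / 2) ^ K - (-(k : ℂ) - 1 / 2) ^ K := by
  rw [shiftedPowerSum, colLen_hookPartition, sum_range_succ', rowLen_hookPartition_zero]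
  have h1 : ∀ i ∈ range k, (((((diagram (hookPartition hk)).rowLen (i + 1) : ℕ) : ℂ) -
      ((i + 1 : ℕ) + 1) + 1 / 2) ^ K - (-(((i + 1 : ℕ) : ℂ) + 1) + 1 / 2) ^ K) =
      (-(i : ℂ) - 1 / 2) ^ K - (-((i + 1 : ℕ) : ℂ) - 1 / 2) ^ K := by
    intro i hi
    rw [rowLen_hookPartition_succ hk (mem_range.mp hi)]
    push_cast
    congr 2 <;> ring
  rw [sum_congr rfl h1, sum_range_sub' (fun i : ℕ => (-(i : ℂ) - 1 / 2) ^ K)]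
  have h2 : ((d - k : ℕ) : ℂ) = ((d - 1 - k : ℕ) : ℂ) + 1 := by
    rw [show d - k = d - 1 - k + 1 by omega]
    push_cast
    ring
  rw [h2]
  push_cast
  ring_nf

theorem chi_eq_zero_of_not_hook (lam : Nat.Partition d) (hd : 0 < d) (h : (1, 1) ∈ diagram lam) :
    chi lam (Nat.Partition.indiscrete d) = 0 := by
  obtain ⟨σ, hσ, he⟩ := chi_eq_spechtCharacter lam (Nat.Partition.indiscrete d)
  rw [he]
  refine spechtCharacter_eq_zero h ?_
  rw [hσ, Nat.Partition.indiscrete_parts hd.ne', card_cell_diagram]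

theorem zero_zero_mem_hookPartition {k : ℕ} (hk : k < d) : (0, 0) ∈ diagram (hookPartition hk) := by
  rw [YoungDiagram.mem_iff_lt_colLen, colLen_hookPartition]
  omega

/-- The generating function of the values of the hook characters. -/
theorem biFunctional_eq_sum_chi (mu : Nat.Partition d) (hd : 0 < d) {W : BiPoly}
    (hW : (MvPolynomial.X 0 - MvPolynomial.X 1) * W =
      (mu.parts.map fun p => MvPolynomial.X 0 ^ p - MvPolynomial.X 1 ^ p : Multiset BiPoly).prod)
    (f : ℕ → ℕ → ℂ) :
    biFunctional f W = ∑ k : Fin d, (-1) ^ (k : ℕ) * chi (hookPartition k.2) mu *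
      f (d - 1 - k) k := by
  have hd0 : (d : ℂ) ≠ 0 := Nat.cast_ne_zero.mpr hd.ne'
  -- The permutation defining the `k`-th character lives on the cells of the `k`-th hook, so each
  -- `k` yields its own expansion `c` of the same functional, of which only the entry `c k` is
  -- identified.
  have key : ∀ k (hk : k < d), ∃ c : ℕ → ℂ,
      (∀ f, (d : ℂ) * biFunctional f W = ∑ i ∈ range d, c i * f (d - 1 - i) i) ∧
      c k = d * ((-1) ^ k * chi (hookPartition hk) mu) := by
    intro k hk
    obtain ⟨σ, hσ, he⟩ := chi_eq_spechtCharacter (hookPartition hk) mu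
    have hσ' : (σ⁻¹).partition.parts = mu.parts := by
      rw [← hσ, Equiv.Perm.parts_partition, Equiv.Perm.parts_partition, Equiv.Perm.cycleType_inv,
        Equiv.Perm.support_inv]
    have h1 : hookPoly σ⁻¹ = (d : ℂ) • W := by
      apply mul_left_cancel₀ X_sub_X_ne_zero
      rw [sub_mul_hookPoly, hσ', ← hW, card_cell_diagram, MvPolynomial.smul_eq_C_mul, map_natCast]
      ring
    refine ⟨fun i => (-1) ^ i * (hookSum (Cell (diagram (hookPartition hk))) i).coeff σ⁻¹,
      fun f => ?_, ?_⟩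
    · have h2 := biFunctional_hookPoly σ⁻¹ f
      rwa [h1, map_smul, smul_eq_mul, card_cell_diagram] at h2
    · rw [he, spechtCharacter_of_hook (one_one_notMem_hookPartition hk)
        (zero_zero_mem_hookPartition hk), card_cell_diagram, colLen_hookPartition,
        Nat.add_sub_cancel]
      field_simp
  -- Testing on an indicator function identifies each coefficient independently of the diagram used
  -- to compute it.
  have hδ : ∀ k (hk : k < d), biFunctional (fun _ j => if j = k then (1 : ℂ) else 0) W =
      (-1) ^ k * chi (hookPartition hk) mu := by
    intro k hk
    obtain ⟨c, hc, hck⟩ := key k hk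
    apply mul_left_cancel₀ hd0
    rw [hc, ← hck]
    simp [hk]
  obtain ⟨c, hc, -⟩ := key 0 hd
  apply mul_left_cancel₀ hd0
  rw [hc, mul_sum, sum_range]
  refine sum_congr rfl fun k _ => ?_
  rw [← hδ k k.2, ← mul_assoc, hc]
  simp

theorem chi_hookPartition_indiscrete {k : ℕ} (hk : k < d) :
    chi (hookPartition hk) (Nat.Partition.indiscrete d) = (-1) ^ k := by
  have hd : 0 < d := by omega
  have h := biFunctional_eq_sum_chi (Nat.Partition.indiscrete d) hd
    (W := ∑ ij ∈ antidiagonal (d - 1), MvPolynomial.X 0 ^ ij.1 * MvPolynomial.X 1 ^ ij.2)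
    (by
      rw [sub_mul_sum_antidiagonal, Nat.Partition.indiscrete_parts hd.ne', Nat.sub_add_cancel hd]
      simp) (fun _ j => if j = k then 1 else 0)
  have h1 : ∑ i : Fin d, (-1) ^ (i : ℕ) * chi (hookPartition i.2) (Nat.Partition.indiscrete d) *
      (if (i : ℕ) = k then 1 else 0) =
      (-1) ^ k * chi (hookPartition hk) (Nat.Partition.indiscrete d) := by
    rw [sum_eq_single (⟨k, hk⟩ : Fin d)]
    · simp
    · intro i _ hi
      rw [if_neg (fun h => hi (Fin.ext h)), mul_zero]
    · simp
  have h2 : ∀ ij ∈ antidiagonal (d - 1), biFunctional (fun _ j => if j = k then (1 : ℂ) else 0)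
      (MvPolynomial.X 0 ^ ij.1 * MvPolynomial.X 1 ^ ij.2) =
      if ij = (d - 1 - k, k) then 1 else 0 := by
    rintro ⟨i, j⟩ hij
    rw [HasAntidiagonal.mem_antidiagonal] at hij
    rw [biFunctional_X_pow]
    refine if_congr ?_ rfl rfl
    simp only [Prod.mk.injEq] at hij ⊢
    omega
  rw [h1, map_sum, sum_congr rfl h2, sum_ite_eq', if_pos] at h
  · have h3 : ((-1 : ℂ) ^ k) * (-1) ^ k = 1 := by rw [← mul_pow]; simp
    apply mul_left_cancel₀ (pow_ne_zero k (neg_ne_zero.mpr (one_ne_zero (α := ℂ))))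
    rw [← h, h3]
  · rw [HasAntidiagonal.mem_antidiagonal]
    simp only
    omega

theorem sum_partition_eq_sum_hook (hd : 0 < d) (F : Nat.Partition d → ℂ)
    (hF : ∀ lam, (1, 1) ∈ diagram lam → F lam = 0) :
    ∑ lam, F lam = ∑ k : Fin d, F (hookPartition k.2) := by
  symm
  refine sum_of_injOn (fun k : Fin d => hookPartition k.2) ?_ (by simp) ?_ fun _ _ => rfl
  · intro k _ l _ h
    have := congrArg (fun lam => (diagram lam).colLen 0) h
    simp only [colLen_hookPartition] at this
    exact Fin.ext (by omega)
  · intro lam _ hlam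
    refine hF lam (by_contra fun h => ?_)
    obtain ⟨k, hk, rfl⟩ := eq_hookPartition hd lam h
    exact hlam ⟨⟨k, hk⟩, by simp, rfl⟩

/-- The eigenvalue of the completed `(r+1)`-cycle on the hook with arm length `i` and leg
length `j`. -/
def hookContent (r i j : ℕ) : ℂ :=
  (((i : ℂ) + 1 / 2) ^ (r + 1) - (-(j : ℂ) - 1 / 2) ^ (r + 1)) / ((r + 1).factorial : ℂ)

/-- Only hooks have a nonzero character on the long cycle, and its value `(-1)^k` there is exactly
the sign in the generating function of the hook characters. -/
theorem hurwitz_indiscrete (r m : ℕ) (hd : 0 < d) (mu : Nat.Partition d) {W : BiPoly}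
    (hW : (MvPolynomial.X 0 - MvPolynomial.X 1) * W =
      (mu.parts.map fun p => MvPolynomial.X 0 ^ p - MvPolynomial.X 1 ^ p : Multiset BiPoly).prod) :
    hurwitz r m (Nat.Partition.indiscrete d) mu = 1 / ((d : ℂ) * (mu.parts.prod : ℂ)) *
      biFunctional (fun i j => hookContent r i j ^ m) W := by
  have h1 := sum_partition_eq_sum_hook hd (fun lam => chi lam (Nat.Partition.indiscrete d) *
      (shiftedPowerSum (r + 1) lam / ((r + 1).factorial : ℂ)) ^ m * chi lam mu) fun lam h => by
    rw [chi_eq_zero_of_not_hook lam hd h, zero_mul, zero_mul]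
  have h2 : ∀ k : Fin d, chi (hookPartition k.2) (Nat.Partition.indiscrete d) *
      (shiftedPowerSum (r + 1) (hookPartition k.2) / ((r + 1).factorial : ℂ)) ^ m *
      chi (hookPartition k.2) mu =
      (-1) ^ (k : ℕ) * chi (hookPartition k.2) mu * hookContent r (d - 1 - k) k ^ m := by
    intro k
    rw [chi_hookPartition_indiscrete, shiftedPowerSum_hookPartition, ← hookContent, mul_right_comm]
  rw [hurwitz, h1, biFunctional_eq_sum_chi mu hd hW, sum_congr rfl fun k _ => h2 k,
    Nat.Partition.indiscrete_parts hd.ne', Multiset.prod_singleton]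

theorem onePartHurwitz_eq (r m : ℕ) {n : ℕ} (hn : 1 ≤ n) (μ : Fin n → ℕ+) {W : BiPoly}
    (hW : (MvPolynomial.X 0 - MvPolynomial.X 1) * W =
      ∏ l, (MvPolynomial.X 0 ^ (μ l : ℕ) - MvPolynomial.X 1 ^ (μ l : ℕ))) :
    onePartHurwitz r m μ = 1 / (((∑ l, (μ l : ℕ) : ℕ) : ℂ) * ∏ l, ((μ l : ℕ) : ℂ)) *
      biFunctional (fun i j => hookContent r i j ^ m) W := by
  have hd : 0 < ∑ l, (μ l : ℕ) :=
    sum_pos (fun l _ => (μ l).pos) ⟨⟨0, hn⟩, mem_univ _⟩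
  rw [onePartHurwitz, hurwitz_indiscrete r m hd (tuplePartition μ) (W := W)]
  · have : (tuplePartition μ).parts.prod = ∏ l, (μ l : ℕ) := rfl
    rw [this]
    push_cast
    rfl
  · rw [hW, tuplePartition, Multiset.map_map]
    rfl

end Diagram

end CompletedHurwitz

end

/-! ### Polynomiality of the content functional in the parts. -/

noncomputable section

namespace CompletedHurwitz

open Finset

/-! ### The content polynomial -/

/-- The polynomial `((x + 1/2)^{r+1} - (x - 1/2)^{r+1}) / (r+1)!`. -/
def contentPoly (r : ℕ) : Polynomial ℂ :=
  Polynomial.C (((r + 1).factorial : ℂ)⁻¹) *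
    ((Polynomial.X + Polynomial.C (1 / 2)) ^ (r + 1) -
      (Polynomial.X - Polynomial.C (1 / 2)) ^ (r + 1))

theorem natDegree_contentPoly_le (r : ℕ) : (contentPoly r).natDegree ≤ r := by
  refine (Polynomial.natDegree_C_mul_le _ _).trans ?_
  rw [← (Commute.all _ _).mul_geom_sum₂]
  have h1 : (Polynomial.X + Polynomial.C (1 / 2) - (Polynomial.X - Polynomial.C (1 / 2)) :
      Polynomial ℂ) = Polynomial.C 1 := by
    rw [add_sub_sub_cancel, ← map_add]
    norm_num
  rw [h1]
  refine (Polynomial.natDegree_C_mul_le _ _).trans (Polynomial.natDegree_sum_le_of_forall_le _ _ ?_)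
  intro i hi
  rw [mem_range] at hi
  refine Polynomial.natDegree_mul_le.trans ?_
  refine (add_le_add (Polynomial.natDegree_pow_le_of_le i (Polynomial.natDegree_X_add_C _).le)
    (Polynomial.natDegree_pow_le_of_le _ (Polynomial.natDegree_X_sub_C _).le)).trans ?_
  omega

/-- The content polynomial satisfies `P(-x) = (-1)^r P(x)`. This parity is what makes the genus an
integer. -/
theorem even_of_coeff_contentPoly_pow_ne_zero {r m s : ℕ} (h : (contentPoly r ^ m).coeff s ≠ 0) :
    Even (r * m + s) := by
  have h1 : (contentPoly r).comp (Polynomial.C (-1) * Polynomial.X) =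
      Polynomial.C ((-1) ^ r) * contentPoly r := by
    simp only [contentPoly, Polynomial.mul_comp, Polynomial.sub_comp, Polynomial.pow_comp,
      Polynomial.add_comp, Polynomial.X_comp, Polynomial.C_comp, map_neg, map_pow, map_one]
    have e1 : (-1 * Polynomial.X + Polynomial.C (1 / 2) : Polynomial ℂ) =
        -1 * (Polynomial.X - Polynomial.C (1 / 2)) := by ring
    have e2 : (-1 * Polynomial.X - Polynomial.C (1 / 2) : Polynomial ℂ) =
        -1 * (Polynomial.X + Polynomial.C (1 / 2)) := by ring
    rw [e1, e2, mul_pow, mul_pow]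
    ring
  have h2 := Polynomial.comp_C_mul_X_coeff (p := contentPoly r ^ m) (r := -1) (n := s)
  rw [Polynomial.pow_comp, h1, mul_pow, ← map_pow, ← pow_mul, Polynomial.coeff_C_mul] at h2
  have h3 : (-1 : ℂ) ^ (r * m + s) = 1 := by
    have h4 : (-1 : ℂ) ^ (r * m) = (-1) ^ s := mul_right_cancel₀ h (h2.trans (mul_comm _ _))
    rw [pow_add, h4, ← mul_pow]
    simp
  rwa [neg_one_pow_eq_one_iff_even (by norm_num)] at h3

/-- With `D = i + j + 1` and `x = (i - j)/2`, the two bases are `x + D/2` and `x - D/2`, so the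
content is `D^{r+1} P(x/D)` for the content polynomial `P`, which has degree at most `r`. -/
theorem hookContent_pow_eq_sum (r m : ℕ) {i j : ℕ} :
    hookContent r i j ^ m = ∑ s ∈ range (r * m + 1), (contentPoly r ^ m).coeff s *
      (((i : ℂ) - j) / 2) ^ s * ((i + j + 1 : ℕ) : ℂ) ^ ((r + 1) * m - s) := by
  set D : ℂ := ((i + j + 1 : ℕ) : ℂ) with hD
  have hD0 : D ≠ 0 := Nat.cast_ne_zero.mpr (Nat.succ_ne_zero _)
  set x : ℂ := ((i : ℂ) - j) / 2 with hx
  have h1 : hookContent r i j = D ^ (r + 1) * (contentPoly r).eval (x / D) := by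
    simp only [contentPoly, Polynomial.eval_mul, Polynomial.eval_C, Polynomial.eval_sub,
      Polynomial.eval_pow, Polynomial.eval_add, Polynomial.eval_X]
    have hxD : D * (x / D) = x := by field_simp
    have e1 : (i : ℂ) + 1 / 2 = D * (x / D + 1 / 2) := by
      rw [mul_add, hxD, hx, hD]; push_cast; ring
    have e2 : -(j : ℂ) - 1 / 2 = D * (x / D - 1 / 2) := by
      rw [mul_sub, hxD, hx, hD]; push_cast; ring
    rw [hookContent, e1, e2, mul_pow, mul_pow]
    ring
  rw [h1, mul_pow, ← Polynomial.eval_pow, Polynomial.eval_eq_sum_range' (n := r * m + 1), mul_sum]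
  · refine sum_congr rfl fun s hs => ?_
    rw [mem_range] at hs
    have h2 : D ^ ((r + 1) * m) = D ^ s * D ^ ((r + 1) * m - s) := by
      rw [← pow_add]
      congr 1
      have : (r + 1) * m = r * m + m := by ring
      omega
    rw [← pow_mul, h2, div_pow]
    field_simp
  · refine Nat.lt_succ_of_le ?_
    rw [mul_comm]
    exact Polynomial.natDegree_pow_le_of_le m (natDegree_contentPoly_le r)

/-! ### Homogeneity of the quotient by `X - Y` -/

theorem powDiff_isHomogeneous (k : ℕ) : (powDiff k).IsHomogeneous k := by
  rw [powDiff]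
  exact ((MvPolynomial.isHomogeneous_X_pow _ _).sub (MvPolynomial.isHomogeneous_X_pow _ _)).C_mul _

theorem isHomogeneous_quotient {n : ℕ} (hn : 1 ≤ n) (μ : Fin n → ℕ+) {V : BiPoly}
    (hV : (MvPolynomial.X 0 - MvPolynomial.X 1) * V = ∏ l, powDiff (μ l)) :
    V.IsHomogeneous (∑ l, (μ l : ℕ) - 1) := by
  obtain ⟨n, rfl⟩ : ∃ k, n = k + 1 := ⟨n - 1, by omega⟩
  obtain ⟨k, hk⟩ : ∃ k, (μ 0 : ℕ) = k + 1 := ⟨(μ 0 : ℕ) - 1, (Nat.sub_add_cancel (μ 0).pos).symm⟩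
  have h1 : V = (MvPolynomial.C (((μ 0 : ℕ) : ℂ)⁻¹) *
      ∑ ij ∈ antidiagonal k, MvPolynomial.X 0 ^ ij.1 * MvPolynomial.X 1 ^ ij.2) *
      ∏ l : Fin n, powDiff (μ l.succ) := by
    apply mul_left_cancel₀ X_sub_X_ne_zero
    rw [hV, Fin.prod_univ_succ, powDiff, hk, ← sub_mul_sum_antidiagonal]
    ring
  have h2 : ∑ l, (μ l : ℕ) - 1 = k + ∑ l : Fin n, (μ l.succ : ℕ) := by
    rw [Fin.sum_univ_succ, hk]
    omega
  rw [h2, h1]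
  refine MvPolynomial.IsHomogeneous.mul (MvPolynomial.IsHomogeneous.C_mul
    (MvPolynomial.IsHomogeneous.sum _ _ _ fun ij hij => ?_) _)
    (MvPolynomial.IsHomogeneous.prod _ _ _ fun l _ => powDiff_isHomogeneous _)
  rw [HasAntidiagonal.mem_antidiagonal] at hij
  rw [← hij]
  exact (MvPolynomial.isHomogeneous_X_pow _ _).mul (MvPolynomial.isHomogeneous_X_pow _ _)

theorem biFunctional_congr {M : Type*} [AddCommGroup M] [Module ℂ M] {f f' : ℕ → ℕ → M} {V : BiPoly}
    {D : ℕ} (hV : V.IsHomogeneous D) (h : ∀ i j, i + j = D → f i j = f' i j) :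
    biFunctional f V = biFunctional f' V := by
  rw [V.as_sum, map_sum, map_sum]
  refine sum_congr rfl fun e he => ?_
  have h1 : MvPolynomial.monomial e (V.coeff e) = V.coeff e • MvPolynomial.monomial e (1 : ℂ) := by
    rw [MvPolynomial.smul_monomial, smul_eq_mul, mul_one]
  have h2 : e 0 + e 1 = D := by
    have h3 : e.degree = D := by
      by_contra h
      exact MvPolynomial.mem_support_iff.mp he (hV.coeff_eq_zero h)
    rw [← h3, Finsupp.degree_eq_sum, Fin.sum_univ_two]
  rw [h1, map_smul, map_smul, biFunctional_monomial, biFunctional_monomial, h _ _ h2]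

/-! ### The hyperbolic sine -/

/-- The power series `sinh(z/2) / (z/2)`. -/
def sinhc : PowerSeries ℂ :=
  PowerSeries.mk fun k => if Even k then (1 / 2) ^ k / ((k + 1).factorial : ℂ) else 0

theorem X_mul_sinhc : PowerSeries.X * sinhc =
    PowerSeries.rescale (1 / 2 : ℂ) (PowerSeries.exp ℂ) -
      PowerSeries.rescale (-(1 / 2) : ℂ) (PowerSeries.exp ℂ) := by
  ext k
  cases k with
  | zero => rw [PowerSeries.coeff_zero_X_mul, map_sub, PowerSeries.coeff_rescale,
      PowerSeries.coeff_rescale, pow_zero, pow_zero, sub_self]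
  | succ k =>
    rw [PowerSeries.coeff_succ_X_mul, sinhc, PowerSeries.coeff_mk, map_sub,
      PowerSeries.coeff_rescale, PowerSeries.coeff_rescale, PowerSeries.coeff_exp]
    split_ifs with h
    · rw [h.add_one.neg_pow, pow_succ]
      simp only [one_div, map_inv₀, map_natCast]
      ring
    · rw [(Nat.not_even_iff_odd.mp h).add_one.neg_pow, sub_self]

theorem constantCoeff_sinhc : PowerSeries.constantCoeff sinhc = 1 := by
  rw [← PowerSeries.coeff_zero_eq_constantCoeff_apply, sinhc, PowerSeries.coeff_mk]
  simp

theorem sinhc_mul_inv : sinhc * sinhc⁻¹ = 1 :=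
  PowerSeries.mul_inv_cancel _ (by rw [constantCoeff_sinhc]; exact one_ne_zero)

theorem coeff_sinhc_of_odd {k : ℕ} (hk : ¬Even k) : PowerSeries.coeff k sinhc = 0 := by
  rw [sinhc, PowerSeries.coeff_mk, if_neg hk]

theorem rescale_neg_one_sinhc : PowerSeries.rescale (-1 : ℂ) sinhc = sinhc := by
  ext k
  rw [PowerSeries.coeff_rescale]
  by_cases hk : Even k
  · rw [hk.neg_one_pow, one_mul]
  · rw [coeff_sinhc_of_odd hk, mul_zero]

theorem coeff_inv_sinhc_of_odd {k : ℕ} (hk : ¬Even k) : PowerSeries.coeff k sinhc⁻¹ = 0 := by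
  have h1 : PowerSeries.rescale (-1 : ℂ) sinhc⁻¹ = sinhc⁻¹ := by
    have h2 := congrArg (PowerSeries.rescale (-1 : ℂ)) sinhc_mul_inv
    rw [map_mul, rescale_neg_one_sinhc, map_one] at h2
    calc _ = (sinhc * sinhc⁻¹) * PowerSeries.rescale (-1 : ℂ) sinhc⁻¹ := by
          rw [sinhc_mul_inv, one_mul]
      _ = sinhc⁻¹ * (sinhc * PowerSeries.rescale (-1 : ℂ) sinhc⁻¹) := by ring
      _ = _ := by rw [h2, mul_one]
  have h2 := congrArg (PowerSeries.coeff k) h1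
  rw [PowerSeries.coeff_rescale, (Nat.not_even_iff_odd.mp hk).neg_one_pow, neg_one_mul] at h2
  exact eq_zero_of_eq_neg h2.symm

/-! ### Polynomiality of the one-part numbers -/

/-- The substitution `X ↦ e^{z/2}`, `Y ↦ e^{-z/2}`. -/
def expHom : BiPoly →ₐ[ℂ] PowerSeries ℂ :=
  MvPolynomial.aeval ![PowerSeries.rescale (1 / 2 : ℂ) (PowerSeries.exp ℂ),
    PowerSeries.rescale (-(1 / 2) : ℂ) (PowerSeries.exp ℂ)]

theorem expHom_X_zero_pow (i : ℕ) : expHom (MvPolynomial.X 0 ^ i) =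
    PowerSeries.rescale ((i : ℂ) / 2) (PowerSeries.exp ℂ) := by
  rw [map_pow, expHom, MvPolynomial.aeval_X]
  simp only [Matrix.cons_val_zero]
  rw [← map_pow, PowerSeries.exp_pow_eq_rescale_exp, PowerSeries.rescale_rescale]
  congr 2
  ring

theorem expHom_X_one_pow (i : ℕ) : expHom (MvPolynomial.X 1 ^ i) =
    PowerSeries.rescale (-((i : ℂ) / 2)) (PowerSeries.exp ℂ) := by
  rw [map_pow, expHom, MvPolynomial.aeval_X]
  simp only [Matrix.cons_val_one, Matrix.cons_val_zero]
  rw [← map_pow, PowerSeries.exp_pow_eq_rescale_exp, PowerSeries.rescale_rescale]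
  congr 2
  ring

/-- Under `X = e^{z/2}`, `Y = e^{-z/2}` the functionals given by powers of `(i - j)/2` become
extractions of coefficients of `z`, which are computed multiplicatively. -/
theorem coeff_expHom (s i j : ℕ) :
    PowerSeries.coeff s (expHom (MvPolynomial.X 0 ^ i * MvPolynomial.X 1 ^ j)) =
      (((i : ℂ) - j) / 2) ^ s / (s.factorial : ℂ) := by
  rw [map_mul, expHom_X_zero_pow, expHom_X_one_pow, PowerSeries.exp_mul_exp_eq_exp_add,
    PowerSeries.coeff_rescale, PowerSeries.coeff_exp]
  simp only [one_div, map_inv₀, map_natCast]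
  rw [div_eq_mul_inv]
  congr 2
  ring

theorem rescale_X_mul_sinhc (k : ℂ) : PowerSeries.C k * (PowerSeries.X *
    PowerSeries.rescale k sinhc) = PowerSeries.rescale (k / 2) (PowerSeries.exp ℂ) -
      PowerSeries.rescale (-(k / 2)) (PowerSeries.exp ℂ) := by
  have h := congrArg (PowerSeries.rescale k) X_mul_sinhc
  rw [map_mul, PowerSeries.rescale_X, map_sub, PowerSeries.rescale_rescale,
    PowerSeries.rescale_rescale, mul_assoc] at h
  rw [h]
  congr 3 <;> ring

theorem expHom_powDiff {k : ℕ} (hk : k ≠ 0) :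
    expHom (powDiff k) = PowerSeries.X * PowerSeries.rescale (k : ℂ) sinhc := by
  have hk' : (k : ℂ) ≠ 0 := Nat.cast_ne_zero.mpr hk
  rw [powDiff, map_mul, map_sub, expHom_X_zero_pow, expHom_X_one_pow, ← rescale_X_mul_sinhc,
    ← mul_assoc]
  have : expHom (MvPolynomial.C (k : ℂ)⁻¹) = PowerSeries.C (k : ℂ)⁻¹ := by
    rw [expHom, MvPolynomial.aeval_C]
    rfl
  rw [this, ← map_mul, inv_mul_cancel₀ hk', map_one, one_mul]

theorem expHom_quotient {n : ℕ} (hn : 1 ≤ n) (μ : Fin n → ℕ+) {V : BiPoly}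
    (hV : (MvPolynomial.X 0 - MvPolynomial.X 1) * V = ∏ l, powDiff (μ l)) :
    expHom V = PowerSeries.X ^ (n - 1) *
      (sinhc⁻¹ * ∏ l, PowerSeries.rescale ((μ l : ℕ) : ℂ) sinhc) := by
  have h := congrArg expHom hV
  have h1 : expHom (MvPolynomial.X 0 - MvPolynomial.X 1) = PowerSeries.X * sinhc := by
    have h2 := expHom_powDiff one_ne_zero
    rw [powDiff] at h2
    simpa using h2
  rw [map_mul, h1, map_prod, prod_congr rfl fun l _ => expHom_powDiff (μ l).ne_zero,
    prod_mul_distrib, prod_const, card_univ, Fintype.card_fin] at h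
  have h3 : (PowerSeries.X : PowerSeries ℂ) ^ n = PowerSeries.X * PowerSeries.X ^ (n - 1) := by
    rw [← pow_succ', Nat.sub_add_cancel hn]
  rw [h3, mul_assoc, mul_assoc] at h
  have h4 := mul_left_cancel₀ PowerSeries.X_ne_zero h
  calc expHom V = (sinhc * sinhc⁻¹) * expHom V := by rw [sinhc_mul_inv, one_mul]
    _ = sinhc⁻¹ * (sinhc * expHom V) := by ring
    _ = _ := by rw [h4]; ring

/-- The series `S(z)⁻¹ ∏ S(x_l z)` with coefficients polynomials in the `x_l`. -/
def sinhcProd (n : ℕ) : PowerSeries (MvPolynomial (Fin n) ℂ) :=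
  PowerSeries.map MvPolynomial.C sinhc⁻¹ *
    ∏ l, PowerSeries.rescale (MvPolynomial.X l) (PowerSeries.map MvPolynomial.C sinhc)

/-- The polynomial whose value at `μ` is `|μ| h_{|μ|,μ} / m!`. -/
def onePartPoly (r m n : ℕ) : MvPolynomial (Fin n) ℂ :=
  ∑ s ∈ range (r * m + 1),
    MvPolynomial.C ((m.factorial : ℂ)⁻¹ * ((contentPoly r ^ m).coeff s * (s.factorial : ℂ))) *
      ((∑ l, MvPolynomial.X l) ^ ((r + 1) * m - s) *
        PowerSeries.coeff s (PowerSeries.X ^ (n - 1) * sinhcProd n))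

/-- The functional `X^i Y^j ↦ Q(i,j)^m / m!`. -/
def contentFunctional (r m : ℕ) : BiPoly →ₗ[ℂ] ℂ :=
  biFunctional fun i j => hookContent r i j ^ m / (m.factorial : ℂ)

theorem map_eval_sinhcProd {n : ℕ} (x : Fin n → ℂ) :
    PowerSeries.map (MvPolynomial.eval x) (sinhcProd n) =
      sinhc⁻¹ * ∏ l, PowerSeries.rescale (x l) sinhc := by
  have hC : ∀ f : PowerSeries ℂ,
      PowerSeries.map (MvPolynomial.eval x) (PowerSeries.map MvPolynomial.C f) = f := by
    intro f
    ext k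
    simp
  rw [sinhcProd, map_mul, map_prod, hC]
  congr 1
  refine prod_congr rfl fun l _ => ?_
  rw [← PowerSeries.rescale_map, hC, MvPolynomial.eval_X]

/-- On the homogeneous quotient `i + j + 1 = |μ|` is constant, so only the powers of `(i - j)/2`
have to be evaluated. They are coefficients of `z^{n-1} S(z)⁻¹ ∏ S(μ_l z)` with `S(z) =
sinh(z/2)/(z/2)`, hence polynomials in `μ`. -/
theorem contentFunctional_eq_eval (r m : ℕ) {n : ℕ} (hn : 1 ≤ n) (μ : Fin n → ℕ+) {V : BiPoly}
    (hV : (MvPolynomial.X 0 - MvPolynomial.X 1) * V = ∏ l, powDiff (μ l)) :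
    contentFunctional r m V = MvPolynomial.eval (fun l => ((μ l : ℕ) : ℂ)) (onePartPoly r m n) := by
  set D := ∑ l, (μ l : ℕ) with hD
  have hDpos : 1 ≤ D := sum_pos (fun l _ => (μ l).pos) ⟨⟨0, hn⟩, mem_univ _⟩
  have h1 : contentFunctional r m V = biFunctional (fun i j => ∑ s ∈ range (r * m + 1),
      ((m.factorial : ℂ)⁻¹ * ((contentPoly r ^ m).coeff s * (s.factorial : ℂ))) *
        ((D : ℂ) ^ ((r + 1) * m - s) * ((((i : ℂ) - j) / 2) ^ s / (s.factorial : ℂ)))) V := by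
    refine biFunctional_congr (isHomogeneous_quotient hn μ hV) fun i j hij => ?_
    rw [hookContent_pow_eq_sum, show i + j + 1 = D by omega, sum_div]
    refine sum_congr rfl fun s _ => ?_
    have : (s.factorial : ℂ) ≠ 0 := Nat.cast_ne_zero.mpr (Nat.factorial_ne_zero _)
    field_simp
  have h2 : biFunctional (fun i j => ∑ s ∈ range (r * m + 1),
      ((m.factorial : ℂ)⁻¹ * ((contentPoly r ^ m).coeff s * (s.factorial : ℂ))) *
        ((D : ℂ) ^ ((r + 1) * m - s) * ((((i : ℂ) - j) / 2) ^ s / (s.factorial : ℂ)))) =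
      ∑ s ∈ range (r * m + 1),
        ((m.factorial : ℂ)⁻¹ * ((contentPoly r ^ m).coeff s * (s.factorial : ℂ)) *
          (D : ℂ) ^ ((r + 1) * m - s)) • ((PowerSeries.coeff s).comp expHom.toLinearMap) := by
    refine biPoly_hom_ext fun i j => ?_
    rw [biFunctional_X_pow, LinearMap.sum_apply]
    refine sum_congr rfl fun s _ => ?_
    rw [LinearMap.smul_apply, LinearMap.comp_apply, AlgHom.toLinearMap_apply, coeff_expHom,
      smul_eq_mul]
    ring
  rw [h1, h2, LinearMap.sum_apply, onePartPoly, map_sum]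
  refine sum_congr rfl fun s _ => ?_
  have h3 : MvPolynomial.eval (fun l => ((μ l : ℕ) : ℂ)) (∑ l, MvPolynomial.X l) = D := by
    rw [map_sum, hD]
    push_cast
    exact sum_congr rfl fun l _ => MvPolynomial.eval_X l
  have h4 : MvPolynomial.eval (fun l => ((μ l : ℕ) : ℂ))
      (PowerSeries.coeff s (PowerSeries.X ^ (n - 1) * sinhcProd n)) =
      PowerSeries.coeff s (expHom V) := by
    rw [← PowerSeries.coeff_map, RingHom.map_mul, RingHom.map_pow, PowerSeries.map_X,
      map_eval_sinhcProd, expHom_quotient hn μ hV]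
  rw [LinearMap.smul_apply, LinearMap.comp_apply, AlgHom.toLinearMap_apply, smul_eq_mul]
  simp only [RingHom.map_mul, RingHom.map_pow, h3, h4, MvPolynomial.eval_C]
  ring

theorem isHomogeneous_coeff_prod_rescale {n : ℕ} (f : PowerSeries ℂ) (s : Finset (Fin n)) (t : ℕ) :
    (PowerSeries.coeff t (∏ l ∈ s, PowerSeries.rescale (MvPolynomial.X l : MvPolynomial (Fin n) ℂ)
      (PowerSeries.map MvPolynomial.C f))).IsHomogeneous t := by
  induction s using Finset.induction_on generalizing t with
  | empty =>
    rw [prod_empty, PowerSeries.coeff_one]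
    split_ifs with h
    · rw [h]; exact MvPolynomial.isHomogeneous_one _ _
    · exact MvPolynomial.isHomogeneous_zero _ _ _
  | insert l s hl ih =>
    rw [prod_insert hl, PowerSeries.coeff_mul]
    refine MvPolynomial.IsHomogeneous.sum _ _ _ fun p hp => ?_
    rw [HasAntidiagonal.mem_antidiagonal] at hp
    rw [← hp, PowerSeries.coeff_rescale, PowerSeries.coeff_map, mul_comm (MvPolynomial.X l ^ _)]
    exact ((MvPolynomial.isHomogeneous_X_pow _ _).C_mul _).mul (ih p.2)

theorem coeff_prod_rescale_sinhc_of_odd {n : ℕ} {t : ℕ} (ht : ¬Even t) :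
    PowerSeries.coeff t (∏ l, PowerSeries.rescale (MvPolynomial.X l : MvPolynomial (Fin n) ℂ)
      (PowerSeries.map MvPolynomial.C sinhc)) = 0 := by
  set F := ∏ l, PowerSeries.rescale (MvPolynomial.X l : MvPolynomial (Fin n) ℂ)
      (PowerSeries.map MvPolynomial.C sinhc) with hF
  have h1 : PowerSeries.rescale (-1) F = F := by
    rw [hF, map_prod]
    refine prod_congr rfl fun l _ => ?_
    rw [PowerSeries.rescale_rescale, mul_comm, ← PowerSeries.rescale_rescale]
    congr 1
    have := PowerSeries.rescale_map (MvPolynomial.C : ℂ →+* MvPolynomial (Fin n) ℂ) (-1) sinhc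
    rw [map_neg, map_one] at this
    rw [this, rescale_neg_one_sinhc]
  have h2 := congrArg (PowerSeries.coeff t) h1
  rw [PowerSeries.coeff_rescale, (Nat.not_even_iff_odd.mp ht).neg_one_pow, neg_one_mul] at h2
  exact eq_zero_of_eq_neg h2.symm

/-- The monomials that occur in the one-part polynomial. -/
theorem degree_of_coeff_onePartPoly_ne_zero {r m n : ℕ} (hn : 1 ≤ n) {e : Fin n →₀ ℕ}
    (he : MvPolynomial.coeff e (onePartPoly r m n) ≠ 0) :
    ∃ g j, j ≤ g ∧ 2 * g + n = r * m + 1 ∧ e.degree + 2 * j = 2 * g + m := by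
  rw [onePartPoly, MvPolynomial.coeff_sum] at he
  obtain ⟨s, hs, he⟩ := exists_ne_zero_of_sum_ne_zero he
  rw [mem_range] at hs
  rw [MvPolynomial.coeff_C_mul] at he
  have hc : (contentPoly r ^ m).coeff s ≠ 0 := by
    intro h
    apply left_ne_zero_of_mul he
    rw [h, zero_mul, mul_zero]
  have hpar := even_of_coeff_contentPoly_pow_ne_zero hc
  replace he := right_ne_zero_of_mul he
  rw [PowerSeries.coeff_X_pow_mul'] at he
  split_ifs at he with hns
  · rw [sinhcProd, PowerSeries.coeff_mul, mul_sum, MvPolynomial.coeff_sum] at he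
    obtain ⟨⟨t, t'⟩, ht, he⟩ := exists_ne_zero_of_sum_ne_zero he
    rw [HasAntidiagonal.mem_antidiagonal] at ht
    simp only at ht he
    rw [PowerSeries.coeff_map] at he
    have ht1 : Even t := by
      by_contra h
      rw [coeff_inv_sinhc_of_odd h] at he
      simp at he
    have ht2 : Even t' := by
      by_contra h
      rw [coeff_prod_rescale_sinhc_of_odd h] at he
      simp at he
    have hhom : ((∑ l, MvPolynomial.X l : MvPolynomial (Fin n) ℂ) ^ ((r + 1) * m - s) *
        (MvPolynomial.C (PowerSeries.coeff t sinhc⁻¹) * PowerSeries.coeff t'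
        (∏ l, PowerSeries.rescale (MvPolynomial.X l : MvPolynomial (Fin n) ℂ)
          (PowerSeries.map MvPolynomial.C sinhc)))).IsHomogeneous (1 * ((r + 1) * m - s) + t') := by
      refine MvPolynomial.IsHomogeneous.mul (MvPolynomial.IsHomogeneous.pow
        (MvPolynomial.IsHomogeneous.sum _ _ _ fun l _ => MvPolynomial.isHomogeneous_X _ _) _) ?_
      exact (isHomogeneous_coeff_prod_rescale _ _ _).C_mul _
    have hdeg : e.degree = 1 * ((r + 1) * m - s) + t' := by
      by_contra h
      exact he (hhom.coeff_eq_zero h)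
    have hrm : (r + 1) * m = r * m + m := by ring
    rw [hrm] at hdeg
    rw [Nat.even_iff] at ht1 ht2 hpar
    -- The power `t` of `z` taken from `S⁻¹` is `2j`. Since `r m + s`, `t` and `t'` are even and `t
    -- + t' = s - (n - 1)`, the number `r m + 1 - n` is even too and gives `2g`.
    exact ⟨(r * m + 1 - n) / 2, t / 2, by omega, by omega, by omega⟩
  · simp at he

end CompletedHurwitz

end

/-! ### Existence and uniqueness of the intersection numbers. -/

noncomputable section

namespace CompletedHurwitz

open Finset

/-! ### The one-part numbers as values of polynomials -/

theorem exists_quotient {n : ℕ} (hn : 1 ≤ n) (μ : Fin n → ℕ+) :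
    ∃ V : BiPoly, (MvPolynomial.X 0 - MvPolynomial.X 1) * V = ∏ l, powDiff (μ l) := by
  have h1 : (MvPolynomial.X 0 - MvPolynomial.X 1 : BiPoly) ∣ powDiff (μ ⟨0, hn⟩) :=
    Dvd.dvd.mul_left (sub_dvd_pow_sub_pow _ _ _) _
  obtain ⟨V, hV⟩ := h1.trans (dvd_prod_of_mem (fun l => powDiff (μ l)) (mem_univ _))
  exact ⟨V, hV.symm⟩

theorem onePartHurwitz_eq_eval (r m : ℕ) {n : ℕ} (hn : 1 ≤ n) (μ : Fin n → ℕ+) :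
    onePartHurwitz r m μ = (m.factorial : ℂ) / ((∑ l, (μ l : ℕ) : ℕ) : ℂ) *
      MvPolynomial.eval (fun l => ((μ l : ℕ) : ℂ)) (onePartPoly r m n) := by
  obtain ⟨V, hV⟩ := exists_quotient hn μ
  set p : ℂ := ∏ l, ((μ l : ℕ) : ℂ) with hp
  have hp0 : p ≠ 0 := prod_ne_zero_iff.mpr fun l _ => Nat.cast_ne_zero.mpr (μ l).ne_zero
  have hm0 : (m.factorial : ℂ) ≠ 0 := Nat.cast_ne_zero.mpr (Nat.factorial_ne_zero _)
  have hW : (MvPolynomial.X 0 - MvPolynomial.X 1) * (p • V) =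
      ∏ l, (MvPolynomial.X 0 ^ (μ l : ℕ) - MvPolynomial.X 1 ^ (μ l : ℕ)) := by
    rw [mul_smul_comm, hV, MvPolynomial.smul_eq_C_mul, hp, map_prod, ← prod_mul_distrib]
    refine prod_congr rfl fun l _ => ?_
    rw [powDiff, ← mul_assoc, ← map_mul, mul_inv_cancel₀ (Nat.cast_ne_zero.mpr (μ l).ne_zero),
      map_one, one_mul]
  have h1 : biFunctional (fun i j => hookContent r i j ^ m) =
      (m.factorial : ℂ) • contentFunctional r m := by
    refine biPoly_hom_ext fun i j => ?_
    rw [LinearMap.smul_apply, contentFunctional, biFunctional_X_pow, biFunctional_X_pow, smul_eq_mul,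
      mul_div_cancel₀ _ hm0]
  rw [onePartHurwitz_eq r m hn μ hW, h1, LinearMap.smul_apply, map_smul,
    contentFunctional_eq_eval r m hn μ hV, smul_eq_mul, smul_eq_mul, ← hp]
  have hd : ((∑ l, (μ l : ℕ) : ℕ) : ℂ) ≠ 0 :=
    Nat.cast_ne_zero.mpr (sum_pos (fun l _ => (μ l).pos) ⟨⟨0, hn⟩, mem_univ _⟩).ne'
  field_simp

theorem mvPolynomial_ext_pnat {n : ℕ} {p q : MvPolynomial (Fin n) ℂ}
    (h : ∀ μ : Fin n → ℕ+, MvPolynomial.eval (fun l => ((μ l : ℕ) : ℂ)) p =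
      MvPolynomial.eval (fun l => ((μ l : ℕ) : ℂ)) q) : p = q := by
  refine MvPolynomial.funext_set (fun _ => Set.range fun k : ℕ+ => ((k : ℕ) : ℂ)) (fun _ => ?_) ?_
  · refine Set.infinite_range_of_injective fun a b hab => ?_
    exact PNat.coe_injective (Nat.cast_injective hab)
  · intro x hx
    choose μ hμ using fun l => hx l (Set.mem_univ l)
    have : x = fun l => ((μ l : ℕ) : ℂ) := funext fun l => (hμ l).symm
    rw [this]
    exact h μ

theorem exists_perm_of_map_univ_eq {n : ℕ} {d d' : Fin n → ℕ}
    (h : univ.val.map d = univ.val.map d') : ∃ π : Equiv.Perm (Fin n), d = d' ∘ π := by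
  rw [Fin.univ_val_map, Fin.univ_val_map, Multiset.coe_eq_coe] at h
  have h1 : List.ofFn (d ∘ Tuple.sort d) = List.ofFn (d' ∘ Tuple.sort d') :=
    List.Perm.eq_of_sortedLE (Tuple.monotone_sort d).sortedLE_ofFn
      (Tuple.monotone_sort d').sortedLE_ofFn
      (((Tuple.sort d).ofFn_comp_perm d).trans (h.trans ((Tuple.sort d').ofFn_comp_perm d').symm))
  refine ⟨(Tuple.sort d).symm.trans (Tuple.sort d'), funext fun l => ?_⟩
  have h2 := congrFun (List.ofFn_injective h1) ((Tuple.sort d).symm l)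
  simpa using h2

/-- At positive integers the polynomial is a functional of a quotient that does not depend on the
order of the parts, and these points determine a polynomial. -/
theorem coeff_onePartPoly_symm {r m n : ℕ} (hn : 1 ≤ n) {d d' : Fin n → ℕ}
    (h : univ.val.map d = univ.val.map d') :
    MvPolynomial.coeff (Finsupp.equivFunOnFinite.symm d) (onePartPoly r m n) =
      MvPolynomial.coeff (Finsupp.equivFunOnFinite.symm d') (onePartPoly r m n) := by
  obtain ⟨π, hπ⟩ := exists_perm_of_map_univ_eq h
  have hsymm : MvPolynomial.rename π (onePartPoly r m n) = onePartPoly r m n := by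
    refine mvPolynomial_ext_pnat fun μ => ?_
    obtain ⟨V, hV⟩ := exists_quotient hn μ
    rw [MvPolynomial.eval_rename, ← contentFunctional_eq_eval r m hn μ hV]
    symm
    refine contentFunctional_eq_eval r m hn (μ ∘ π) ?_
    rw [hV]
    exact (Equiv.prod_comp π fun l => powDiff (μ l)).symm
  have h1 : Finsupp.equivFunOnFinite.symm d' =
      (Finsupp.equivFunOnFinite.symm d).mapDomain π := by
    ext l
    obtain ⟨l, rfl⟩ := π.surjective l
    rw [Finsupp.mapDomain_apply π.injective]
    simp [hπ]
  rw [h1]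
  conv_rhs => rw [← hsymm]
  rw [MvPolynomial.coeff_rename_mapDomain _ π.injective]

/-! ### Existence and uniqueness of the intersection numbers -/

/-- Substituting `2g + n - 1 = r m` makes the constraint divisible by `r`. In the reduced form the
exponents determine `j`. -/
theorem dimensionConstraint_iff {r g j m n : ℕ} (hr : 1 ≤ r) (hm : 2 * g + n = r * m + 1)
    {d : Multiset ℕ} (hd : Multiset.card d = n) :
    DimensionConstraint r g j d ↔ d.sum + 2 * j = 2 * g + m := by
  rw [DimensionConstraint, hd]
  have h1 : 2 * g * (r + 1) + n = (2 * g + m) * r + 1 := by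
    calc 2 * g * (r + 1) + n = 2 * g * r + (2 * g + n) := by ring
      _ = _ := by rw [hm]; ring
  rw [h1, Nat.add_right_cancel_iff, Nat.mul_left_inj (by omega)]
  omega

/-- Without any `d_i` the constraint would equate an even number with an odd one. -/
theorem exists_of_dimensionConstraint {r g j : ℕ} (hr : 1 ≤ r) {d : Multiset ℕ}
    (h : DimensionConstraint r g j d) :
    1 ≤ Multiset.card d ∧ ∃ m, 2 * g + Multiset.card d = r * m + 1 := by
  rw [DimensionConstraint] at h
  have h1 : 1 ≤ Multiset.card d := by
    rw [Nat.one_le_iff_ne_zero]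
    intro h0
    rw [h0, Multiset.card_eq_zero.mp h0, Multiset.sum_zero] at h
    have h2 := congrArg (· % 2) h
    simp only [add_zero, mul_assoc, Nat.mul_mod_right] at h2
    omega
  -- Solving the constraint for `(2g + n - 1) / r` gives this value of `m`.
  refine ⟨h1, 2 * j + d.sum - 2 * g, ?_⟩
  have h2 : 2 * g ≤ 2 * j + d.sum := by
    by_contra hlt
    have h3 : (2 * j + d.sum + 1) * r ≤ 2 * g * r := Nat.mul_le_mul_right r (by omega)
    have h4 : 2 * g * (r + 1) = 2 * g * r + 2 * g := by ring
    have h5 : (2 * j + d.sum + 1) * r = (2 * j + d.sum) * r + r := by ring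
    omega
  obtain ⟨q, hq⟩ := Nat.exists_eq_add_of_le h2
  rw [hq] at h ⊢
  rw [Nat.add_sub_cancel_left]
  have h4 : 2 * g * (r + 1) = 2 * g * r + 2 * g := by ring
  have h5 : (2 * g + q) * r = 2 * g * r + r * q := by ring
  omega

/-- An enumeration of a multiset. -/
def multisetFn (D : Multiset ℕ) : Fin (Multiset.card D) → ℕ := fun i =>
  D.toList.get (i.cast D.length_toList.symm)

theorem map_multisetFn (D : Multiset ℕ) : univ.val.map (multisetFn D) = D := by
  have h : ∀ (l : List ℕ) (n : ℕ) (hn : n = l.length),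
      univ.val.map (fun i : Fin n => l.get (i.cast hn)) = (l : Multiset ℕ) := by
    rintro l _ rfl
    rw [Fin.univ_val_map]
    exact congrArg _ (List.ofFn_get l)
  exact (h D.toList _ D.length_toList.symm).trans D.coe_toList

open Classical in
/-- The intersection numbers, read off from the coefficients of the one-part polynomials. -/
def intersectionNumber (r g j : ℕ) (D : Multiset ℕ) : ℂ :=
  if j ≤ g ∧ DimensionConstraint r g j D then
    (-1) ^ j * MvPolynomial.coeff (Finsupp.equivFunOnFinite.symm (multisetFn D))
      (onePartPoly r ((2 * g + Multiset.card D - 1) / r) (Multiset.card D))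
  else 0

theorem card_map_univ {n : ℕ} (d : Fin n → ℕ) : Multiset.card (univ.val.map d) = n := by simp

theorem coeff_multisetFn {r m n : ℕ} (hn : 1 ≤ n) (d : Fin n → ℕ) {D : Multiset ℕ}
    (hD : D = univ.val.map d) :
    MvPolynomial.coeff (Finsupp.equivFunOnFinite.symm (multisetFn D))
      (onePartPoly r m (Multiset.card D)) =
      MvPolynomial.coeff (Finsupp.equivFunOnFinite.symm d) (onePartPoly r m n) := by
  have h : ∀ (n' : ℕ) (d' : Fin n' → ℕ), n' = n → univ.val.map d' = univ.val.map d →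
      MvPolynomial.coeff (Finsupp.equivFunOnFinite.symm d') (onePartPoly r m n') =
      MvPolynomial.coeff (Finsupp.equivFunOnFinite.symm d) (onePartPoly r m n) := by
    rintro n' d' rfl h
    exact coeff_onePartPoly_symm hn h
  exact h _ _ (by rw [hD, card_map_univ]) (by rw [map_multisetFn, hD])

theorem intersectionNumber_map {r g j m n : ℕ} (hr : 1 ≤ r) (hn : 1 ≤ n)
    (hm : 2 * g + n = r * m + 1) (d : Fin n → ℕ) :
    intersectionNumber r g j (univ.val.map d) =
      if j ≤ g ∧ ∑ l, d l + 2 * j = 2 * g + m then (-1) ^ j *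
        MvPolynomial.coeff (Finsupp.equivFunOnFinite.symm d) (onePartPoly r m n) else 0 := by
  rw [intersectionNumber, dimensionConstraint_iff hr hm (card_map_univ d)]
  have h1 : (2 * g + Multiset.card (univ.val.map d) - 1) / r = m := by
    rw [card_map_univ, hm, Nat.add_sub_cancel, Nat.mul_div_cancel_left _ (by omega)]
  rw [h1, coeff_multisetFn hn d rfl]
  by_cases h : j ≤ g ∧ ∑ l, d l + 2 * j = 2 * g + m
  · rw [if_pos h]
    exact if_pos h
  · rw [if_neg h]
    exact if_neg h

theorem finsum_eq_sum_piFinset {n M : ℕ} (f : (Fin n → ℕ) → ℂ)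
    (hf : ∀ d, f d ≠ 0 → ∑ l, d l ≤ M) :
    ∑ᶠ d, f d = ∑ d ∈ Fintype.piFinset fun _ : Fin n => range (M + 1), f d := by
  refine finsum_eq_sum_of_support_subset _ fun d hd => ?_
  rw [mem_coe, Fintype.mem_piFinset]
  intro l
  rw [mem_range, Nat.lt_succ_iff]
  exact (single_le_sum (fun _ _ => Nat.zero_le _) (mem_univ l)).trans (hf d hd)

theorem eval_eq_sum_piFinset {n M : ℕ} {P : MvPolynomial (Fin n) ℂ}
    (hP : ∀ e, MvPolynomial.coeff e P ≠ 0 → e.degree ≤ M) (x : Fin n → ℂ) :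
    MvPolynomial.eval x P = ∑ d ∈ Fintype.piFinset fun _ : Fin n => range (M + 1),
      MvPolynomial.coeff (Finsupp.equivFunOnFinite.symm d) P * ∏ l, x l ^ d l := by
  rw [MvPolynomial.eval_eq']
  refine sum_of_injOn (fun e => ⇑e) DFunLike.coe_injective.injOn ?_ ?_ ?_
  · intro e he
    rw [mem_coe, Fintype.mem_piFinset]
    intro l
    rw [mem_range, Nat.lt_succ_iff]
    exact (Finsupp.le_degree l e).trans (hP e (MvPolynomial.mem_support_iff.mp he))
  · intro d _ hd
    rw [mul_eq_zero]
    left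
    by_contra h
    exact hd ⟨_, MvPolynomial.mem_support_iff.mpr h, rfl⟩
  · intro e _
    rw [Finsupp.equivFunOnFinite_symm_coe]

theorem degree_le_of_coeff_onePartPoly_ne_zero {r m n g : ℕ} (hn : 1 ≤ n)
    (hm : 2 * g + n = r * m + 1) {e : Fin n →₀ ℕ}
    (he : MvPolynomial.coeff e (onePartPoly r m n) ≠ 0) :
    ∃ j ≤ g, e.degree + 2 * j = 2 * g + m := by
  obtain ⟨g', j, h1, h2, h3⟩ := degree_of_coeff_onePartPoly_ne_zero hn he
  exact ⟨j, by omega, by omega⟩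

theorem degree_equivFunOnFinite_symm {n : ℕ} (d : Fin n → ℕ) :
    (Finsupp.equivFunOnFinite.symm d).degree = ∑ l, d l := by
  rw [Finsupp.degree_eq_sum]
  rfl

/-- Every monomial of the one-part polynomial has degree `2g + m - 2j` for exactly one `j ≤ g`. Its
coefficient is assigned to that `j`, and the two signs `(-1)^j` cancel. -/
theorem isIntersectionNumbers_intersectionNumber {r : ℕ} (hr : 1 ≤ r) :
    IsIntersectionNumbers r (intersectionNumber r) where
  dimension g j D h := by
    by_contra hne
    exact h (by rw [intersectionNumber, if_neg fun h => hne h.2])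
  index_le g j D h := by
    by_contra hne
    exact h (by rw [intersectionNumber, if_neg fun h => hne h.1])
  formula g m n μ hn hm := by
    classical
    rw [onePartHurwitz_eq_eval r m hn μ]
    congr 1
    have h1 : ∀ j, ∑ᶠ d : Fin n → ℕ, intersectionNumber r g j (univ.val.map d) *
        ∏ i, ((μ i : ℕ) : ℂ) ^ d i = ∑ d ∈ Fintype.piFinset fun _ : Fin n => range (2 * g + m + 1),
        intersectionNumber r g j (univ.val.map d) * ∏ i, ((μ i : ℕ) : ℂ) ^ d i := by
      intro j
      refine finsum_eq_sum_piFinset _ fun d hd => ?_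
      replace hd := left_ne_zero_of_mul hd
      rw [intersectionNumber_map hr hn hm] at hd
      split_ifs at hd with h
      · omega
      · exact absurd rfl hd
    simp only [h1, mul_sum]
    rw [sum_comm, eval_eq_sum_piFinset (M := 2 * g + m)]
    · refine sum_congr rfl fun d _ => ?_
      simp only [← mul_assoc]
      rw [← sum_mul]
      congr 1
      by_cases h0 : MvPolynomial.coeff (Finsupp.equivFunOnFinite.symm d) (onePartPoly r m n) = 0
      · rw [h0]
        refine (sum_eq_zero fun j _ => ?_).symm
        rw [intersectionNumber_map hr hn hm, h0, mul_zero, ite_self, mul_zero]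
      · obtain ⟨j, hj, hdeg⟩ := degree_le_of_coeff_onePartPoly_ne_zero hn hm h0
        rw [degree_equivFunOnFinite_symm] at hdeg
        rw [sum_eq_single_of_mem j (mem_range.mpr (by omega)), intersectionNumber_map hr hn hm,
          if_pos ⟨hj, hdeg⟩, ← mul_assoc, ← mul_pow]
        · simp
        · intro j' _ hne
          rw [intersectionNumber_map hr hn hm, if_neg, mul_zero]
          omega
    · intro e he
      obtain ⟨j, -, h⟩ := degree_le_of_coeff_onePartPoly_ne_zero hn hm he
      omega

/-- The intersection numbers are, up to sign, the coefficients of the one-part polynomials. -/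
theorem IsIntersectionNumbers.eq_coeff {r : ℕ} {N : ℕ → ℕ → Multiset ℕ → ℂ} (hr : 1 ≤ r)
    (hN : IsIntersectionNumbers r N) {g j m n : ℕ} (hn : 1 ≤ n) (hm : 2 * g + n = r * m + 1)
    (hj : j ≤ g) (d : Fin n → ℕ) (hd : ∑ l, d l + 2 * j = 2 * g + m) :
    (-1) ^ j * N g j (univ.val.map d) =
      MvPolynomial.coeff (Finsupp.equivFunOnFinite.symm d) (onePartPoly r m n) := by
  have hdim : ∀ j (d : Fin n → ℕ), N g j (univ.val.map d) ≠ 0 → ∑ l, d l + 2 * j = 2 * g + m :=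
    fun j d h => (dimensionConstraint_iff hr hm (card_map_univ d)).mp (hN.dimension _ _ _ h)
  set S := Fintype.piFinset fun _ : Fin n => range (2 * g + m + 1) with hS
  set R : MvPolynomial (Fin n) ℂ := ∑ d ∈ S, MvPolynomial.monomial
    (Finsupp.equivFunOnFinite.symm d) (∑ j ∈ range (g + 1), (-1) ^ j * N g j (univ.val.map d))
    with hR
  -- Both polynomials compute the same Hurwitz numbers at all tuples of positive integers, so they
  -- coincide.
  have hRP : R = onePartPoly r m n := by
    refine mvPolynomial_ext_pnat fun μ => ?_
    have hd0 : ((∑ l, (μ l : ℕ) : ℕ) : ℂ) ≠ 0 :=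
      Nat.cast_ne_zero.mpr (sum_pos (fun l _ => (μ l).pos) ⟨⟨0, hn⟩, mem_univ _⟩).ne'
    have hm0 : (m.factorial : ℂ) ≠ 0 := Nat.cast_ne_zero.mpr (Nat.factorial_ne_zero _)
    have h1 := hN.formula g m n μ hn hm
    rw [onePartHurwitz_eq_eval r m hn μ] at h1
    rw [mul_left_cancel₀ (div_ne_zero hm0 hd0) h1, hR, map_sum]
    have h2 : ∀ j, ∑ᶠ d : Fin n → ℕ, N g j (univ.val.map d) * ∏ i, ((μ i : ℕ) : ℂ) ^ d i =
        ∑ d ∈ S, N g j (univ.val.map d) * ∏ i, ((μ i : ℕ) : ℂ) ^ d i := by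
      intro j
      refine finsum_eq_sum_piFinset _ fun d hd => ?_
      have := hdim j d (left_ne_zero_of_mul hd)
      omega
    simp only [h2, mul_sum]
    rw [sum_comm]
    refine sum_congr rfl fun d _ => ?_
    rw [MvPolynomial.eval_monomial, sum_mul, Finsupp.prod_fintype _ _ fun _ => pow_zero _]
    exact sum_congr rfl fun j _ => mul_assoc _ _ _
  have hdS : d ∈ S := by
    rw [hS, Fintype.mem_piFinset]
    intro l
    rw [mem_range, Nat.lt_succ_iff]
    have := single_le_sum (f := d) (fun _ _ => Nat.zero_le _) (mem_univ l)
    omega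
  rw [← hRP, hR, MvPolynomial.coeff_sum, sum_eq_single_of_mem d hdS, MvPolynomial.coeff_monomial,
    if_pos rfl, sum_eq_single_of_mem j (mem_range.mpr (by omega))]
  · intro j' _ hne
    rw [mul_eq_zero]
    right
    by_contra h
    have := hdim j' d h
    omega
  · intro d' _ hne
    rw [MvPolynomial.coeff_monomial, if_neg]
    exact fun h => hne (Finsupp.equivFunOnFinite.symm.injective h)

theorem IsIntersectionNumbers.unique {r : ℕ} {N N' : ℕ → ℕ → Multiset ℕ → ℂ} (hr : 1 ≤ r)
    (hN : IsIntersectionNumbers r N) (hN' : IsIntersectionNumbers r N') : N = N' := by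
  funext g j D
  by_cases h : j ≤ g ∧ DimensionConstraint r g j D
  · obtain ⟨hn, m, hm⟩ := exists_of_dimensionConstraint hr h.2
    have hd := (dimensionConstraint_iff hr hm rfl).mp h.2
    have hs : D.sum = ∑ l, multisetFn D l := by
      conv_lhs => rw [← map_multisetFn D]
      rfl
    rw [hs] at hd
    have h1 := hN.eq_coeff hr hn hm h.1 (multisetFn D) hd
    rw [← hN'.eq_coeff hr hn hm h.1 (multisetFn D) hd, map_multisetFn] at h1
    exact mul_left_cancel₀ (pow_ne_zero j (neg_ne_zero.mpr one_ne_zero)) h1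
  · have h1 : ∀ {N}, IsIntersectionNumbers r N → N g j D = 0 := fun hN => by
      by_contra hne
      exact h ⟨hN.index_le _ _ _ hne, hN.dimension _ _ _ hne⟩
    rw [h1 hN, h1 hN']

end CompletedHurwitz

end

/-! ### The linear forms `T` as finite differences, and their divided powers. -/

noncomputable section

namespace CompletedHurwitz

open Finset

/-! ### The linear forms `T` -/

/-- The coefficient of `u^{d-β} q_{β+1}` in `T_d`. -/
def tCoeff (d β : ℕ) : ℂ :=
  ∑ i ∈ range (β + 1), (-1) ^ (β - i) * (β.choose i : ℂ) * ((i : ℂ) + 1) ^ d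

theorem tCoeff_zero_zero : tCoeff 0 0 = 1 := by simp [tCoeff]

theorem tCoeff_zero_succ (β : ℕ) : tCoeff 0 (β + 1) = 0 := by
  have h := add_pow (1 : ℂ) (-1) (β + 1)
  rw [add_neg_cancel, zero_pow (Nat.succ_ne_zero _)] at h
  rw [tCoeff, h]
  refine sum_congr rfl fun i _ => ?_
  rw [one_pow, one_mul, pow_zero, mul_one]

theorem tCoeff_succ_zero (d : ℕ) : tCoeff (d + 1) 0 = tCoeff d 0 := by simp [tCoeff]

/-- Leibniz rule for finite differences: `i + 1 = (β + 2) - (β + 1 - i)`, and the factor `β + 1 - i`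
is absorbed by the binomial coefficient, lowering the order of the difference. -/
theorem tCoeff_succ_succ (d β : ℕ) :
    tCoeff (d + 1) (β + 1) = (β + 2) * tCoeff d (β + 1) + (β + 1) * tCoeff d β := by
  have h1 : ∑ i ∈ range (β + 2), (-1 : ℂ) ^ (β + 1 - i) * ((β + 1).choose i : ℂ) *
      ((i : ℂ) + 1) ^ d * ((β : ℂ) + 1 - i) = -((β + 1) * tCoeff d β) := by
    rw [sum_range_succ, tCoeff, mul_sum, ← sum_neg_distrib]
    simp only [Nat.cast_add, Nat.cast_one, sub_self, mul_zero, add_zero]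
    refine sum_congr rfl fun i hi => ?_
    rw [mem_range] at hi
    have h2 : (β.choose i : ℂ) * (β + 1) = ((β + 1).choose i : ℂ) * (β + 1 - i) := by
      have h3 : ((β.choose i * (β + 1) : ℕ) : ℂ) = (((β + 1).choose i * (β + 1 - i) : ℕ) : ℂ) :=
        congrArg _ (Nat.choose_mul_succ_eq β i)
      rw [Nat.cast_mul, Nat.cast_mul, Nat.cast_sub (by omega)] at h3
      push_cast at h3
      exact h3
    rw [show β + 1 - i = (β - i) + 1 by omega, pow_succ]
    linear_combination ((-1 : ℂ) ^ (β - i) * ((i : ℂ) + 1) ^ d) * h2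
  have h2 : tCoeff (d + 1) (β + 1) = (β + 2) * tCoeff d (β + 1) -
      ∑ i ∈ range (β + 2), (-1 : ℂ) ^ (β + 1 - i) * ((β + 1).choose i : ℂ) *
      ((i : ℂ) + 1) ^ d * ((β : ℂ) + 1 - i) := by
    rw [tCoeff, tCoeff, mul_sum, ← sum_sub_distrib]
    refine sum_congr rfl fun i _ => ?_
    rw [pow_succ]
    ring
  rw [h2, h1]
  ring

theorem tCoeff_eq_zero {d β : ℕ} (h : d < β) : tCoeff d β = 0 := by
  induction d generalizing β with
  | zero =>
    obtain ⟨β, rfl⟩ : ∃ k, β = k + 1 := ⟨β - 1, by omega⟩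
    exact tCoeff_zero_succ β
  | succ d ih =>
    obtain ⟨β, rfl⟩ : ∃ k, β = k + 1 := ⟨β - 1, by omega⟩
    rw [tCoeff_succ_succ, ih (by omega), ih (by omega), mul_zero, mul_zero, add_zero]

/-- The operator `𝓔_{0,1}` keeps `q_{β+1}` and `𝓔_{-1,1}` raises it, both with factor `β + 1`; this
is the recursion of the finite differences of `(x + 1)^d` at `0`. -/
theorem T_eq_sum (d : ℕ) : T d = ∑ β ∈ range (d + 1),
    (PowerSeries.C (tCoeff d β) * PowerSeries.X ^ (d - β)) • MvPolynomial.X (Nat.succPNat β) := by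
  induction d with
  | zero =>
    simp [T, tCoeff_zero_zero]
    rfl
  | succ d ih =>
    have hE : ∀ β, E01 (MvPolynomial.X (Nat.succPNat β)) =
        PowerSeries.C ((β : ℂ) + 1) • MvPolynomial.X (Nat.succPNat β) := by
      intro β
      rw [E01, MvPolynomial.mkDerivation_X, ← Nat.cast_smul_eq_nsmul (PowerSeries ℂ)]
      simp
    have hM : ∀ β, Em11 (MvPolynomial.X (Nat.succPNat β)) =
        PowerSeries.C ((β : ℂ) + 1) • MvPolynomial.X (Nat.succPNat (β + 1)) := by
      intro β
      rw [Em11, MvPolynomial.mkDerivation_X, ← Nat.cast_smul_eq_nsmul (PowerSeries ℂ)]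
      simp only [Nat.succPNat_coe, Nat.succ_eq_add_one, Nat.cast_add, Nat.cast_one, map_add,
        map_natCast, map_one]
      rfl
    have h1 : (PowerSeries.X : PowerSeries ℂ) • E01 (T d) = ∑ β ∈ range (d + 2),
        (PowerSeries.C ((β + 1) * tCoeff d β) * PowerSeries.X ^ (d + 1 - β)) •
          MvPolynomial.X (Nat.succPNat β) := by
      rw [sum_range_succ, tCoeff_eq_zero (Nat.lt_succ_self d), mul_zero, map_zero, zero_mul,
        zero_smul, add_zero, ih, map_sum, smul_sum]
      refine sum_congr rfl fun β hβ => ?_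
      rw [mem_range] at hβ
      rw [Derivation.map_smul, hE, smul_smul, smul_smul, show d + 1 - β = (d - β) + 1 by omega,
        map_mul, pow_succ]
      congr 1
      ring
    have h2 : Em11 (T d) = ∑ β ∈ range (d + 1),
        (PowerSeries.C ((β + 1) * tCoeff d β) * PowerSeries.X ^ (d - β)) •
          MvPolynomial.X (Nat.succPNat (β + 1)) := by
      rw [ih, map_sum]
      refine sum_congr rfl fun β _ => ?_
      rw [Derivation.map_smul, hM, smul_smul, map_mul]
      congr 1
      ring
    rw [T, h1, h2, sum_range_succ', sum_range_succ' _ (d + 1), add_right_comm, ← sum_add_distrib]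
    congr 1
    · refine sum_congr rfl fun β _ => ?_
      rw [← add_smul, Nat.add_sub_add_right, ← add_mul, ← map_add, tCoeff_succ_succ]
      push_cast
      congr 4
      ring
    · rw [tCoeff_succ_zero]
      simp

/-- The coefficient of `q_b` in `T_d`. -/
def tSeries (d : ℕ) (b : ℕ+) : PowerSeries ℂ :=
  PowerSeries.C (tCoeff d b.natPred) * PowerSeries.X ^ (d - b.natPred)

theorem pderiv_T (d : ℕ) (b : ℕ+) :
    MvPolynomial.pderiv b (T d) = MvPolynomial.C (tSeries d b) := by
  rw [T_eq_sum, map_sum]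
  have h1 : ∀ β ∈ range (d + 1), MvPolynomial.pderiv b
      ((PowerSeries.C (tCoeff d β) * PowerSeries.X ^ (d - β)) • MvPolynomial.X (Nat.succPNat β)) =
      if β = b.natPred then (MvPolynomial.C (tSeries d b) : MvPolynomial ℕ+ (PowerSeries ℂ))
        else 0 := by
    intro β _
    rw [Derivation.map_smul, MvPolynomial.pderiv_X]
    split_ifs with h
    · rw [h, PNat.succPNat_natPred, Pi.single_eq_same, ← tSeries, MvPolynomial.smul_eq_C_mul,
        mul_one]
    · rw [Pi.single_eq_of_ne, smul_zero]
      intro h'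
      apply h
      rw [← h', Nat.natPred_succPNat]
  rw [sum_congr rfl h1, sum_ite_eq']
  split_ifs with h
  · rfl
  · rw [mem_range, Nat.not_lt] at h
    rw [tSeries, tCoeff_eq_zero h, map_zero, zero_mul, map_zero]

theorem coeff_zero_T (d : ℕ) : MvPolynomial.coeff 0 (T d) = 0 := by
  rw [T_eq_sum, MvPolynomial.coeff_sum]
  refine sum_eq_zero fun β _ => ?_
  rw [MvPolynomial.coeff_smul, MvPolynomial.coeff_zero_X, smul_zero]

/-! ### The divided powers of the linear forms -/

/-- The product `∏ T_i^{k_i} / k_i!`. -/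
def tProd (k : ℕ →₀ ℕ) : MvPolynomial ℕ+ (PowerSeries ℂ) :=
  k.prod fun i m => PowerSeries.C ((m.factorial : ℂ)⁻¹) • T i ^ m

theorem derivation_prod {R A ι : Type*} [CommRing R] [CommRing A] [Algebra R A] [DecidableEq ι]
    (D : Derivation R A A) (s : Finset ι) (f : ι → A) :
    D (∏ i ∈ s, f i) = ∑ i ∈ s, (∏ j ∈ s.erase i, f j) * D (f i) := by
  induction s using Finset.induction_on with
  | empty => simp
  | insert a s ha ih =>
    rw [prod_insert ha, Derivation.leibniz, ih, sum_insert ha, erase_insert ha, smul_eq_mul,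
      smul_eq_mul, mul_sum, add_comm]
    congr 1
    refine sum_congr rfl fun i hi => ?_
    have hne : a ≠ i := by rintro rfl; exact ha hi
    rw [erase_insert_of_ne hne, prod_insert (fun h => ha (mem_of_mem_erase h))]
    ring

theorem pderiv_tProd (b : ℕ+) (k : ℕ →₀ ℕ) :
    MvPolynomial.pderiv b (tProd k) =
      ∑ i ∈ k.support, tSeries i b • tProd (k - Finsupp.single i 1) := by
  rw [tProd, Finsupp.prod, derivation_prod]
  refine sum_congr rfl fun i hi => ?_
  obtain ⟨m, hm⟩ : ∃ m, k i = m + 1 := ⟨k i - 1, by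
    have := Finsupp.mem_support_iff.mp hi
    omega⟩
  have h1 : (k - Finsupp.single i 1).support ⊆ k.support := by
    intro j hj
    rw [Finsupp.mem_support_iff, Finsupp.tsub_apply] at hj
    rw [Finsupp.mem_support_iff]
    omega
  rw [tProd, Finsupp.prod_of_support_subset _ h1 _ (by simp), ← prod_erase_mul _ _ hi]
  have h2 : ∏ x ∈ k.support.erase i, PowerSeries.C
        ((((k - Finsupp.single i 1 : ℕ →₀ ℕ) x).factorial : ℂ)⁻¹) •
      T x ^ ((k - Finsupp.single i 1 : ℕ →₀ ℕ) x) =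
      ∏ x ∈ k.support.erase i, PowerSeries.C (((k x).factorial : ℂ)⁻¹) • T x ^ (k x) := by
    refine prod_congr rfl fun x hx => ?_
    rw [Finsupp.tsub_apply, Finsupp.single_apply, if_neg (Ne.symm (ne_of_mem_erase hx)),
      Nat.sub_zero]
  have h3 : (k - Finsupp.single i 1 : ℕ →₀ ℕ) i = m := by
    rw [Finsupp.tsub_apply, Finsupp.single_eq_same, hm, Nat.add_sub_cancel]
  have h4 : ∀ Z : MvPolynomial ℕ+ (PowerSeries ℂ),
      PowerSeries.C ((((m + 1).factorial : ℕ) : ℂ)⁻¹) • (m + 1) • Z =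
      PowerSeries.C ((m.factorial : ℂ)⁻¹) • Z := by
    intro Z
    rw [← Nat.cast_smul_eq_nsmul (PowerSeries ℂ), smul_smul, ← map_natCast PowerSeries.C, ← map_mul,
      Nat.factorial_succ, Nat.cast_mul, mul_inv, mul_right_comm,
      inv_mul_cancel₀ (Nat.cast_ne_zero.mpr (Nat.succ_ne_zero m)), one_mul]
  rw [h2, h3, hm, Derivation.map_smul, Derivation.leibniz_pow, pderiv_T, Nat.add_sub_cancel, h4]
  simp only [MvPolynomial.smul_eq_C_mul, smul_eq_mul]
  ring

theorem coeff_zero_tProd (k : ℕ →₀ ℕ) :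
    MvPolynomial.coeff 0 (tProd k) = if k = 0 then 1 else 0 := by
  rw [← MvPolynomial.constantCoeff_eq, tProd, Finsupp.prod, map_prod]
  split_ifs with h
  · simp [h]
  · obtain ⟨i, hi⟩ := Finsupp.support_nonempty_iff.mpr h
    refine prod_eq_zero hi ?_
    rw [MvPolynomial.smul_eq_C_mul, map_mul, map_pow, show MvPolynomial.constantCoeff (T i) = 0
      from coeff_zero_T i, zero_pow (Finsupp.mem_support_iff.mp hi), mul_zero]

theorem sum_piFinset_succ {M : Type*} [AddCommMonoid M] {n : ℕ} (S : Finset ℕ)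
    (f : (Fin (n + 1) → ℕ) → M) :
    ∑ d ∈ Fintype.piFinset fun _ => S, f d =
      ∑ i ∈ S, ∑ d ∈ Fintype.piFinset fun _ => S, f (Fin.cons i d) := by
  rw [← sum_product']
  refine sum_bij' (fun d _ => (d 0, Fin.tail d)) (fun p _ => Fin.cons p.1 p.2) ?_ ?_ ?_ ?_ ?_
  · intro d hd
    rw [Fintype.mem_piFinset] at hd
    rw [mem_product, Fintype.mem_piFinset]
    exact ⟨hd 0, fun l => hd l.succ⟩
  · intro p hp
    rw [mem_product, Fintype.mem_piFinset] at hp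
    rw [Fintype.mem_piFinset]
    exact Fin.cases hp.1 hp.2
  · intro d _
    exact Fin.cons_self_tail d
  · intro p _
    simp
  · intro d _
    simp only
    rw [Fin.cons_self_tail]

/-- Differentiating successively in the `b_l` uses up one of the forms `T_i` each time. The divided
powers remove the multiplicities, so what remains is a sum over ordered tuples with content `k`. -/
theorem coeff_tProd {n : ℕ} (b : Fin n → ℕ+) (k : ℕ →₀ ℕ) {S : Finset ℕ} (hS : k.support ⊆ S) :
    factProd (∑ l, Finsupp.single (b l) 1) •
        MvPolynomial.coeff (∑ l, Finsupp.single (b l) 1) (tProd k) =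
      ∑ d ∈ Fintype.piFinset fun _ : Fin n => S,
        if ∑ l, Finsupp.single (d l) 1 = k then ∏ l, tSeries (d l) (b l) else 0 := by
  induction n generalizing k with
  | zero =>
    have h1 : factProd 0 = 1 := Finsupp.prod_zero_index
    simp only [univ_eq_empty, sum_empty, prod_empty, h1, one_smul, coeff_zero_tProd]
    rw [Fintype.piFinset_of_isEmpty, univ_unique, sum_singleton]
    exact if_congr eq_comm rfl rfl
  | succ n ih =>
    set e' : ℕ+ →₀ ℕ := ∑ l : Fin n, Finsupp.single (b l.succ) 1 with he'
    have h1 : factProd (e' + Finsupp.single (b 0) 1) •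
        MvPolynomial.coeff (e' + Finsupp.single (b 0) 1) (tProd k) =
        factProd e' • MvPolynomial.coeff e' (MvPolynomial.pderiv (b 0) (tProd k)) := by
      rw [MvPolynomial.coeff_pderiv, factProd_add_single, mul_smul, PowerSeries.smul_eq_C_mul _
        (_ + 1 : ℂ), mul_comm (PowerSeries.C _), map_add, map_natCast, map_one]
    have h2 : ∀ i ∈ k.support, factProd e' •
        MvPolynomial.coeff e' (tSeries i (b 0) • tProd (k - Finsupp.single i 1)) =
        ∑ d ∈ Fintype.piFinset fun _ : Fin n => S,
          if Finsupp.single i 1 + ∑ l, Finsupp.single (d l) 1 = k then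
            tSeries i (b 0) * ∏ l, tSeries (d l) (b l.succ) else 0 := by
      intro i hi
      have hle : Finsupp.single i 1 ≤ k := by
        rw [Finsupp.single_le_iff]
        exact Nat.one_le_iff_ne_zero.mpr (Finsupp.mem_support_iff.mp hi)
      have hsub : (k - Finsupp.single i 1).support ⊆ S := by
        intro j hj
        apply hS
        rw [Finsupp.mem_support_iff, Finsupp.tsub_apply] at hj
        rw [Finsupp.mem_support_iff]
        omega
      rw [MvPolynomial.coeff_smul, smul_eq_mul, ← mul_smul_comm, ih _ _ hsub, mul_sum]
      refine sum_congr rfl fun d _ => ?_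
      rw [mul_ite, mul_zero]
      refine if_congr ?_ rfl rfl
      rw [eq_tsub_iff_add_eq_of_le hle, add_comm]
    rw [Fin.sum_univ_succ, ← he', add_comm, h1, pderiv_tProd, MvPolynomial.coeff_sum, smul_sum,
      sum_congr rfl h2, sum_piFinset_succ]
    refine (sum_subset hS fun i _ hi => sum_eq_zero fun d _ => ?_).trans ?_
    · rw [if_neg]
      rintro rfl
      apply hi
      rw [Finsupp.mem_support_iff, Finsupp.add_apply, Finsupp.single_eq_same]
      omega
    · refine sum_congr rfl fun i _ => sum_congr rfl fun d _ => ?_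
      rw [Fin.sum_univ_succ, Fin.prod_univ_succ]
      simp only [Fin.cons_zero, Fin.cons_succ]

end CompletedHurwitz

end

/-! ### Factorization of the exponentiated contents, and the substitution `X ↦ X - 1`, `Y ↦ Y - 1`.
-/

noncomputable section

namespace CompletedHurwitz

open Finset

/-! ### The exponential series of the hook contents -/

/-- The series `exp (x u^{r+1})`. -/
def contentExp (r : ℕ) (x : ℂ) : PowerSeries ℂ :=
  PowerSeries.expand (r + 1) (Nat.succ_ne_zero r) (PowerSeries.rescale x (PowerSeries.exp ℂ))

theorem contentExp_mul (r : ℕ) (x y : ℂ) :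
    contentExp r x * contentExp r y = contentExp r (x + y) := by
  rw [contentExp, contentExp, ← map_mul, PowerSeries.exp_mul_exp_eq_exp_add, contentExp]

theorem coeff_contentExp (r : ℕ) (x : ℂ) (c : ℕ) : PowerSeries.coeff c (contentExp r x) =
    if r + 1 ∣ c then x ^ (c / (r + 1)) / ((c / (r + 1)).factorial : ℂ) else 0 := by
  rw [contentExp, PowerSeries.coeff_expand, PowerSeries.coeff_rescale, PowerSeries.coeff_exp]
  simp only [div_eq_mul_inv, one_mul, map_inv₀, map_natCast]

theorem sum_choose_mul_half_pow_eq_zero {i j : ℕ} (h : j < i) :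
    ∑ s ∈ range (i + 1), (-1 : ℂ) ^ (i - s) * (i.choose s : ℂ) * ((s : ℂ) + 1 / 2) ^ j = 0 := by
  have h1 := congrFun (fwdDiff_iter_pow_eq_zero_of_lt (R := ℂ) h) (1 / 2)
  rw [fwdDiff_iter_eq_sum_shift, Pi.zero_apply] at h1
  rw [← h1]
  refine sum_congr rfl fun s _ => ?_
  rw [zsmul_eq_mul, nsmul_eq_mul, mul_one, add_comm (s : ℂ)]
  push_cast
  rfl

/-- The series `u^i` divides the `i`-th difference of the exponentials. -/
theorem exists_X_pow_mul_eq (r : ℕ) (κ : ℂ) (i : ℕ) : ∃ A : PowerSeries ℂ,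
    PowerSeries.X ^ i * A = ∑ s ∈ range (i + 1), ((-1 : ℂ) ^ (i - s) * (i.choose s : ℂ)) •
      contentExp r (κ * ((s : ℂ) + 1 / 2) ^ (r + 1)) := by
  have h : (PowerSeries.X : PowerSeries ℂ) ^ i ∣ ∑ s ∈ range (i + 1),
      ((-1 : ℂ) ^ (i - s) * (i.choose s : ℂ)) •
        contentExp r (κ * ((s : ℂ) + 1 / 2) ^ (r + 1)) := by
    rw [PowerSeries.X_pow_dvd_iff]
    intro c hc
    rw [map_sum]
    by_cases hdvd : r + 1 ∣ c
    · obtain ⟨q, rfl⟩ := hdvd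
      -- The coefficient of `u^{(r+1)q}` is a polynomial in `s` of degree at most `(r + 1) q`, which
      -- is killed by differences of order `i > (r + 1) q`.
      rw [← mul_zero (κ ^ q / (q.factorial : ℂ)), ← sum_choose_mul_half_pow_eq_zero hc, mul_sum]
      refine sum_congr rfl fun s _ => ?_
      rw [PowerSeries.coeff_smul, coeff_contentExp, if_pos (dvd_mul_right _ _),
        Nat.mul_div_cancel_left _ (Nat.succ_pos r), mul_pow, ← pow_mul, smul_eq_mul]
      ring
    · refine sum_eq_zero fun s _ => ?_
      rw [PowerSeries.coeff_smul, coeff_contentExp, if_neg hdvd, smul_zero]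
  obtain ⟨A, hA⟩ := h
  exact ⟨A, hA.symm⟩

/-- The series `A_i` of the tau function: `u^i A_i` is the `i`-th difference of
`exp (u^{r+1} (s + 1/2)^{r+1} / (r+1)!)` at `s = 0`. -/
def armSeries (r i : ℕ) : PowerSeries ℂ :=
  (exists_X_pow_mul_eq r ((r + 1).factorial : ℂ)⁻¹ i).choose

/-- The series `B_j` of the tau function: `u^j B_j` is the `j`-th difference of
`exp (-u^{r+1} (-s - 1/2)^{r+1} / (r+1)!)` at `s = 0`. -/
def legSeries (r j : ℕ) : PowerSeries ℂ :=
  (exists_X_pow_mul_eq r ((-1) ^ r * ((r + 1).factorial : ℂ)⁻¹) j).choose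

/-- The substitution `X ↦ X - 1`, `Y ↦ Y - 1`. -/
def shiftHom : BiPoly →ₐ[ℂ] BiPoly := MvPolynomial.aeval fun i => MvPolynomial.X i - 1

theorem shiftHom_X (i : Fin 2) : shiftHom (MvPolynomial.X i) = MvPolynomial.X i - 1 :=
  MvPolynomial.aeval_X _ _

theorem X_sub_one_pow (i : Fin 2) (k : ℕ) : (MvPolynomial.X i - 1 : BiPoly) ^ k =
    ∑ s ∈ range (k + 1), ((-1 : ℂ) ^ (k - s) * (k.choose s : ℂ)) • MvPolynomial.X i ^ s := by
  rw [sub_eq_add_neg, add_pow]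
  refine sum_congr rfl fun s _ => ?_
  rw [MvPolynomial.smul_eq_C_mul, map_mul, map_pow, map_neg, map_one, map_natCast]
  ring

/-- The content of a hook is a function of the arm plus a function of the leg, so its exponential
factors. This is the source of the product form `A_i B_j`. -/
theorem contentExp_mul_contentExp (r s t : ℕ) :
    contentExp r (((r + 1).factorial : ℂ)⁻¹ * ((s : ℂ) + 1 / 2) ^ (r + 1)) *
      contentExp r ((-1) ^ r * ((r + 1).factorial : ℂ)⁻¹ * ((t : ℂ) + 1 / 2) ^ (r + 1)) =
      contentExp r (hookContent r s t) := by
  rw [contentExp_mul, hookContent]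
  congr 1
  rw [show -(t : ℂ) - 1 / 2 = -1 * ((t : ℂ) + 1 / 2) by ring, mul_pow, pow_succ (-1 : ℂ) r]
  ring

/-- Expanding `(X - 1)^i (Y - 1)^j` turns values at `(s, t)` into differences at `(0, 0)`, which by
construction are `u^i A_i` and `u^j B_j`. -/
theorem biFunctional_shiftHom (r : ℕ) (V : BiPoly) :
    biFunctional (fun i j => (PowerSeries.X : PowerSeries ℂ) ^ (i + j) *
      (armSeries r i * legSeries r j)) V =
      biFunctional (fun s t => contentExp r (hookContent r s t)) (shiftHom V) := by
  have h : biFunctional (fun i j => (PowerSeries.X : PowerSeries ℂ) ^ (i + j) *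
      (armSeries r i * legSeries r j)) =
      (biFunctional fun s t => contentExp r (hookContent r s t)) ∘ₗ shiftHom.toLinearMap := by
    refine biPoly_hom_ext fun i j => ?_
    rw [biFunctional_X_pow, LinearMap.comp_apply, AlgHom.toLinearMap_apply, map_mul, map_pow,
      map_pow, shiftHom_X, shiftHom_X, X_sub_one_pow, X_sub_one_pow, sum_mul_sum, map_sum, pow_add,
      mul_mul_mul_comm, armSeries, legSeries, (exists_X_pow_mul_eq r _ i).choose_spec,
      (exists_X_pow_mul_eq r _ j).choose_spec, sum_mul_sum]
    refine sum_congr rfl fun s _ => ?_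
    rw [map_sum]
    refine sum_congr rfl fun t _ => ?_
    rw [smul_mul_smul_comm, smul_mul_smul_comm, map_smul, biFunctional_X_pow,
      contentExp_mul_contentExp]
  rw [h]
  rfl

theorem coeff_biFunctional_contentExp (r c : ℕ) (V : BiPoly) :
    PowerSeries.coeff c (biFunctional (fun s t => contentExp r (hookContent r s t)) V) =
      if r + 1 ∣ c then contentFunctional r (c / (r + 1)) V else 0 := by
  have h : (PowerSeries.coeff c) ∘ₗ (biFunctional fun s t => contentExp r (hookContent r s t)) =
      if r + 1 ∣ c then contentFunctional r (c / (r + 1)) else 0 := by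
    refine biPoly_hom_ext fun i j => ?_
    rw [LinearMap.comp_apply, biFunctional_X_pow, coeff_contentExp]
    split_ifs
    · rw [contentFunctional, biFunctional_X_pow]
    · rfl
  have h1 := LinearMap.congr_fun h V
  rw [LinearMap.comp_apply] at h1
  rw [h1]
  split_ifs <;> rfl

/-- On polynomials of degree `D` one has `D = i + j`, so a single power of `u` restores both factors
`u^i` and `u^j`. -/
theorem X_pow_mul_biFunctional (A B : ℕ → PowerSeries ℂ) {V : BiPoly} {D : ℕ}
    (hV : V.IsHomogeneous D) :
    (PowerSeries.X : PowerSeries ℂ) ^ D * biFunctional (fun i j => A i * B j) V =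
      biFunctional (fun i j => PowerSeries.X ^ (i + j) * (A i * B j)) V := by
  have h : (LinearMap.mulLeft ℂ ((PowerSeries.X : PowerSeries ℂ) ^ D)) ∘ₗ
      (biFunctional fun i j => A i * B j) =
      biFunctional fun i j => PowerSeries.X ^ D * (A i * B j) := by
    refine biPoly_hom_ext fun i j => ?_
    rw [LinearMap.comp_apply, biFunctional_X_pow, biFunctional_X_pow, LinearMap.mulLeft_apply]
  have h1 := LinearMap.congr_fun h V
  rw [LinearMap.comp_apply, LinearMap.mulLeft_apply] at h1
  rw [h1]
  exact biFunctional_congr hV fun i j hij => by rw [hij]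

/-! ### The content functional of the shifted quotient -/

/-- The constant terms of the two binomial expansions cancel, and `choose(β+1, i+1)/(β+1) =
choose(β, i)/(i+1)` leaves the same weights as in the coefficients of `T_d`. This matches the linear
forms with the substitution. -/
theorem shiftHom_powDiff (β : ℕ) : shiftHom (powDiff (β + 1)) =
    ∑ i ∈ range (β + 1), ((-1 : ℂ) ^ (β - i) * (β.choose i : ℂ)) • powDiff (i + 1) := by
  rw [powDiff, map_mul, map_sub, map_pow, map_pow, shiftHom_X, shiftHom_X, X_sub_one_pow,
    X_sub_one_pow, ← sum_sub_distrib, sum_range_succ']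
  have hC : shiftHom (MvPolynomial.C (((β + 1 : ℕ) : ℂ)⁻¹)) = MvPolynomial.C (((β + 1 : ℕ) : ℂ)⁻¹) :=
    shiftHom.commutes _
  rw [hC, pow_zero, pow_zero, sub_self, add_zero, mul_sum]
  refine sum_congr rfl fun i _ => ?_
  have h1 : (((β + 1 : ℕ) : ℂ)⁻¹) * ((β + 1).choose (i + 1) : ℂ) =
      (β.choose i : ℂ) * ((i + 1 : ℕ) : ℂ)⁻¹ := by
    have h2 : (((β + 1) * β.choose i : ℕ) : ℂ) = (((β + 1).choose (i + 1) * (i + 1) : ℕ) : ℂ) :=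
      congrArg _ (Nat.add_one_mul_choose_eq β i)
    have h3 : ((β + 1 : ℕ) : ℂ) ≠ 0 := Nat.cast_ne_zero.mpr (Nat.succ_ne_zero _)
    have h4 : ((i + 1 : ℕ) : ℂ) ≠ 0 := Nat.cast_ne_zero.mpr (Nat.succ_ne_zero _)
    rw [Nat.cast_mul, Nat.cast_mul] at h2
    field_simp
    rw [h2]
  rw [powDiff, Nat.add_sub_add_right, ← smul_sub, MvPolynomial.smul_eq_C_mul,
    MvPolynomial.smul_eq_C_mul, ← mul_assoc, ← mul_assoc, ← map_mul, ← map_mul]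
  congr 2
  linear_combination ((-1 : ℂ) ^ (β - i)) * h1

/-- Expanding every factor writes the shifted quotient as a combination of ordinary quotients for
tuples `i_l + 1`. By polynomiality each contributes powers `(i_l + 1)^{d_l}`, and the binomial
weights turn these into differences. -/
theorem contentFunctional_shiftHom (r m : ℕ) {n M : ℕ} (hn : 1 ≤ n) (b : Fin n → ℕ+) {V : BiPoly}
    (hV : (MvPolynomial.X 0 - MvPolynomial.X 1) * V = ∏ l, powDiff (b l))
    (hM : ∀ e, MvPolynomial.coeff e (onePartPoly r m n) ≠ 0 → e.degree ≤ M) :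
    contentFunctional r m (shiftHom V) = ∑ d ∈ Fintype.piFinset fun _ : Fin n => range (M + 1),
      MvPolynomial.coeff (Finsupp.equivFunOnFinite.symm d) (onePartPoly r m n) *
        ∏ l, tCoeff (d l) (b l).natPred := by
  choose W hW using fun i : Fin n → ℕ => exists_quotient hn fun l => Nat.succPNat (i l)
  set I := Fintype.piFinset fun l => range ((b l).natPred + 1) with hI
  let c : (Fin n → ℕ) → ℂ := fun i =>
    ∏ l, ((-1 : ℂ) ^ ((b l).natPred - i l) * ((b l).natPred.choose (i l) : ℂ))
  have h1 : shiftHom V = ∑ i ∈ I, c i • W i := by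
    apply mul_left_cancel₀ X_sub_X_ne_zero
    have h2 := congrArg shiftHom hV
    rw [map_mul, map_sub, shiftHom_X, shiftHom_X, sub_sub_sub_cancel_right, map_prod] at h2
    rw [h2, mul_sum]
    have h3 : ∀ l, shiftHom (powDiff (b l)) = ∑ i ∈ range ((b l).natPred + 1),
        ((-1 : ℂ) ^ ((b l).natPred - i) * ((b l).natPred.choose i : ℂ)) • powDiff (i + 1) := by
      intro l
      rw [← shiftHom_powDiff, PNat.natPred_add_one]
    rw [prod_congr rfl fun l _ => h3 l, prod_univ_sum]
    refine sum_congr rfl fun i _ => ?_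
    rw [mul_smul_comm, hW, prod_smul]
    rfl
  have h2 : ∀ i, contentFunctional r m (W i) =
      ∑ d ∈ Fintype.piFinset fun _ : Fin n => range (M + 1),
        MvPolynomial.coeff (Finsupp.equivFunOnFinite.symm d) (onePartPoly r m n) *
          ∏ l, ((i l : ℂ) + 1) ^ d l := by
    intro i
    rw [contentFunctional_eq_eval r m hn _ (hW i), eval_eq_sum_piFinset hM]
    simp
  rw [h1, map_sum]
  simp only [map_smul, smul_eq_mul, h2, mul_sum]
  rw [sum_comm]
  refine sum_congr rfl fun d _ => ?_
  have h3 : ∏ l, tCoeff (d l) (b l).natPred = ∑ i ∈ I, c i * ∏ l, ((i l : ℂ) + 1) ^ d l := by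
    simp only [tCoeff, prod_univ_sum, ← hI, c, ← prod_mul_distrib]
  rw [h3, mul_sum]
  exact sum_congr rfl fun i _ => by ring

end CompletedHurwitz

end

/-! ### The coefficients of `G`, and its hook type. -/

noncomputable section

namespace CompletedHurwitz

open Finset

/-! ### The coefficients of the generating series -/

theorem exists_tuple (e : ℕ+ →₀ ℕ) :
    ∃ (n : ℕ) (b : Fin n → ℕ+), e = ∑ l, Finsupp.single (b l) 1 := by
  have h : ∀ M : Multiset ℕ+, ∃ (n : ℕ) (b : Fin n → ℕ+),
      Multiset.toFinsupp M = ∑ l, Finsupp.single (b l) 1 := by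
    intro M
    induction M using Multiset.induction_on with
    | empty => exact ⟨0, Fin.elim0, by simp⟩
    | cons a M ih =>
      obtain ⟨n, b, hb⟩ := ih
      refine ⟨n + 1, Fin.cons a b, ?_⟩
      rw [Fin.sum_univ_succ, ← Multiset.singleton_add, map_add, hb, Multiset.toFinsupp_singleton]
      simp only [Fin.cons_zero, Fin.cons_succ]
  obtain ⟨n, b, hb⟩ := h (Finsupp.toMultiset e)
  exact ⟨n, b, by rw [← hb, Finsupp.toMultiset_toFinsupp]⟩

theorem powDiffProd_sum_single {ι : Type*} (s : Finset ι) (b : ι → ℕ+) :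
    powDiffProd (∑ l ∈ s, Finsupp.single (b l) 1) = ∏ l ∈ s, powDiff (b l) := by
  classical
  induction s using Finset.induction_on with
  | empty => rw [sum_empty, prod_empty, powDiffProd_zero]
  | insert a s ha ih =>
    rw [sum_insert ha, prod_insert ha, powDiffProd_add, powDiffProd_single, ih]

theorem toMultiset_sum_single_univ {n : ℕ} (d : Fin n → ℕ) :
    Finsupp.toMultiset (∑ l, Finsupp.single (d l) 1) = univ.val.map d := by
  rw [map_sum]
  simp only [Finsupp.toMultiset_single, one_smul]
  have h := Multiset.sum_map_singleton (univ.val.map d)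
  rwa [Multiset.map_map] at h

theorem coeff_X_pow_mul_prod_tSeries (a j : ℕ) {n : ℕ} (d : Fin n → ℕ) (b : Fin n → ℕ+) :
    PowerSeries.coeff a (PowerSeries.X ^ (2 * j) * ∏ l, tSeries (d l) (b l)) =
      if a + ∑ l, (b l : ℕ) = 2 * j + ∑ l, d l + n then ∏ l, tCoeff (d l) (b l).natPred
        else 0 := by
  -- Where the truncated subtraction in the exponent of `u` would be wrong, the coefficient is a
  -- difference of order above the degree and vanishes.
  by_cases h : ∃ l, d l < (b l).natPred
  · obtain ⟨l, hl⟩ := h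
    have h1 : tSeries (d l) (b l) = 0 := by
      rw [tSeries, tCoeff_eq_zero hl, map_zero, zero_mul]
    rw [prod_eq_zero (mem_univ l) h1, prod_eq_zero (mem_univ l) (tCoeff_eq_zero hl), mul_zero,
      map_zero, ite_self]
  · push Not at h
    have h1 : ∏ l, tSeries (d l) (b l) = PowerSeries.C (∏ l, tCoeff (d l) (b l).natPred) *
        PowerSeries.X ^ (∑ l, (d l - (b l).natPred)) := by
      simp only [tSeries, prod_mul_distrib, map_prod, prod_pow_eq_pow_sum]
    have h2 : ∑ l, (d l - (b l).natPred) + ∑ l, (b l : ℕ) = ∑ l, d l + n := by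
      have h3 : ∀ l, d l - (b l).natPred + (b l : ℕ) = d l + 1 := by
        intro l
        have := PNat.natPred_add_one (b l)
        have := h l
        omega
      rw [← sum_add_distrib, sum_congr rfl fun l _ => h3 l, sum_add_distrib]
      simp
    rw [h1, mul_left_comm, ← pow_add, PowerSeries.coeff_C_mul_X_pow]
    refine if_congr ?_ rfl rfl
    omega

variable {r : ℕ} {N : ℕ → ℕ → Multiset ℕ → ℂ}

theorem factProd_mul_coeff_gTerm (N : ℕ → ℕ → Multiset ℕ → ℂ) (a g j : ℕ) (k : ℕ →₀ ℕ) {n : ℕ}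
    (b : Fin n → ℕ+) {S : Finset ℕ} (hS : k.support ⊆ S) :
    factProd (∑ l, Finsupp.single (b l) 1) * PowerSeries.coeff a
      (MvPolynomial.coeff (∑ l, Finsupp.single (b l) 1) (gTerm N g j k)) =
      ∑ d ∈ Fintype.piFinset fun _ : Fin n => S, if ∑ l, Finsupp.single (d l) 1 = k then
        (-1) ^ j * N g j (univ.val.map d) * (if a + ∑ l, (b l : ℕ) = 2 * j + ∑ l, d l + n then
          ∏ l, tCoeff (d l) (b l).natPred else 0) else 0 := by
  set e : ℕ+ →₀ ℕ := ∑ l, Finsupp.single (b l) 1 with he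
  have h1 : gTerm N g j k = (PowerSeries.C ((-1) ^ j * N g j (Finsupp.toMultiset k)) *
      PowerSeries.X ^ (2 * j)) • tProd k := rfl
  have h2 : factProd e * PowerSeries.coeff a (MvPolynomial.coeff e (gTerm N g j k)) =
      (-1) ^ j * N g j (Finsupp.toMultiset k) *
        PowerSeries.coeff a (PowerSeries.X ^ (2 * j) * (factProd e • MvPolynomial.coeff e (tProd k))) := by
    rw [h1, MvPolynomial.coeff_smul, smul_eq_mul, mul_assoc, PowerSeries.coeff_C_mul, mul_smul_comm,
      PowerSeries.coeff_smul, smul_eq_mul]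
    ring
  rw [h2, he, coeff_tProd b k hS, mul_sum, map_sum, mul_sum]
  refine sum_congr rfl fun d _ => ?_
  split_ifs with h3 h4
  · rw [coeff_X_pow_mul_prod_tSeries, if_pos h4, ← h3, toMultiset_sum_single_univ]
  · rw [coeff_X_pow_mul_prod_tSeries, if_neg h4, mul_zero, mul_zero]
  · rw [mul_zero, map_zero, mul_zero]

/-- The powers of `u` and of the `q_b` together determine `m`, and with `n` also `g`. Only finitely
many `j` and `k` are then left, so the sum defining a coefficient of `G` is finite. -/
theorem exists_of_coeff_gTerm_ne_zero (hr : 1 ≤ r) (hN : IsIntersectionNumbers r N) {a g j : ℕ}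
    {k : ℕ →₀ ℕ} {n : ℕ} {b : Fin n → ℕ+}
    (h : PowerSeries.coeff a
      (MvPolynomial.coeff (∑ l, Finsupp.single (b l) 1) (gTerm N g j k)) ≠ 0) :
    ∃ (m : ℕ) (d : Fin n → ℕ), 2 * g + n = r * m + 1 ∧ a + ∑ l, (b l : ℕ) = (r + 1) * m + 1 ∧
      j ≤ g ∧ ∑ l, Finsupp.single (d l) 1 = k ∧ ∑ l, d l + 2 * j = 2 * g + m ∧
      DimensionConstraint r g j (Finsupp.toMultiset k) := by
  have h1 := mul_ne_zero (factProd_ne_zero (∑ l, Finsupp.single (b l) 1)) h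
  rw [factProd_mul_coeff_gTerm N a g j k b (Subset.refl _)] at h1
  obtain ⟨d, -, hd⟩ := exists_ne_zero_of_sum_ne_zero h1
  rw [ite_ne_right_iff] at hd
  obtain ⟨hdk, hd⟩ := hd
  have hd2 := right_ne_zero_of_mul hd
  rw [ite_ne_right_iff] at hd2
  have hNd := right_ne_zero_of_mul (left_ne_zero_of_mul hd)
  have hdim := hN.dimension _ _ _ hNd
  obtain ⟨-, m, hm⟩ := exists_of_dimensionConstraint hr hdim
  rw [card_map_univ] at hm
  have h3 : ∑ l, d l + 2 * j = 2 * g + m :=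
    (dimensionConstraint_iff hr hm (card_map_univ d)).mp hdim
  refine ⟨m, d, hm, ?_, hN.index_le _ _ _ hNd, hdk, h3, ?_⟩
  · rw [hd2.1, add_one_mul]
    omega
  · rw [← hdk, toMultiset_sum_single_univ]
    exact hdim

/-- The summands excluded by the dimension constraint vanish anyway. -/
theorem coeff_G_eq_finsum (hr : 1 ≤ r) (hN : IsIntersectionNumbers r N) (a : ℕ) {n : ℕ}
    (b : Fin n → ℕ+) :
    PowerSeries.coeff a (MvPowerSeries.coeff (∑ l, Finsupp.single (b l) 1) (G r N)) =
      ∑ᶠ x : ℕ × ℕ × (ℕ →₀ ℕ), PowerSeries.coeff a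
        (MvPolynomial.coeff (∑ l, Finsupp.single (b l) 1) (gTerm N x.1 x.2.1 x.2.2)) := by
  have h1 : PowerSeries.coeff a (MvPowerSeries.coeff (∑ l, Finsupp.single (b l) 1) (G r N)) =
      ∑ᶠ x ∈ {x : ℕ × ℕ × (ℕ →₀ ℕ) |
        DimensionConstraint r x.1 x.2.1 (Finsupp.toMultiset x.2.2)}, PowerSeries.coeff a
        (MvPolynomial.coeff (∑ l, Finsupp.single (b l) 1) (gTerm N x.1 x.2.1 x.2.2)) := by
    rw [show MvPowerSeries.coeff (∑ l, Finsupp.single (b l) 1) (G r N) =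
      G r N (∑ l, Finsupp.single (b l) 1) from rfl, G, PowerSeries.coeff_mk]
  refine h1.trans (Eq.trans (finsum_mem_inter_support_eq _ _ Set.univ ?_) (finsum_mem_univ _))
  ext x
  simp only [Set.mem_inter_iff, Set.mem_ofPred_eq, Function.mem_support, Set.mem_univ, true_and,
    and_iff_right_iff_imp]
  intro hx
  obtain ⟨m, d, -, -, -, -, -, h⟩ := exists_of_coeff_gTerm_ne_zero hr hN hx
  exact h

theorem coeff_G_eq_zero (hr : 1 ≤ r) (hN : IsIntersectionNumbers r N) {a n : ℕ} {b : Fin n → ℕ+}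
    (h : ∀ g m, 2 * g + n = r * m + 1 → a + ∑ l, (b l : ℕ) ≠ (r + 1) * m + 1) :
    PowerSeries.coeff a (MvPowerSeries.coeff (∑ l, Finsupp.single (b l) 1) (G r N)) = 0 := by
  rw [coeff_G_eq_finsum hr hN]
  refine (finsum_congr fun x => ?_).trans finsum_zero
  by_contra hx
  obtain ⟨m, d, h1, h2, -⟩ := exists_of_coeff_gTerm_ne_zero hr hN hx
  exact h _ _ h1 h2

/-- Since `a` and `b` fix `m` and `g`, and each tuple `d` then allows at most one `j`, the triple
sum collapses to a sum over `d` with the coefficients of the one-part polynomial. -/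
theorem factProd_mul_coeff_G (hr : 1 ≤ r) (hN : IsIntersectionNumbers r N) {a g m n : ℕ}
    (hn : 1 ≤ n) {b : Fin n → ℕ+} (hm : 2 * g + n = r * m + 1)
    (ha : a + ∑ l, (b l : ℕ) = (r + 1) * m + 1) :
    factProd (∑ l, Finsupp.single (b l) 1) *
      PowerSeries.coeff a (MvPowerSeries.coeff (∑ l, Finsupp.single (b l) 1) (G r N)) =
      ∑ d ∈ Fintype.piFinset fun _ : Fin n => range (2 * g + m + 1),
        MvPolynomial.coeff (Finsupp.equivFunOnFinite.symm d) (onePartPoly r m n) *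
          ∏ l, tCoeff (d l) (b l).natPred := by
  classical
  set D := Fintype.piFinset fun _ : Fin n => range (2 * g + m + 1) with hD
  let κ : (Fin n → ℕ) → (ℕ →₀ ℕ) := fun d => ∑ l, Finsupp.single (d l) 1
  have hsupp : ∀ k ∈ D.image κ, k.support ⊆ range (2 * g + m + 1) := by
    intro k hk
    obtain ⟨d, hd, rfl⟩ := mem_image.mp hk
    rw [hD, Fintype.mem_piFinset] at hd
    intro i hi
    obtain ⟨l, -, hl⟩ := mem_biUnion.mp (Finsupp.support_finsetSum hi)
    rw [Finset.mem_singleton.mp (Finsupp.support_single_subset hl)]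
    exact hd l
  have h1 : ∑ᶠ x : ℕ × ℕ × (ℕ →₀ ℕ), PowerSeries.coeff a
        (MvPolynomial.coeff (∑ l, Finsupp.single (b l) 1) (gTerm N x.1 x.2.1 x.2.2)) =
      ∑ x ∈ {g} ×ˢ (range (g + 1) ×ˢ D.image κ), PowerSeries.coeff a
        (MvPolynomial.coeff (∑ l, Finsupp.single (b l) 1) (gTerm N x.1 x.2.1 x.2.2)) := by
    refine finsum_eq_sum_of_support_subset _ ?_
    rintro ⟨g', j, k⟩ hx
    obtain ⟨m', d, h2, h3, h4, h5, h6, -⟩ := exists_of_coeff_gTerm_ne_zero hr hN hx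
    have hmm : m' = m := by
      have : (r + 1) * m' = (r + 1) * m := by omega
      exact Nat.eq_of_mul_eq_mul_left (Nat.succ_pos r) this
    subst hmm
    simp only at h2 h4 h5 h6
    have hgg : g' = g := by omega
    subst hgg
    rw [mem_coe, mem_product, mem_product]
    refine ⟨mem_singleton_self _, mem_range.mpr (Nat.lt_succ_of_le h4), mem_image.mpr ⟨d, ?_, h5⟩⟩
    rw [hD, Fintype.mem_piFinset]
    intro l
    rw [mem_range]
    have := single_le_sum (f := d) (fun _ _ => Nat.zero_le _) (mem_univ l)
    omega
  rw [coeff_G_eq_finsum hr hN, h1, sum_product, sum_singleton, sum_product, mul_sum]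
  have h2 : ∀ j, factProd (∑ l, Finsupp.single (b l) 1) * ∑ k ∈ D.image κ, PowerSeries.coeff a
        (MvPolynomial.coeff (∑ l, Finsupp.single (b l) 1) (gTerm N g j k)) =
      ∑ d ∈ D, (-1) ^ j * N g j (univ.val.map d) *
        (if a + ∑ l, (b l : ℕ) = 2 * j + ∑ l, d l + n then
          ∏ l, tCoeff (d l) (b l).natPred else 0) := by
    intro j
    rw [mul_sum, sum_congr rfl fun k hk => factProd_mul_coeff_gTerm N a g j k b (hsupp k hk),
      sum_comm]
    refine sum_congr rfl fun d hd => ?_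
    rw [sum_ite_eq, if_pos (mem_image_of_mem κ hd)]
  rw [sum_congr rfl fun j _ => h2 j, sum_comm]
  refine sum_congr rfl fun d _ => ?_
  have hcond : ∀ j, a + ∑ l, (b l : ℕ) = 2 * j + ∑ l, d l + n ↔ ∑ l, d l + 2 * j = 2 * g + m := by
    intro j
    rw [ha, add_one_mul]
    omega
  simp only [hcond]
  by_cases hj : ∃ j ≤ g, ∑ l, d l + 2 * j = 2 * g + m
  · obtain ⟨j, hj, hdj⟩ := hj
    rw [sum_eq_single_of_mem j (mem_range.mpr (Nat.lt_succ_of_le hj)), if_pos hdj,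
      hN.eq_coeff hr hn hm hj d hdj]
    intro j' _ hne
    rw [if_neg (by omega), mul_zero]
  · have h0 : MvPolynomial.coeff (Finsupp.equivFunOnFinite.symm d) (onePartPoly r m n) = 0 := by
      by_contra h0
      obtain ⟨j, h3, h4⟩ := degree_le_of_coeff_onePartPoly_ne_zero hn hm h0
      rw [degree_equivFunOnFinite_symm] at h4
      exact hj ⟨j, h3, h4⟩
    rw [h0, zero_mul]
    refine sum_eq_zero fun j hj' => ?_
    rw [if_neg, mul_zero]
    exact fun h => hj ⟨j, Nat.lt_succ_iff.mp (mem_range.mp hj'), h⟩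

/-- The generating series is of hook type. -/
theorem isHookSeries_G (hr : 1 ≤ r) (hN : IsIntersectionNumbers r N) :
    IsHookSeries (seqSeries 1 (armSeries r)) (seqSeries (-1) (legSeries r)) (G r N) := by
  refine isHookSeries_of_coeff _ _ _ fun e he V hV => ?_
  obtain ⟨n, b, rfl⟩ := exists_tuple e
  have hn : 1 ≤ n := by
    rw [Nat.one_le_iff_ne_zero]
    rintro rfl
    exact he (by simp)
  rw [powDiffProd_sum_single] at hV
  have hw : 1 ≤ ∑ l, (b l : ℕ) := sum_pos (fun l _ => (b l).pos) ⟨⟨0, hn⟩, mem_univ _⟩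
  ext a
  rw [PowerSeries.coeff_smul, smul_eq_mul]
  -- The quotient `V` has degree `|b| - 1`, so multiplying by that power of `u` leads to the
  -- exponentiated contents of the shifted quotient, which contain only powers of `u^{r+1}`.
  have h1 : PowerSeries.coeff a (biFunctional (fun i j => armSeries r i * legSeries r j) V) =
      if r + 1 ∣ a + (∑ l, (b l : ℕ) - 1) then
        contentFunctional r ((a + (∑ l, (b l : ℕ) - 1)) / (r + 1)) (shiftHom V) else 0 := by
    rw [← coeff_biFunctional_contentExp, ← biFunctional_shiftHom,
      ← X_pow_mul_biFunctional _ _ (isHomogeneous_quotient hn b hV), PowerSeries.coeff_X_pow_mul]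
  rw [h1]
  split_ifs with hdvd
  · obtain ⟨m, hm⟩ := hdvd
    rw [hm, Nat.mul_div_cancel_left _ (Nat.succ_pos r)]
    have ha : a + ∑ l, (b l : ℕ) = (r + 1) * m + 1 := by omega
    by_cases hg : ∃ g, 2 * g + n = r * m + 1
    · obtain ⟨g, hg⟩ := hg
      rw [factProd_mul_coeff_G hr hN hn hg ha, contentFunctional_shiftHom r m hn b hV]
      intro e he
      obtain ⟨j, -, h⟩ := degree_le_of_coeff_onePartPoly_ne_zero hn hg he
      omega
    -- If no genus fits `n` and `m`, the one-part polynomial has no monomials at all, in agreement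
    -- with the missing terms of `G`.
    · have h0 : ∀ e, MvPolynomial.coeff e (onePartPoly r m n) = 0 := by
        intro e
        by_contra h
        obtain ⟨g, j, -, h2, -⟩ := degree_of_coeff_onePartPoly_ne_zero hn h
        exact hg ⟨g, h2⟩
      rw [coeff_G_eq_zero hr hN, mul_zero, contentFunctional_shiftHom (M := 0) r m hn b hV
        fun e he => absurd (h0 e) he]
      · exact (sum_eq_zero fun d _ => by rw [h0, zero_mul]).symm
      · intro g m' h2 h3
        have hmm : m' = m := by
          have : (r + 1) * m' = (r + 1) * m := by omega
          exact Nat.eq_of_mul_eq_mul_left (Nat.succ_pos r) this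
        exact hg ⟨g, hmm ▸ h2⟩
  · rw [coeff_G_eq_zero hr hN, mul_zero]
    intro g m _ h
    exact hdvd ⟨m, by omega⟩

end CompletedHurwitz

end

theorem theorem7p2 (r : ℕ) (hr : 1 ≤ r) :
    (∃! N : ℕ → ℕ → Multiset ℕ → ℂ, CompletedHurwitz.IsIntersectionNumbers r N) ∧
    ∀ N : ℕ → ℕ → Multiset ℕ → ℂ, CompletedHurwitz.IsIntersectionNumbers r N →
      ∀ (A : Type*) [CommRing A] [Algebra ℚ A] [Algebra (PowerSeries ℂ) A] (c : A),
        CompletedHurwitz.SolvesHirota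
          (MvPowerSeries.C c +
            MvPowerSeries.map (algebraMap (PowerSeries ℂ) A) (CompletedHurwitz.G r N)) := by
  refine ⟨⟨CompletedHurwitz.intersectionNumber r,
    CompletedHurwitz.isIntersectionNumbers_intersectionNumber hr,
    fun N hN => hN.unique hr (CompletedHurwitz.isIntersectionNumbers_intersectionNumber hr)⟩, ?_⟩
  intro N hN A _ _ _ c
  exact (((CompletedHurwitz.isHookSeries_G hr hN).map
    (algebraMap (PowerSeries ℂ) A)).C_add c).solvesHirota
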